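/- A \emph{mesh} is a plane straight-line graph with a finite vertex set all of whose bounded faces are triangles whose sides are edges of the graph; its \emph{size} is its number of vertices. A mesh is \emph{$\delta$-fat} if every angle of each of its triangles is at least $\delta$. A mesh $M$ is a \emph{Delaunay triangulation} of its vertices if its triangles cover the convex hull of its vertices and no vertex of $M$ lies strictly inside the circumcircle of a triangle of $M$. A convex polygon (a two-dimensional convex polygonal region, identified with its point set) \emph{respects} $M$ if its boundary is a union of edges of $M$; consecutive collinear edges are allowed on the boundary. \textbf{Theorem.} Let $0<\delta\le \pi/3$. There are a constant $C>0$ and an integer $N$, depending only on $\delta$, such that for every integer $n\ge N$ there exists a $\delta$-fat mesh $M$ of size exactly $n$ for which the number of convex polygons that respect $M$ is at least $$C\, n^{\frac12\left\lfloor \frac{2\pi}{\delta}\right\rfloor}.$$ Moreover, $M$ can be chosen to be a Delaunay triangulation of its vertices. -/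

import Mathlib

open EuclideanGeometry

/-- The Euclidean plane. -/
abbrev Plane : Type := EuclideanSpace ℝ (Fin 2)

/-- A plane straight-line graph with a finite set of vertices: edges are drawn as straight
segments, no vertex lies in the relative interior of an edge, and the relative interiors of two
different edges are disjoint. -/
structure PlaneGraph where
  /-- The vertices. -/
  verts : Finset Plane
  /-- The edges, as an adjacency relation between points of the plane. -/
  graph : SimpleGraph Plane
  mem_verts_of_adj : ∀ a b, graph.Adj a b → a ∈ verts
  vertex_notMem_edge : ∀ a b, graph.Adj a b → ∀ v ∈ verts, v ∉ openSegment ℝ a b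
  disjoint_edges : ∀ a b c d, graph.Adj a b → graph.Adj c d → s(a, b) ≠ s(c, d) →
    Disjoint (openSegment ℝ a b) (openSegment ℝ c d)

namespace PlaneGraph

/-- The size of a plane graph: its number of vertices. -/
def size (G : PlaneGraph) : ℕ := G.verts.card

/-- The set of points of the plane that are covered by the vertices and the edges. -/
def drawing (G : PlaneGraph) : Set Plane :=
  (G.verts : Set Plane) ∪ {x | ∃ a b, G.graph.Adj a b ∧ x ∈ segment ℝ a b}

/-- The faces: the connected components of the complement of the drawing. -/
def IsFace (G : PlaneGraph) (F : Set Plane) : Prop :=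
  ∃ x ∈ G.drawingᶜ, F = connectedComponentIn G.drawingᶜ x

/-- `a`, `b`, `c` are the corners of a triangle of `G`: a nondegenerate triangle whose sides are
edges of `G` and whose interior is a face of `G`. -/
def IsTriangle (G : PlaneGraph) (a b c : Plane) : Prop :=
  AffineIndependent ℝ ![a, b, c] ∧
  G.graph.Adj a b ∧ G.graph.Adj b c ∧ G.graph.Adj c a ∧
  G.IsFace (interior (convexHull ℝ {a, b, c}))

/-- A mesh: a plane straight-line graph all of whose bounded faces are triangles. -/
def IsMesh (G : PlaneGraph) : Prop :=
  ∀ F : Set Plane, G.IsFace F → Bornology.IsBounded F →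
    ∃ a b c, G.IsTriangle a b c ∧ F = interior (convexHull ℝ {a, b, c})

/-- `G` is `δ`-fat: every angle of every triangle of `G` is at least `δ`. -/
def IsFat (G : PlaneGraph) (δ : ℝ) : Prop :=
  ∀ a b c, G.IsTriangle a b c → δ ≤ ∠ a b c ∧ δ ≤ ∠ b c a ∧ δ ≤ ∠ c a b

/-- `G` is maximal: its triangles cover the convex hull of its vertices. -/
def IsMaximal (G : PlaneGraph) : Prop :=
  ∀ x ∈ convexHull ℝ (G.verts : Set Plane),
    ∃ a b c, G.IsTriangle a b c ∧ x ∈ convexHull ℝ {a, b, c}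

/-- `G` is a Delaunay triangulation of its vertices: it is a mesh that covers the convex hull of
its vertices, and no vertex lies strictly inside the circumcircle of a triangle of `G`. -/
def IsDelaunay (G : PlaneGraph) : Prop :=
  G.IsMesh ∧ G.IsMaximal ∧
  ∀ a b c, G.IsTriangle a b c →
    ∀ o : Plane, dist b o = dist a o → dist c o = dist a o →
      ∀ v ∈ G.verts, dist a o ≤ dist v o

end PlaneGraph

/-- A (nondegenerate) convex polygon, as a region of the plane. -/
def IsConvexPolygon (P : Set Plane) : Prop :=
  (∃ V : Finset Plane, P = convexHull ℝ (V : Set Plane)) ∧ (interior P).Nonempty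

namespace PlaneGraph

/-- The polygonal region `P` respects `G`: its boundary is made of edges of `G`. (Consecutive
collinear edges are allowed on the boundary.) -/
def IsRespectedBy (G : PlaneGraph) (P : Set Plane) : Prop :=
  ∃ S : Set (Plane × Plane), (∀ e ∈ S, G.graph.Adj e.1 e.2) ∧
    frontier P = ⋃ e ∈ S, segment ℝ e.1 e.2

/-- The convex polygons that respect `G`. -/
def convexPolygons (G : PlaneGraph) : Set (Set Plane) :=
  {P | IsConvexPolygon P ∧ G.IsRespectedBy P}

end PlaneGraph

/-!
Let `k = ⌊2π / δ⌋`, so that `k ≥ 6` and all angles may be as small as `θ = 2π / k ≥ δ`. The meshes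
have `k`-fold rotational symmetry: `k` wedges of angle `θ` meet at the origin, and each wedge
carries parallel rows of edges, orthogonal to its axis, that join up to concentric regular `k`-gons
(`RowMesh`). If a row lies on a line that is a union of edges through the whole mesh, then the mesh
can be cut along this line. Choosing one such row in each wedge, independently of the other wedges,
gives a convex polygon with `k` sides whose boundary consists of edges. With about `√n` admissible
rows per wedge these are of order `n ^ (k / 2)` polygons (`RowMesh.pow_le_ncard_convexPolygons`).

The line of a row meets the adjacent wedges. In order that it consists of edges there, the outer
rows are `a / τ` apart, where `cos θ = 1 / (1 + a)` and `τ = tan (θ / 2)` (`rowGap`): then the rows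
of two adjacent wedges cut a strip along their common ray into congruent parallelograms, and the
vertices of the mesh are the corners of these (`RowMesh.Sliced`, `RowMesh.Sliced.cut`). The inner
rows bound isosceles triangles with apex angle `θ`; they form a regular `k`-gon that no line of an
outer row enters. The remaining part of the outer rows is filled with triangles whose angles lie
between `θ` and `π / 2`; which subdivision is possible depends on the sign of `a ^ 2 + 2 a - 1`,
that is, on whether `k ≤ 8` (`coarseMesh`) or `k ≥ 8` (`fineMesh`).

All angles are at most `π / 2`, and this implies the Delaunay property
(`IsTriangulation.isDelaunay`): crossing a side of a triangle towards a vertex `v` does not increase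
the power of `v` with respect to the circumcircle, and can keep it only if both angles opposite to
the side are right, which cannot occur at two consecutive crossings. So the power is minimal at a
triangle with the corner `v`, where it is zero.

To reach every size `n` exactly, the mesh is restricted to one of the polygons bounded by rows, with
the row number `s i` in the wedge `i` (`IsTriangulation.restrict`). Its number of vertices is a
quadratic polynomial in the `s i` (`RowMesh.size_formula`). For `k ≥ 8` it takes all required values
by the four squares theorem (`exists_sq_add_eq`), for `k = 7` along an explicit family that is
linear in one parameter, and for `k = 6`, where the mesh is the triangular lattice, because
triangular numbers represent all residues modulo powers of two (`exists_triangular_residue`).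
-/

/-! ### Coordinates, convex hulls and triangles in the plane -/

/-- The two-dimensional cross product: twice the signed area spanned by two vectors. -/
def cross (u v : Plane) : ℝ := u 0 * v 1 - u 1 * v 0

lemma inner_eq_coord (u v : Plane) : inner ℝ u v = u 0 * v 0 + u 1 * v 1 := by
  simp [PiLp.inner_apply, Fin.sum_univ_two, mul_comm]

lemma plane_ext {u v : Plane} (h0 : u 0 = v 0) (h1 : u 1 = v 1) : u = v := by
  ext i
  fin_cases i
  · exact h0
  · exact h1

lemma continuous_cross (a b c : Plane) : Continuous fun x : Plane => cross (b - a) (x - c) := by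
  unfold cross
  fun_prop

lemma convex_cross_nonneg (a b c : Plane) : Convex ℝ {x : Plane | 0 ≤ cross (b - a) (x - c)} := by
  intro x hx y hy s t hs ht hst
  have : cross (b - a) (s • x + t • y - c)
      = s * cross (b - a) (x - c) + t * cross (b - a) (y - c) := by
    obtain rfl : t = 1 - s := by linarith
    simp only [cross, PiLp.sub_apply, PiLp.add_apply, PiLp.smul_apply, smul_eq_mul]
    ring
  simp only [Set.mem_ofPred_eq] at hx hy ⊢
  rw [this]
  positivity

/-- A point of a convex hull at which a linear functional attains its maximum over the generating
set lies in the convex hull of the generators where the maximum is attained. -/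
lemma mem_convexHull_face {E : Type*} [AddCommGroup E] [Module ℝ E] (F : E →ₗ[ℝ] ℝ) {S : Set E}
    {m : ℝ} {x : E} (hS : ∀ v ∈ S, F v ≤ m) (hx : x ∈ convexHull ℝ S) (hxm : F x = m) :
    x ∈ convexHull ℝ (S ∩ {v | F v = m}) := by
  have hsub : S ⊆ {y | F y ≤ m ∧ (F y = m → y ∈ convexHull ℝ (S ∩ {v | F v = m}))} :=
    fun v hv => ⟨hS v hv, fun h => subset_convexHull ℝ _ ⟨hv, h⟩⟩
  refine (convexHull_min hsub ?_ hx).2 hxm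
  intro y hy z hz s t hs ht hst
  have hF : F (s • y + t • z) = s * F y + t * F z := by simp
  have hy1 : F y ≤ m := hy.1
  have hz1 : F z ≤ m := hz.1
  obtain rfl : t = 1 - s := by linarith
  refine ⟨?_, fun h => ?_⟩
  · rw [hF]
    nlinarith [mul_le_mul_of_nonneg_left hy1 hs, mul_le_mul_of_nonneg_left hz1 ht]
  · rw [hF] at h
    rcases hs.eq_or_lt with rfl | hs'
    · simpa using hz.2 (by simpa using h)
    rcases ht.eq_or_lt with ht0 | ht'
    · obtain rfl : s = 1 := by linarith
      simpa using hy.2 (by simpa using h)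
    have h1 : F y = m := by
      refine le_antisymm hy1 ?_
      by_contra hlt
      push Not at hlt
      nlinarith [mul_lt_mul_of_pos_left hlt hs', mul_le_mul_of_nonneg_left hz1 ht]
    have h2 : F z = m := by
      refine le_antisymm hz1 ?_
      by_contra hlt
      push Not at hlt
      nlinarith [mul_lt_mul_of_pos_left hlt ht', mul_le_mul_of_nonneg_left hy1 hs]
    exact convex_convexHull ℝ _ (hy.2 h1) (hz.2 h2) hs ht hst

lemma mem_convexHull_triangle {a b c x : Plane} (h : 0 < cross (b - a) (c - a)) :
    x ∈ convexHull ℝ ({a, b, c} : Set Plane) ↔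
      0 ≤ cross (b - a) (x - a) ∧ 0 ≤ cross (c - b) (x - b) ∧ 0 ≤ cross (a - c) (x - c) := by
  constructor
  · intro hx
    refine ⟨?_, ?_, ?_⟩
    · refine convexHull_min (t := {x : Plane | 0 ≤ cross (b - a) (x - a)}) ?_
        (convex_cross_nonneg a b a) hx
      rintro y (rfl | rfl | rfl) <;> simp [cross] at h ⊢ <;> linarith
    · refine convexHull_min (t := {x : Plane | 0 ≤ cross (c - b) (x - b)}) ?_
        (convex_cross_nonneg b c b) hx
      rintro y (rfl | rfl | rfl) <;> simp [cross] at h ⊢ <;> linarith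
    · refine convexHull_min (t := {x : Plane | 0 ≤ cross (a - c) (x - c)}) ?_
        (convex_cross_nonneg c a c) hx
      rintro y (rfl | rfl | rfl) <;> simp [cross] at h ⊢ <;> linarith
  · rintro ⟨h1, h2, h3⟩
    set D := cross (b - a) (c - a) with hD
    have hw : ∑ i : Fin 3, ![cross (c - b) (x - b) / D, cross (a - c) (x - c) / D,
        cross (b - a) (x - a) / D] i = 1 := by
      simp only [Fin.sum_univ_three, Matrix.cons_val]
      field_simp
      simp only [cross, PiLp.sub_apply, hD]
      ring
    have hm := (convex_convexHull ℝ ({a, b, c} : Set Plane)).sum_mem (t := Finset.univ)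
      (w := ![cross (c - b) (x - b) / D, cross (a - c) (x - c) / D, cross (b - a) (x - a) / D])
      (z := ![a, b, c])
      (by intro i _; fin_cases i <;> simp <;> positivity) hw
      (by intro i _; fin_cases i <;> exact subset_convexHull ℝ _ (by simp))
    convert hm using 1
    have hD' : D ≠ 0 := h.ne'
    apply plane_ext <;>
    · simp only [Fin.sum_univ_three, Matrix.cons_val, PiLp.add_apply, PiLp.smul_apply, smul_eq_mul]
      field_simp
      simp only [cross, PiLp.sub_apply, hD]
      ring

lemma mem_interior_triangle {a b c x : Plane} (h : 0 < cross (b - a) (c - a)) :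
    x ∈ interior (convexHull ℝ ({a, b, c} : Set Plane)) ↔
      0 < cross (b - a) (x - a) ∧ 0 < cross (c - b) (x - b) ∧ 0 < cross (a - c) (x - c) := by
  constructor
  · intro hx
    have hmem := (mem_convexHull_triangle h).1 (interior_subset hx)
    -- a point with a vanishing barycentric coordinate can be moved out of the triangle
    have key : ∀ u : Plane, ∃ e : ℝ, 0 < e ∧ x - e • u ∈ convexHull ℝ ({a, b, c} : Set Plane) := by
      intro u
      have hcont : Filter.Tendsto (fun e : ℝ => x - e • u) (nhdsWithin 0 (Set.Ioi 0)) (nhds x) := by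
        have : Filter.Tendsto (fun e : ℝ => x - e • u) (nhds 0) (nhds (x - (0 : ℝ) • u)) :=
          (Continuous.tendsto (by fun_prop) 0)
        simp only [zero_smul, sub_zero] at this
        exact this.mono_left nhdsWithin_le_nhds
      have := hcont.eventually (mem_interior_iff_mem_nhds.1 hx)
      obtain ⟨e, he, he'⟩ := (this.and self_mem_nhdsWithin).exists
      exact ⟨e, he', he⟩
    refine ⟨lt_of_le_of_ne hmem.1 fun h0 => ?_, lt_of_le_of_ne hmem.2.1 fun h0 => ?_,
      lt_of_le_of_ne hmem.2.2 fun h0 => ?_⟩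
    · obtain ⟨e, he, hm⟩ := key (c - a)
      have := ((mem_convexHull_triangle h).1 hm).1
      have e1 : cross (b - a) (x - e • (c - a) - a)
          = cross (b - a) (x - a) - e * cross (b - a) (c - a) := by
        simp only [cross, PiLp.sub_apply, PiLp.smul_apply, smul_eq_mul]; ring
      rw [e1, ← h0] at this
      nlinarith
    · obtain ⟨e, he, hm⟩ := key (a - b)
      have := ((mem_convexHull_triangle h).1 hm).2.1
      have e1 : cross (c - b) (x - e • (a - b) - b)
          = cross (c - b) (x - b) - e * cross (b - a) (c - a) := by
        simp only [cross, PiLp.sub_apply, PiLp.smul_apply, smul_eq_mul]; ring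
      rw [e1, ← h0] at this
      nlinarith
    · obtain ⟨e, he, hm⟩ := key (b - c)
      have := ((mem_convexHull_triangle h).1 hm).2.2
      have e1 : cross (a - c) (x - e • (b - c) - c)
          = cross (a - c) (x - c) - e * cross (b - a) (c - a) := by
        simp only [cross, PiLp.sub_apply, PiLp.smul_apply, smul_eq_mul]; ring
      rw [e1, ← h0] at this
      nlinarith
  · rintro ⟨h1, h2, h3⟩
    have hopen : IsOpen {x : Plane | 0 < cross (b - a) (x - a) ∧ 0 < cross (c - b) (x - b) ∧
        0 < cross (a - c) (x - c)} :=
      ((isOpen_lt continuous_const (continuous_cross a b a)).inter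
        ((isOpen_lt continuous_const (continuous_cross b c b)).inter
          (isOpen_lt continuous_const (continuous_cross c a c))))
    refine interior_maximal ?_ hopen ⟨h1, h2, h3⟩
    rintro y ⟨y1, y2, y3⟩
    exact (mem_convexHull_triangle h).2 ⟨y1.le, y2.le, y3.le⟩

/-- A point of a nondegenerate triangle on the line through two corners is on that side. -/
lemma mem_side_of_cross_eq_zero {a b c x : Plane} (h : 0 < cross (b - a) (c - a))
    (hx : x ∈ convexHull ℝ ({a, b, c} : Set Plane)) (h0 : cross (b - a) (x - a) = 0) :
    x ∈ segment ℝ a b := by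
  obtain ⟨-, h2, h3⟩ := (mem_convexHull_triangle h).1 hx
  set D := cross (b - a) (c - a) with hD
  have hD' : D ≠ 0 := h.ne'
  have hsum : cross (c - b) (x - b) + cross (a - c) (x - c) = D - cross (b - a) (x - a) := by
    simp only [cross, PiLp.sub_apply, hD]; ring
  refine ⟨cross (c - b) (x - b) / D, cross (a - c) (x - c) / D, by positivity, by positivity,
    ?_, ?_⟩
  · rw [← add_div, hsum, h0, sub_zero, div_self hD']
  · apply plane_ext
    · have : D * x 0 = cross (c - b) (x - b) * a 0 + cross (a - c) (x - c) * b 0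
          + cross (b - a) (x - a) * c 0 := by
        simp only [cross, PiLp.sub_apply, hD]; ring
      rw [h0] at this
      simp only [PiLp.add_apply, PiLp.smul_apply, smul_eq_mul]
      field_simp
      linarith
    · have : D * x 1 = cross (c - b) (x - b) * a 1 + cross (a - c) (x - c) * b 1
          + cross (b - a) (x - a) * c 1 := by
        simp only [cross, PiLp.sub_apply, hD]; ring
      rw [h0] at this
      simp only [PiLp.add_apply, PiLp.smul_apply, smul_eq_mul]
      field_simp
      linarith

lemma affineIndependent_of_cross_ne_zero {a b c : Plane} (h : cross (b - a) (c - a) ≠ 0) :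
    AffineIndependent ℝ ![a, b, c] := by
  rw [affineIndependent_iff_linearIndependent_vsub ℝ _ (0 : Fin 3)]
  have hli : LinearIndependent ℝ ![b - a, c - a] := by
    rw [LinearIndependent.pair_iff]
    intro s t hst
    have e0 := congrFun (congrArg WithLp.ofLp hst) 0
    have e1 := congrFun (congrArg WithLp.ofLp hst) 1
    simp only [PiLp.add_apply, PiLp.smul_apply, smul_eq_mul, PiLp.zero_apply] at e0 e1
    constructor
    · have : s * cross (b - a) (c - a) = 0 := by
        unfold cross
        linear_combination (c - a) 1 * e0 - (c - a) 0 * e1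
      exact (mul_eq_zero.1 this).resolve_right h
    · have : t * cross (b - a) (c - a) = 0 := by
        unfold cross
        linear_combination (b - a) 0 * e1 - (b - a) 1 * e0
      exact (mul_eq_zero.1 this).resolve_right h
  let e : Fin 2 ≃ {x : Fin 3 // x ≠ 0} :=
    { toFun := fun i => ⟨i.succ, Fin.succ_ne_zero i⟩
      invFun := fun x => x.1.pred x.2
      left_inv := fun i => by simp
      right_inv := fun x => by simp }
  rw [← linearIndependent_equiv e]
  have hfun : (fun i : {x : Fin 3 // x ≠ 0} => ![a, b, c] i -ᵥ ![a, b, c] 0) ∘ e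
      = ![b - a, c - a] := by
    funext i
    fin_cases i <;> simp [e]
  rw [hfun]
  exact hli

/-- Convex hulls of sets of corners of one nondegenerate triangle meet in a common face. -/
lemma convexHull_inter_of_subset_triangle {a b c : Plane} (h : cross (b - a) (c - a) ≠ 0)
    {s t : Set Plane} (hs : s ⊆ {a, b, c}) (ht : t ⊆ {a, b, c}) :
    convexHull ℝ s ∩ convexHull ℝ t ⊆ convexHull ℝ (s ∩ t) := by
  classical
  have hfin : ({a, b, c} : Set Plane).Finite := by simp
  obtain ⟨s', rfl⟩ := (hfin.subset hs).exists_finset_coe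
  obtain ⟨t', rfl⟩ := (hfin.subset ht).exists_finset_coe
  have hai := (affineIndependent_of_cross_ne_zero h).range
  have hr : Set.range ![a, b, c] = (({a, b, c} : Finset Plane) : Set Plane) := by
    ext y
    simp [eq_comm]
    tauto
  rw [hr] at hai
  rw [AffineIndependent.convexHull_inter hai]
  · intro y hy
    simpa using hs hy
  · intro y hy
    simpa using ht hy

/-! ### Triangulations of convex regions -/

/-- A triangulation of a convex region `Ω` of the plane by finitely many nondegenerate triangles,
each given by the set of its three corners. Two triangles meet in a common face: the convex hull of
their common corners. -/
structure IsTriangulation (𝒯 : Set (Set Plane)) (Ω : Set Plane) : Prop where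
  finite : 𝒯.Finite
  triangle : ∀ t ∈ 𝒯, ∃ a b c, t = {a, b, c} ∧ 0 < cross (b - a) (c - a)
  inter : ∀ s ∈ 𝒯, ∀ t ∈ 𝒯, convexHull ℝ s ∩ convexHull ℝ t ⊆ convexHull ℝ (s ∩ t)
  cover : ∀ x, x ∈ Ω ↔ ∃ t ∈ 𝒯, x ∈ convexHull ℝ t
  convex : Convex ℝ Ω

lemma cross_cycle (a b c : Plane) : cross (c - b) (a - b) = cross (b - a) (c - a) := by
  simp only [cross, PiLp.sub_apply]; ring

lemma ne_of_cross_pos {a b c : Plane} (h : 0 < cross (b - a) (c - a)) :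
    a ≠ b ∧ b ≠ c ∧ c ≠ a := by
  refine ⟨?_, ?_, ?_⟩ <;> rintro rfl <;> simp [cross] at h
  rw [mul_comm] at h
  exact lt_irrefl _ h

namespace IsTriangulation

variable {𝒯 : Set (Set Plane)} {Ω : Set Plane}

lemma finite_mem (h : IsTriangulation 𝒯 Ω) {t : Set Plane} (ht : t ∈ 𝒯) : t.Finite := by
  obtain ⟨a, b, c, rfl, -⟩ := h.triangle t ht
  simp

lemma isClosed_hull (h : IsTriangulation 𝒯 Ω) {t : Set Plane} (ht : t ∈ 𝒯) :
    IsClosed (convexHull ℝ t) := (h.finite_mem ht).isClosed_convexHull ℝ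

lemma finite_verts (h : IsTriangulation 𝒯 Ω) : (⋃₀ 𝒯).Finite :=
  h.finite.sUnion fun _ ht => h.finite_mem ht

lemma hull_subset (h : IsTriangulation 𝒯 Ω) {t : Set Plane} (ht : t ∈ 𝒯) :
    convexHull ℝ t ⊆ Ω := fun x hx => (h.cover x).2 ⟨t, ht, hx⟩

lemma inter_subset (h : IsTriangulation 𝒯 Ω) {s t s' t' : Set Plane} (hs : s ∈ 𝒯) (ht : t ∈ 𝒯)
    (hs' : s' ⊆ s) (ht' : t' ⊆ t) :
    convexHull ℝ s' ∩ convexHull ℝ t' ⊆ convexHull ℝ (s' ∩ t') := by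
  rintro x ⟨hxs, hxt⟩
  have hx := h.inter s hs t ht ⟨convexHull_mono hs' hxs, convexHull_mono ht' hxt⟩
  obtain ⟨a, b, c, rfl, hc⟩ := h.triangle s hs
  have h1 := convexHull_inter_of_subset_triangle hc.ne' hs' Set.inter_subset_left ⟨hxs, hx⟩
  obtain ⟨a', b', c', rfl, hc'⟩ := h.triangle t ht
  have h2 := convexHull_inter_of_subset_triangle hc'.ne'
    (s := s' ∩ ({a, b, c} ∩ {a', b', c'})) (fun y hy => hy.2.2) ht' ⟨h1, hxt⟩
  have h3 : s' ∩ ({a, b, c} ∩ {a', b', c'}) ∩ t' ⊆ s' ∩ t' := fun y hy => ⟨hy.1.1, hy.2⟩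
  exact convexHull_mono h3 h2

/-- A vertex of a triangulation lying in a triangle is one of its corners. -/
lemma mem_of_mem_hull (h : IsTriangulation 𝒯 Ω) {v : Plane} (hv : v ∈ ⋃₀ 𝒯) {t : Set Plane}
    (ht : t ∈ 𝒯) (hvt : v ∈ convexHull ℝ t) : v ∈ t := by
  obtain ⟨s, hs, hvs⟩ := hv
  have := h.inter_subset hs ht (s' := {v}) (by simpa using hvs) subset_rfl ⟨by simp, hvt⟩
  by_contra hne
  have h0 : ({v} ∩ t : Set Plane) = ∅ := by
    rw [Set.singleton_inter_eq_empty]; exact hne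
  rw [h0, convexHull_empty] at this
  exact this

/-- The edge graph of a family of triangles. -/
def edgeGraph (𝒯 : Set (Set Plane)) : SimpleGraph Plane where
  Adj a b := a ≠ b ∧ ∃ t ∈ 𝒯, a ∈ t ∧ b ∈ t
  symm := ⟨fun _ _ ⟨h, t, ht, ha, hb⟩ => ⟨h.symm, t, ht, hb, ha⟩⟩
  loopless := ⟨fun _ h => h.1 rfl⟩

/-- The plane straight-line graph formed by the corners and sides of a triangulation. -/
noncomputable def toPlaneGraph (h : IsTriangulation 𝒯 Ω) : PlaneGraph where
  verts := h.finite_verts.toFinset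
  graph := edgeGraph 𝒯
  mem_verts_of_adj := by
    rintro a b ⟨-, t, ht, ha, -⟩
    exact h.finite_verts.mem_toFinset.2 ⟨t, ht, ha⟩
  vertex_notMem_edge := by
    rintro a b ⟨hab, t, ht, ha, hb⟩ v hv hvo
    obtain ⟨s, hs, hvs⟩ := h.finite_verts.mem_toFinset.1 hv
    have hab' : ({a, b} : Set Plane) ⊆ t := by rintro x (rfl | rfl) <;> assumption
    have := h.inter_subset hs ht (s' := {v}) (by simpa using hvs) hab'
      ⟨subset_convexHull ℝ _ (Set.mem_singleton v),
        by rw [convexHull_pair]; exact openSegment_subset_segment ℝ a b hvo⟩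
    have hv' : v ∈ ({a, b} : Set Plane) := by
      by_contra hne
      have h0 : ({v} ∩ {a, b} : Set Plane) = ∅ := by
        rw [Set.singleton_inter_eq_empty]; exact hne
      rw [h0, convexHull_empty] at this
      exact this
    rcases hv' with rfl | hv'
    · exact hab ((left_mem_openSegment_iff).1 hvo)
    · rw [Set.mem_singleton_iff.1 hv'] at hvo
      exact hab ((right_mem_openSegment_iff).1 hvo)
  disjoint_edges := by
    rintro a b c d ⟨hab, t, ht, ha, hb⟩ ⟨hcd, s, hs, hc, hd⟩ hne
    rw [Set.disjoint_left]
    intro x hx1 hx2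
    have hab' : ({a, b} : Set Plane) ⊆ t := by rintro x (rfl | rfl) <;> assumption
    have hcd' : ({c, d} : Set Plane) ⊆ s := by rintro x (rfl | rfl) <;> assumption
    have := h.inter_subset ht hs hab' hcd'
      ⟨by rw [convexHull_pair]; exact openSegment_subset_segment ℝ a b hx1,
        by rw [convexHull_pair]; exact openSegment_subset_segment ℝ c d hx2⟩
    have ha' : x ≠ a := by
      rintro rfl; exact hab ((left_mem_openSegment_iff).1 hx1)
    have hb' : x ≠ b := by
      rintro rfl; exact hab ((right_mem_openSegment_iff).1 hx1)
    -- the common part of two different edges is at most one end point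
    by_cases h1 : a ∈ ({c, d} : Set Plane)
    · by_cases h2 : b ∈ ({c, d} : Set Plane)
      · apply hne
        rcases h1 with rfl | h1 <;> rcases h2 with rfl | h2
        · exact absurd rfl hab
        · rw [Set.mem_singleton_iff.1 h2]
        · rw [Set.mem_singleton_iff.1 h1, Sym2.eq_swap]
        · exact absurd (h1.trans h2.symm) hab
      · have hsub : ({a, b} ∩ {c, d} : Set Plane) ⊆ {a} := by
          rintro y ⟨rfl | hy, hy'⟩
          · rfl
          · rw [Set.mem_singleton_iff.1 hy] at hy'
            exact absurd hy' h2
        have := convexHull_mono hsub this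
        rw [convexHull_singleton] at this
        exact ha' this
    · have hsub : ({a, b} ∩ {c, d} : Set Plane) ⊆ {b} := by
        rintro y ⟨rfl | hy, hy'⟩
        · exact absurd hy' h1
        · exact hy
      have := convexHull_mono hsub this
      rw [convexHull_singleton] at this
      exact hb' this

@[simp] lemma mem_verts_toPlaneGraph (h : IsTriangulation 𝒯 Ω) {v : Plane} :
    v ∈ h.toPlaneGraph.verts ↔ v ∈ ⋃₀ 𝒯 := h.finite_verts.mem_toFinset

lemma adj_toPlaneGraph (h : IsTriangulation 𝒯 Ω) {a b : Plane} :
    h.toPlaneGraph.graph.Adj a b ↔ a ≠ b ∧ ∃ t ∈ 𝒯, a ∈ t ∧ b ∈ t := Iff.rfl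

lemma drawing_subset (h : IsTriangulation 𝒯 Ω) {x : Plane} (hx : x ∈ h.toPlaneGraph.drawing) :
    ∃ a b, x ∈ segment ℝ a b ∧ ∃ t ∈ 𝒯, a ∈ t ∧ b ∈ t := by
  rcases hx with hx | ⟨a, b, hab, hx⟩
  · obtain ⟨t, ht, hxt⟩ := h.mem_verts_toPlaneGraph.1 hx
    exact ⟨x, x, by simp, t, ht, hxt, hxt⟩
  · obtain ⟨-, t, ht, ha, hb⟩ := h.adj_toPlaneGraph.1 hab
    exact ⟨a, b, hx, t, ht, ha, hb⟩

lemma interior_subset_compl_drawing (h : IsTriangulation 𝒯 Ω) {t : Set Plane} (ht : t ∈ 𝒯) :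
    interior (convexHull ℝ t) ⊆ h.toPlaneGraph.drawingᶜ := by
  intro x hx hxd
  obtain ⟨p, q, hpq, s, hs, hp, hq⟩ := h.drawing_subset hxd
  have hpq' : ({p, q} : Set Plane) ⊆ s := by rintro x (rfl | rfl) <;> assumption
  have hmem := h.inter_subset ht hs subset_rfl hpq' ⟨interior_subset hx, by rwa [convexHull_pair]⟩
  obtain ⟨a, b, c, rfl, hc⟩ := h.triangle t ht
  obtain ⟨h1, h2, h3⟩ := (mem_interior_triangle hc).1 hx
  obtain ⟨nab, nbc, nca⟩ := ne_of_cross_pos hc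
  -- one corner is missing from the edge `p q`, so its barycentric coordinate vanishes
  have key : ∀ u v w : Plane, cross (v - u) (w - u) = cross (b - a) (c - a) →
      ({a, b, c} : Set Plane) = {u, v, w} → w ∉ ({p, q} : Set Plane) →
      cross (v - u) (x - u) ≤ 0 := by
    intro u v w huv hset hw
    have hsub : ({a, b, c} ∩ {p, q} : Set Plane) ⊆ {u, v} := by
      rintro y ⟨hy, hy'⟩
      rw [hset] at hy
      rcases hy with hy | hy | hy
      · exact Or.inl hy
      · exact Or.inr hy
      · rw [Set.mem_singleton_iff.1 hy] at hy'
        exact absurd hy' hw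
    have hx' := convexHull_mono hsub hmem
    rw [convexHull_pair] at hx'
    obtain ⟨α, β, -, -, hαβ, rfl⟩ := hx'
    obtain rfl : β = 1 - α := by linarith
    simp only [cross, PiLp.sub_apply, PiLp.add_apply, PiLp.smul_apply, smul_eq_mul]
    nlinarith
  by_cases hc' : c ∈ ({p, q} : Set Plane)
  · by_cases hb' : b ∈ ({p, q} : Set Plane)
    · have ha' : a ∉ ({p, q} : Set Plane) := by
        rintro (ha | ha) <;> rcases hb' with hb' | hb' <;> rcases hc' with hc' | hc' <;>
          simp_all
      have := key b c a (by simp only [cross, PiLp.sub_apply]; ring)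
        (by ext y; simp; tauto) ha'
      linarith
    · have := key c a b (by simp only [cross, PiLp.sub_apply]; ring)
        (by ext y; simp; tauto) hb'
      linarith
  · have := key a b c rfl rfl hc'
    linarith

lemma mem_drawing_or_interior (h : IsTriangulation 𝒯 Ω) {t : Set Plane} (ht : t ∈ 𝒯) {x : Plane}
    (hx : x ∈ convexHull ℝ t) :
    x ∈ h.toPlaneGraph.drawing ∨ x ∈ interior (convexHull ℝ t) := by
  obtain ⟨a, b, c, rfl, hc⟩ := h.triangle t ht
  obtain ⟨nab, nbc, nca⟩ := ne_of_cross_pos hc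
  have hc2 : 0 < cross (c - b) (a - b) := by rw [cross_cycle]; exact hc
  have hc3 : 0 < cross (a - c) (b - c) := by rw [cross_cycle, cross_cycle]; exact hc
  obtain ⟨h1, h2, h3⟩ := (mem_convexHull_triangle hc).1 hx
  by_cases e1 : cross (b - a) (x - a) = 0
  · exact Or.inl (Or.inr ⟨a, b, ⟨nab, _, ht, by simp, by simp⟩,
      mem_side_of_cross_eq_zero hc hx e1⟩)
  by_cases e2 : cross (c - b) (x - b) = 0
  · refine Or.inl (Or.inr ⟨b, c, ⟨nbc, _, ht, by simp, by simp⟩,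
      mem_side_of_cross_eq_zero hc2 ?_ e2⟩)
    convert hx using 2
    ext y; simp; tauto
  by_cases e3 : cross (a - c) (x - c) = 0
  · refine Or.inl (Or.inr ⟨c, a, ⟨nca, _, ht, by simp, by simp⟩,
      mem_side_of_cross_eq_zero hc3 ?_ e3⟩)
    convert hx using 2
    ext y; simp; tauto
  exact Or.inr ((mem_interior_triangle hc).2 ⟨lt_of_le_of_ne h1 (Ne.symm e1),
    lt_of_le_of_ne h2 (Ne.symm e2), lt_of_le_of_ne h3 (Ne.symm e3)⟩)

/-- An open triangle is a full connected component of the complement of the drawing: its boundary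
belongs to the drawing, so that it is both open and closed in this complement. -/
lemma connectedComponentIn_eq (h : IsTriangulation 𝒯 Ω) {t : Set Plane} (ht : t ∈ 𝒯) {x : Plane}
    (hx : x ∈ interior (convexHull ℝ t)) :
    connectedComponentIn h.toPlaneGraph.drawingᶜ x = interior (convexHull ℝ t) := by
  apply Set.Subset.antisymm
  · have hpre := isPreconnected_connectedComponentIn (x := x) (F := h.toPlaneGraph.drawingᶜ)
    have hsub : connectedComponentIn h.toPlaneGraph.drawingᶜ x ⊆
        interior (convexHull ℝ t) ∪ (convexHull ℝ t)ᶜ := by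
      intro y hy
      by_cases hyt : y ∈ convexHull ℝ t
      · rcases h.mem_drawing_or_interior ht hyt with hd | hi
        · exact absurd hd (connectedComponentIn_subset _ _ hy)
        · exact Or.inl hi
      · exact Or.inr hyt
    rcases hpre.subset_or_subset isOpen_interior (h.isClosed_hull ht).isOpen_compl
      (Set.disjoint_left.2 fun y hy hy' => hy' (interior_subset hy)) hsub with hl | hr
    · exact hl
    · exact absurd (interior_subset hx)
        (hr (mem_connectedComponentIn (h.interior_subset_compl_drawing ht hx)))
  · exact ((convex_convexHull ℝ t).interior.isPreconnected).subset_connectedComponentIn hx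
      (h.interior_subset_compl_drawing ht)

lemma interior_nonempty (h : IsTriangulation 𝒯 Ω) {t : Set Plane} (ht : t ∈ 𝒯) :
    (interior (convexHull ℝ t)).Nonempty := by
  obtain ⟨a, b, c, rfl, hc⟩ := h.triangle t ht
  refine ⟨(3 : ℝ)⁻¹ • (a + b + c), (mem_interior_triangle hc).2 ⟨?_, ?_, ?_⟩⟩ <;>
  · simp only [cross, PiLp.sub_apply, PiLp.add_apply, PiLp.smul_apply, smul_eq_mul] at hc ⊢
    nlinarith

lemma isFace_interior (h : IsTriangulation 𝒯 Ω) {t : Set Plane} (ht : t ∈ 𝒯) :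
    h.toPlaneGraph.IsFace (interior (convexHull ℝ t)) := by
  obtain ⟨x, hx⟩ := h.interior_nonempty ht
  exact ⟨x, h.interior_subset_compl_drawing ht hx, (h.connectedComponentIn_eq ht hx).symm⟩

/-- The bounded faces are the open triangles: from a point outside the convex region one can
escape to infinity along a ray. -/
lemma eq_interior_of_isFace (h : IsTriangulation 𝒯 Ω) (hne : 𝒯.Nonempty) {F : Set Plane}
    (hF : h.toPlaneGraph.IsFace F) (hb : Bornology.IsBounded F) :
    ∃ t ∈ 𝒯, F = interior (convexHull ℝ t) := by
  obtain ⟨x, hx, rfl⟩ := hF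
  by_cases hxΩ : x ∈ Ω
  · obtain ⟨t, ht, hxt⟩ := (h.cover x).1 hxΩ
    rcases h.mem_drawing_or_interior ht hxt with hd | hi
    · exact absurd hd hx
    · exact ⟨t, ht, h.connectedComponentIn_eq ht hi⟩
  exfalso
  obtain ⟨t, ht⟩ := hne
  obtain ⟨o, ho⟩ := h.interior_nonempty ht
  have hoΩ : o ∈ Ω := h.hull_subset ht (interior_subset ho)
  set R : Set Plane := (fun s : ℝ => x + s • (x - o)) '' Set.Ici 0 with hR
  have hRΩ : ∀ y ∈ R, y ∉ Ω := by
    rintro _ ⟨s, hs, rfl⟩ hy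
    have hs' : (0 : ℝ) ≤ s := hs
    apply hxΩ
    have hpos : (0 : ℝ) < 1 + s := by linarith
    have := h.convex hy hoΩ (a := 1 / (1 + s)) (b := s / (1 + s)) (by positivity) (by positivity)
      (by field_simp)
    convert this using 1
    apply plane_ext <;>
    · simp only [PiLp.sub_apply, PiLp.add_apply, PiLp.smul_apply, smul_eq_mul]
      field_simp
      ring
  have hRsub : R ⊆ connectedComponentIn h.toPlaneGraph.drawingᶜ x := by
    refine IsPreconnected.subset_connectedComponentIn ?_ ⟨0, by simp, by simp⟩ ?_
    · exact isPreconnected_Ici.image _ (by fun_prop)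
    · intro y hy hyd
      obtain ⟨p, q, hpq, s, hs, hp, hq⟩ := h.drawing_subset hyd
      apply hRΩ y hy
      apply h.hull_subset hs
      exact (convex_convexHull ℝ s).segment_subset (subset_convexHull ℝ s hp)
        (subset_convexHull ℝ s hq) hpq
  have hRb := hb.subset hRsub
  obtain ⟨C, hC⟩ := hRb.exists_norm_le
  have hxo : 0 < ‖x - o‖ := by
    rw [norm_pos_iff, sub_ne_zero]
    rintro rfl
    exact hxΩ hoΩ
  have hC0 : 0 ≤ C := (norm_nonneg _).trans (hC x ⟨0, by simp, by simp⟩)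
  set s : ℝ := (C + ‖x‖ + 1) / ‖x - o‖ with hs
  have hs0 : 0 ≤ s := by positivity
  have h1 := hC (x + s • (x - o)) ⟨s, hs0, rfl⟩
  have h2 : ‖s • (x - o)‖ = C + ‖x‖ + 1 := by
    rw [norm_smul, Real.norm_of_nonneg hs0, hs]
    field_simp
  have h3 : ‖s • (x - o)‖ ≤ ‖x + s • (x - o)‖ + ‖x‖ := by
    calc ‖s • (x - o)‖ = ‖(x + s • (x - o)) - x‖ := by congr 1; abel
      _ ≤ _ := norm_sub_le _ _
  linarith

lemma isTriangle_of_mem (h : IsTriangulation 𝒯 Ω) {a b c : Plane} (ht : {a, b, c} ∈ 𝒯)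
    (hc : cross (b - a) (c - a) ≠ 0) (hd : a ≠ b ∧ b ≠ c ∧ c ≠ a) :
    h.toPlaneGraph.IsTriangle a b c :=
  ⟨affineIndependent_of_cross_ne_zero hc, ⟨hd.1, _, ht, by simp, by simp⟩,
    ⟨hd.2.1, _, ht, by simp, by simp⟩, ⟨hd.2.2, _, ht, by simp, by simp⟩, h.isFace_interior ht⟩

lemma mem_of_isTriangle (h : IsTriangulation 𝒯 Ω) {a b c : Plane}
    (habc : h.toPlaneGraph.IsTriangle a b c) : ({a, b, c} : Set Plane) ∈ 𝒯 := by
  obtain ⟨-, hab, hbc, hca, hF⟩ := habc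
  obtain ⟨nab, t₀, ht₀, ha, hb⟩ := h.adj_toPlaneGraph.1 hab
  obtain ⟨nbc, t₁, ht₁, hb₁, hc⟩ := h.adj_toPlaneGraph.1 hbc
  obtain ⟨nca, -⟩ := h.adj_toPlaneGraph.1 hca
  have hfin : ({a, b, c} : Set Plane).Finite := by simp
  have hbdd : Bornology.IsBounded (interior (convexHull ℝ ({a, b, c} : Set Plane))) :=
    (hfin.isCompact_convexHull ℝ).isBounded.subset interior_subset
  obtain ⟨t, ht, heq⟩ := h.eq_interior_of_isFace ⟨t₀, ht₀⟩ hF hbdd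
  have hint : (interior (convexHull ℝ ({a, b, c} : Set Plane))).Nonempty := by
    rw [heq]; exact h.interior_nonempty ht
  have hcl : convexHull ℝ ({a, b, c} : Set Plane) ⊆ convexHull ℝ t := by
    calc convexHull ℝ ({a, b, c} : Set Plane)
        ⊆ closure (convexHull ℝ ({a, b, c} : Set Plane)) := subset_closure
      _ = closure (interior (convexHull ℝ ({a, b, c} : Set Plane))) :=
        ((convex_convexHull ℝ _).closure_interior_eq_closure_of_nonempty_interior hint).symm
      _ ⊆ convexHull ℝ t := by
        rw [heq]
        exact closure_minimal interior_subset (h.isClosed_hull ht)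
  have ha' := h.mem_of_mem_hull ⟨t₀, ht₀, ha⟩ ht (hcl (subset_convexHull ℝ _ (by simp)))
  have hb' := h.mem_of_mem_hull ⟨t₀, ht₀, hb⟩ ht (hcl (subset_convexHull ℝ _ (by simp)))
  have hc' := h.mem_of_mem_hull ⟨t₁, ht₁, hc⟩ ht (hcl (subset_convexHull ℝ _ (by simp)))
  obtain ⟨p, q, r, rfl, -⟩ := h.triangle t ht
  convert ht using 1
  simp only [Set.mem_insert_iff, Set.mem_singleton_iff] at ha' hb' hc'
  rcases ha' with rfl | rfl | rfl <;> rcases hb' with rfl | rfl | rfl <;>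
    rcases hc' with rfl | rfl | rfl <;> first
    | exact absurd rfl nab | exact absurd rfl nbc | exact absurd rfl nca
    | (ext y; simp; try tauto)

theorem isMesh (h : IsTriangulation 𝒯 Ω) (hne : 𝒯.Nonempty) : h.toPlaneGraph.IsMesh := by
  intro F hF hb
  obtain ⟨t, ht, rfl⟩ := h.eq_interior_of_isFace hne hF hb
  obtain ⟨a, b, c, rfl, hc⟩ := h.triangle t ht
  exact ⟨a, b, c, h.isTriangle_of_mem ht hc.ne' (ne_of_cross_pos hc), rfl⟩

theorem isMaximal (h : IsTriangulation 𝒯 Ω) : h.toPlaneGraph.IsMaximal := by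
  intro x hx
  have hsub : (h.toPlaneGraph.verts : Set Plane) ⊆ Ω := by
    intro v hv
    obtain ⟨t, ht, hvt⟩ := h.mem_verts_toPlaneGraph.1 hv
    exact h.hull_subset ht (subset_convexHull ℝ t hvt)
  obtain ⟨t, ht, hxt⟩ := (h.cover x).1 (convexHull_min hsub h.convex hx)
  obtain ⟨a, b, c, rfl, hc⟩ := h.triangle t ht
  exact ⟨a, b, c, h.isTriangle_of_mem ht hc.ne' (ne_of_cross_pos hc), hxt⟩

end IsTriangulation

/-! ### Delaunay property of nonobtuse triangulations -/

lemma dist_sq_eq (u v : Plane) : dist u v ^ 2 = (u 0 - v 0) ^ 2 + (u 1 - v 1) ^ 2 := by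
  rw [EuclideanSpace.dist_eq, Real.sq_sqrt (Finset.sum_nonneg fun i _ => by positivity),
    Fin.sum_univ_two, Real.dist_eq, Real.dist_eq, sq_abs, sq_abs]

lemma exists_circumcenter {a b c : Plane} (h : cross (b - a) (c - a) ≠ 0) :
    ∃ (o : Plane) (ρ : ℝ), ∀ x ∈ ({a, b, c} : Set Plane), dist x o ^ 2 = ρ := by
  set D := cross (b - a) (c - a) with hD
  set U := (b 0 - a 0) ^ 2 + (b 1 - a 1) ^ 2 with hU
  set W := (c 0 - a 0) ^ 2 + (c 1 - a 1) ^ 2 with hW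
  set p := (U * (c 1 - a 1) - W * (b 1 - a 1)) / (2 * D) with hp
  set q := (W * (b 0 - a 0) - U * (c 0 - a 0)) / (2 * D) with hq
  have e1 : 2 * ((b 0 - a 0) * p + (b 1 - a 1) * q) = U := by
    rw [hp, hq]
    field_simp
    simp only [hD, cross, PiLp.sub_apply]
    ring
  have e2 : 2 * ((c 0 - a 0) * p + (c 1 - a 1) * q) = W := by
    rw [hp, hq]
    field_simp
    simp only [hD, cross, PiLp.sub_apply]
    ring
  refine ⟨!₂[a 0 + p, a 1 + q], p ^ 2 + q ^ 2, ?_⟩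
  rintro x (rfl | rfl | rfl)
  · rw [dist_sq_eq]; simp
  · rw [dist_sq_eq]; simp; linear_combination hU - e1
  · rw [dist_sq_eq]; simp; linear_combination hW - e2

/-- The power of a point with respect to a circle through `a` and `b`, in terms of the pencil of
circles through these two points. -/
lemma power_pencil {a b o : Plane} {ρ : ℝ} (ha : dist a o ^ 2 = ρ) (hb : dist b o ^ 2 = ρ)
    (x : Plane) :
    inner ℝ (b - a) (b - a) * (dist x o ^ 2 - ρ) =
      inner ℝ (b - a) (b - a) * inner ℝ (a - x) (b - x)
        - 2 * cross (b - a) (o - a) * cross (b - a) (x - a) := by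
  rw [dist_sq_eq] at ha hb ⊢
  simp only [inner_eq_coord, cross, PiLp.sub_apply]
  linear_combination ((x 0 - a 0) * (b 0 - a 0) + (x 1 - a 1) * (b 1 - a 1)) * (hb - ha)
    + ((b 0 - a 0) ^ 2 + (b 1 - a 1) ^ 2) * ha

lemma inner_self_pos {a b : Plane} (h : a ≠ b) : 0 < inner ℝ (b - a) (b - a) := by
  rw [real_inner_self_eq_norm_sq]
  have : 0 < ‖b - a‖ := norm_pos_iff.2 (sub_ne_zero.2 h.symm)
  positivity

/-- The power of a point with respect to the circumcircle of a triangle depends only on the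
triangle. -/
lemma power_eq_of_circumcenters {a b c o o' : Plane} {ρ ρ' : ℝ} (h : cross (b - a) (c - a) ≠ 0)
    (hab : a ≠ b) (ho : ∀ x ∈ ({a, b, c} : Set Plane), dist x o ^ 2 = ρ)
    (ho' : ∀ x ∈ ({a, b, c} : Set Plane), dist x o' ^ 2 = ρ') (v : Plane) :
    dist v o ^ 2 - ρ = dist v o' ^ 2 - ρ' := by
  have hN := inner_self_pos hab
  have e1 := power_pencil (ho a (by simp)) (ho b (by simp))
  have e2 := power_pencil (ho' a (by simp)) (ho' b (by simp))
  have c1 := e1 c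
  have c2 := e2 c
  rw [ho c (by simp)] at c1
  rw [ho' c (by simp)] at c2
  have hK : cross (b - a) (o - a) = cross (b - a) (o' - a) := by
    apply mul_right_cancel₀ h
    linarith
  have v1 := e1 v
  have v2 := e2 v
  rw [hK] at v1
  exact mul_left_cancel₀ hN.ne' (v1.trans v2.symm)

/-- Crossing a side `a b` from a triangle `a b c` to its neighbour `a b d` does not increase the
power of a point `v` beyond that side, as long as the angles at `c` and `d` are not obtuse; the
power decreases strictly if one of these angles is acute. -/
lemma power_le_power_of_neighbor {a b c d o o' v : Plane} {ρ ρ' : ℝ} (hab : a ≠ b)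
    (ho : ∀ x ∈ ({a, b, c} : Set Plane), dist x o ^ 2 = ρ)
    (ho' : ∀ x ∈ ({a, b, d} : Set Plane), dist x o' ^ 2 = ρ')
    (hc : 0 < cross (b - a) (c - a)) (hd : cross (b - a) (d - a) < 0)
    (hv : cross (b - a) (v - a) < 0) (hc' : 0 ≤ inner ℝ (a - c) (b - c))
    (hd' : 0 ≤ inner ℝ (a - d) (b - d)) :
    dist v o' ^ 2 - ρ' ≤ dist v o ^ 2 - ρ ∧
      (0 < inner ℝ (a - c) (b - c) ∨ 0 < inner ℝ (a - d) (b - d) →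
        dist v o' ^ 2 - ρ' < dist v o ^ 2 - ρ) := by
  have hN := inner_self_pos hab
  have e1 := power_pencil (ho a (by simp)) (ho b (by simp))
  have e2 := power_pencil (ho' a (by simp)) (ho' b (by simp))
  have c1 := e1 c
  have c2 := e2 d
  rw [ho c (by simp)] at c1
  rw [ho' d (by simp)] at c2
  have v1 := e1 v
  have v2 := e2 v
  set N := inner ℝ (b - a) (b - a)
  set K := cross (b - a) (o - a)
  set K' := cross (b - a) (o' - a)
  have hK : 0 ≤ K := by
    by_contra hneg
    push Not at hneg
    nlinarith [mul_nonneg hN.le hc', mul_pos_of_neg_of_neg hneg (neg_lt_zero.2 hc)]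
  have hK' : K' ≤ 0 := by
    by_contra hneg
    push Not at hneg
    nlinarith [mul_nonneg hN.le hd', mul_pos hneg (neg_pos.2 hd)]
  have hdiff : N * ((dist v o ^ 2 - ρ) - (dist v o' ^ 2 - ρ'))
      = 2 * (K - K') * (-cross (b - a) (v - a)) := by
    linear_combination v1 - v2
  constructor
  · have : 0 ≤ N * ((dist v o ^ 2 - ρ) - (dist v o' ^ 2 - ρ')) := by
      rw [hdiff]
      exact mul_nonneg (by linarith) (by linarith)
    have := nonneg_of_mul_nonneg_right this hN
    linarith
  · intro hs
    have hlt : 0 < K - K' := by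
      rcases hs with hs | hs
      · have : K ≠ 0 := by
          intro h0
          rw [h0] at c1
          nlinarith [mul_pos hN hs]
        have : 0 < K := lt_of_le_of_ne hK this.symm
        linarith
      · have : K' ≠ 0 := by
          intro h0
          rw [h0] at c2
          nlinarith [mul_pos hN hs]
        have : K' < 0 := lt_of_le_of_ne hK' this
        linarith
    have : 0 < N * ((dist v o ^ 2 - ρ) - (dist v o' ^ 2 - ρ')) := by
      rw [hdiff]
      exact mul_pos (by linarith) (by linarith)
    have := pos_of_mul_pos_right this hN.le
    linarith

namespace IsTriangulation

variable {𝒯 : Set (Set Plane)} {Ω : Set Plane}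

/-- If a sequence in the region converges, one triangle contains the limit and infinitely many
terms. -/
lemma exists_triangle_of_tendsto (h : IsTriangulation 𝒯 Ω) {x : ℕ → Plane} {y : Plane}
    (hx : ∀ n, x n ∈ Ω) (hy : Filter.Tendsto x Filter.atTop (nhds y)) :
    ∃ t ∈ 𝒯, y ∈ convexHull ℝ t ∧ ∃ᶠ n in Filter.atTop, x n ∈ convexHull ℝ t := by
  have : ∃ t ∈ 𝒯, ∃ᶠ n in Filter.atTop, x n ∈ convexHull ℝ t := by
    by_contra hcon
    simp only [not_exists, not_and, Filter.not_frequently] at hcon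
    have hcon' := (Filter.eventually_all_finite h.finite).2 hcon
    obtain ⟨n, hn⟩ := hcon'.exists
    obtain ⟨t, ht, hxt⟩ := (h.cover _).1 (hx n)
    exact hn t ht hxt
  obtain ⟨t, ht, hfr⟩ := this
  exact ⟨t, ht, (h.isClosed_hull ht).mem_of_frequently_of_tendsto hfr hy, hfr⟩

lemma tendsto_add_smul (p u : Plane) :
    Filter.Tendsto (fun n : ℕ => p + (1 / ((n : ℝ) + 1)) • u) Filter.atTop (nhds p) := by
  have h1 := (tendsto_one_div_add_atTop_nhds_zero_nat (𝕜 := ℝ)).smul_const u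
  have h2 := h1.const_add p
  simpa using h2

/-- A side of a triangle beyond which there is a point of the region is shared with a triangle on
the other side. -/
lemma exists_neighbor (h : IsTriangulation 𝒯 Ω) {a b c v : Plane} (ht : {a, b, c} ∈ 𝒯)
    (hab : a ≠ b) (hv : v ∈ Ω) (hcv : cross (b - a) (v - a) < 0) :
    ∃ d, {a, b, d} ∈ 𝒯 ∧ cross (b - a) (d - a) < 0 := by
  set p : Plane := (1 / 2 : ℝ) • a + (1 / 2 : ℝ) • b with hp
  have hpseg : p ∈ convexHull ℝ ({a, b} : Set Plane) := by
    rw [convexHull_pair]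
    exact ⟨1 / 2, 1 / 2, by norm_num, by norm_num, by norm_num, rfl⟩
  have habt : ({a, b} : Set Plane) ⊆ {a, b, c} := by
    rintro x (rfl | rfl) <;> simp
  have hpΩ : p ∈ Ω := h.hull_subset ht (convexHull_mono habt hpseg)
  have hpa : p ≠ a := by
    intro h0
    apply hab
    have h0' : ∀ i, p i = a i := fun i => by rw [h0]
    simp only [hp, PiLp.add_apply, PiLp.smul_apply, smul_eq_mul] at h0'
    apply plane_ext <;> [linarith [h0' 0]; linarith [h0' 1]]
  have hpb : p ≠ b := by
    intro h0
    apply hab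
    have h0' : ∀ i, p i = b i := fun i => by rw [h0]
    simp only [hp, PiLp.add_apply, PiLp.smul_apply, smul_eq_mul] at h0'
    apply plane_ext <;> [linarith [h0' 0]; linarith [h0' 1]]
  obtain ⟨t', ht', hpt', hfr⟩ := h.exists_triangle_of_tendsto
    (x := fun n : ℕ => p + (1 / ((n : ℝ) + 1)) • (v - p)) (y := p) (fun n => by
      have hn : (0 : ℝ) ≤ n := n.cast_nonneg
      have := h.convex hpΩ hv (a := 1 - 1 / ((n : ℝ) + 1)) (b := 1 / ((n : ℝ) + 1))
        (by rw [sub_nonneg, div_le_one (by positivity)]; linarith) (by positivity) (by ring)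
      convert this using 1
      module) (tendsto_add_smul p _)
  obtain ⟨n, hn⟩ := hfr.exists
  -- the midpoint of the side lies in the new triangle, so both end points are corners of it
  have hmem := h.inter_subset ht ht' habt subset_rfl ⟨hpseg, hpt'⟩
  have ha' : a ∈ t' := by
    by_contra hna
    have hsub : ({a, b} ∩ t' : Set Plane) ⊆ {b} := by
      rintro y ⟨rfl | hy, hy'⟩
      · exact absurd hy' hna
      · exact hy
    have := convexHull_mono hsub hmem
    rw [convexHull_singleton] at this
    exact hpb this
  have hb' : b ∈ t' := by
    by_contra hnb
    have hsub : ({a, b} ∩ t' : Set Plane) ⊆ {a} := by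
      rintro y ⟨rfl | hy, hy'⟩
      · rfl
      · rw [Set.mem_singleton_iff.1 hy] at hy'
        exact absurd hy' hnb
    have := convexHull_mono hsub hmem
    rw [convexHull_singleton] at this
    exact hpa this
  -- some corner lies strictly beyond the side
  have hd : ∃ d ∈ t', cross (b - a) (d - a) < 0 := by
    by_contra hcon
    push Not at hcon
    have h1 : 0 ≤ cross (b - a) (p + (1 / ((n : ℝ) + 1)) • (v - p) - a) :=
      convexHull_min (t := {x : Plane | 0 ≤ cross (b - a) (x - a)}) hcon
        (convex_cross_nonneg a b a) hn
    have h2 : cross (b - a) (p + (1 / ((n : ℝ) + 1)) • (v - p) - a)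
        = 1 / ((n : ℝ) + 1) * cross (b - a) (v - a) := by
      simp only [cross, hp, PiLp.sub_apply, PiLp.add_apply, PiLp.smul_apply, smul_eq_mul]
      ring
    have h3 : 0 < 1 / ((n : ℝ) + 1) := by positivity
    rw [h2] at h1
    nlinarith
  obtain ⟨d, hd, hdc⟩ := hd
  refine ⟨d, ?_, hdc⟩
  have hda : d ≠ a := by rintro rfl; simp [cross] at hdc
  have hdb : d ≠ b := by
    rintro rfl
    have : cross (d - a) (d - a) = 0 := by simp only [cross]; ring
    linarith
  obtain ⟨q, r, s, rfl, -⟩ := h.triangle t' ht'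
  convert ht' using 1
  simp only [Set.mem_insert_iff, Set.mem_singleton_iff] at ha' hb' hd
  rcases ha' with rfl | rfl | rfl <;> rcases hb' with rfl | rfl | rfl <;>
    rcases hd with rfl | rfl | rfl <;> first
    | exact absurd rfl hab | exact absurd rfl hda | exact absurd rfl hdb
    | (ext y; simp; try tauto)

lemma cross_ne_zero (h : IsTriangulation 𝒯 Ω) {a b c : Plane} (ht : {a, b, c} ∈ 𝒯) (hab : a ≠ b)
    (hbc : b ≠ c) (hca : c ≠ a) : cross (b - a) (c - a) ≠ 0 := by
  obtain ⟨p, q, r, heq, hpos⟩ := h.triangle _ ht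
  have ha : a ∈ ({p, q, r} : Set Plane) := by rw [← heq]; simp
  have hb : b ∈ ({p, q, r} : Set Plane) := by rw [← heq]; simp
  have hc : c ∈ ({p, q, r} : Set Plane) := by rw [← heq]; simp
  simp only [Set.mem_insert_iff, Set.mem_singleton_iff] at ha hb hc
  clear heq ht
  have e : ∀ x y z : Plane, cross (y - x) (z - x)
      = (y 0 - x 0) * (z 1 - x 1) - (y 1 - x 1) * (z 0 - x 0) := fun _ _ _ => rfl
  rw [e] at hpos ⊢
  rcases ha with rfl | rfl | rfl <;> rcases hb with rfl | rfl | rfl <;>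
    rcases hc with rfl | rfl | rfl <;> first
    | exact absurd rfl hab | exact absurd rfl hbc | exact absurd rfl hca
    | (intro h0; nlinarith)

/-- In a triangulation of a convex region without obtuse angles, no vertex lies inside the
circumcircle of a triangle: from a triangle for which the power of a vertex is minimal one could
otherwise cross a side towards this vertex, and decrease the power. -/
theorem isDelaunay (h : IsTriangulation 𝒯 Ω) (hne : 𝒯.Nonempty)
    (hno : ∀ t ∈ 𝒯, ∀ a b c, t = {a, b, c} → 0 ≤ inner ℝ (b - a) (c - a)) :
    h.toPlaneGraph.IsDelaunay := by
  refine ⟨h.isMesh hne, h.isMaximal, ?_⟩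
  have hex : ∀ t, ∃ (o : Plane) (ρ : ℝ), t ∈ 𝒯 → ∀ x ∈ t, dist x o ^ 2 = ρ := by
    intro t
    by_cases ht : t ∈ 𝒯
    · obtain ⟨a, b, c, rfl, hc⟩ := h.triangle t ht
      obtain ⟨o, ρ, ho⟩ := exists_circumcenter hc.ne'
      exact ⟨o, ρ, fun _ => ho⟩
    · exact ⟨0, 0, fun h0 => absurd h0 ht⟩
  choose o ρ ho using hex
  have main : ∀ v ∈ ⋃₀ 𝒯, ∀ t ∈ 𝒯, 0 ≤ dist v (o t) ^ 2 - ρ t := by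
    intro v hv
    by_contra hcon
    push Not at hcon
    obtain ⟨t₁, ht₁, hneg₁⟩ := hcon
    have hvΩ : v ∈ Ω := by
      obtain ⟨s, hs, hvs⟩ := hv
      exact h.hull_subset hs (subset_convexHull ℝ s hvs)
    obtain ⟨t, ht, hmin⟩ := Set.exists_min_image 𝒯 (fun t => dist v (o t) ^ 2 - ρ t) h.finite hne
    have hneg : dist v (o t) ^ 2 - ρ t < 0 := (hmin t₁ ht₁).trans_lt hneg₁
    have hout : ∀ s ∈ 𝒯, dist v (o s) ^ 2 - ρ s < 0 → v ∉ convexHull ℝ s := by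
      intro s hs hs0 hvs
      rw [ho s hs v (h.mem_of_mem_hull hv hs hvs)] at hs0
      linarith
    have step : ∀ s ∈ 𝒯, dist v (o s) ^ 2 - ρ s = dist v (o t) ^ 2 - ρ t → ∀ a b c, s = {a, b, c} →
        0 < cross (b - a) (c - a) → cross (b - a) (v - a) < 0 →
        inner ℝ (a - c) (b - c) ≤ 0 ∧ ∃ d, {a, b, d} ∈ 𝒯 ∧ cross (b - a) (d - a) < 0 ∧
          inner ℝ (a - d) (b - d) = 0 ∧
          dist v (o {a, b, d}) ^ 2 - ρ {a, b, d} = dist v (o t) ^ 2 - ρ t := by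
      rintro s hs hst a b c rfl hc hcv
      have hab := (ne_of_cross_pos hc).1
      obtain ⟨d, hd, hdc⟩ := h.exists_neighbor hs hab hvΩ hcv
      have hc' := hno _ hs c a b (by ext y; simp; tauto)
      have hd' := hno _ hd d a b (by ext y; simp; tauto)
      obtain ⟨h1, h2⟩ := power_le_power_of_neighbor hab (ho _ hs) (ho _ hd) hc hdc hcv hc' hd'
      have hm : dist v (o t) ^ 2 - ρ t ≤ dist v (o {a, b, d}) ^ 2 - ρ {a, b, d} := hmin _ hd
      have hnot : ¬ (0 < inner ℝ (a - c) (b - c) ∨ 0 < inner ℝ (a - d) (b - d)) := by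
        intro hs0
        have := h2 hs0
        linarith
      push Not at hnot
      exact ⟨hnot.1, d, hd, hdc, le_antisymm hnot.2 hd', by linarith⟩
    have final : ∀ a b c, t = {a, b, c} → 0 < cross (b - a) (c - a) →
        cross (b - a) (v - a) < 0 → False := by
      intro a b c hteq hc hcv
      obtain ⟨-, d, hd, hdc, hd0, hdeq⟩ := step t ht rfl a b c hteq hc hcv
      -- the neighbour has a right angle at `d`, so its other two angles are acute
      have hc2 : 0 < cross (a - b) (d - b) := by
        have : cross (a - b) (d - b) = - cross (b - a) (d - a) := by
          simp only [cross, PiLp.sub_apply]; ring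
        linarith
      have hv2 : 0 < cross (a - b) (v - b) := by
        have : cross (a - b) (v - b) = - cross (b - a) (v - a) := by
          simp only [cross, PiLp.sub_apply]; ring
        linarith
      have hset : ({a, b, d} : Set Plane) = {b, a, d} := by ext y; simp; tauto
      have hvout := hout _ hd (by linarith)
      rw [hset, mem_convexHull_triangle hc2] at hvout
      obtain ⟨-, hda, hbd⟩ := ne_of_cross_pos hc2
      by_cases h1 : cross (d - a) (v - a) < 0
      · have := (step _ hd hdeq a d b (by ext y; simp; tauto)
          (by rw [cross_cycle b a d]; exact hc2) h1).1
        have e : inner ℝ (a - b) (d - b) = inner ℝ (d - b) (d - b) - inner ℝ (a - d) (b - d) := by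
          simp only [inner_eq_coord, PiLp.sub_apply]; ring
        have := inner_self_pos hbd.symm
        linarith
      · have h2 : cross (b - d) (v - d) < 0 := by
          by_contra h2
          exact hvout ⟨hv2.le, not_lt.1 h1, not_lt.1 h2⟩
        have := (step _ hd hdeq d b a (by ext y; simp; tauto)
          (by rw [← cross_cycle, cross_cycle]
              rw [← cross_cycle]; exact hc2) h2).1
        have e : inner ℝ (d - a) (b - a) = inner ℝ (d - a) (d - a) - inner ℝ (a - d) (b - d) := by
          simp only [inner_eq_coord, PiLp.sub_apply]; ring
        have := inner_self_pos hda
        linarith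
    obtain ⟨a, b, c, hteq, hc⟩ := h.triangle t ht
    have hvt := hout t ht hneg
    rw [hteq, mem_convexHull_triangle hc] at hvt
    have f1 := mt (final a b c hteq hc) (by simp)
    have f2 := mt (final b c a (by rw [hteq]; ext y; simp; tauto)
      (by rw [cross_cycle]; exact hc)) (by simp)
    have f3 := mt (final c a b (by rw [hteq]; ext y; simp; tauto)
      (by rw [cross_cycle, cross_cycle]; exact hc)) (by simp)
    exact hvt ⟨not_lt.1 f1, not_lt.1 f2, not_lt.1 f3⟩
  intro a b c habc p hb hc v hv
  have ht := h.mem_of_isTriangle habc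
  have hab := habc.2.1.ne
  have hcr := h.cross_ne_zero ht hab habc.2.2.1.ne habc.2.2.2.1.ne
  have hp : ∀ x ∈ ({a, b, c} : Set Plane), dist x p ^ 2 = dist a p ^ 2 := by
    rintro x (rfl | rfl | rfl)
    · rfl
    · rw [hb]
    · rw [hc]
  have h0 := main v (h.mem_verts_toPlaneGraph.1 hv) _ ht
  rw [← power_eq_of_circumcenters hcr hab hp (ho _ ht) v] at h0
  exact abs_le_of_sq_le_sq' (by linarith) dist_nonneg |>.2

end IsTriangulation

/-! ### Angles -/

/-- An angle in the first quadrant is at least `θ` if its tangent, the quotient of the cross product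
and the scalar product, is at least `tan θ`. -/
lemma le_angle_of_inner_le {a b c : Plane} {θ : ℝ} (h0 : 0 ≤ θ) (hπ : θ ≤ Real.pi / 2)
    (hD : cross (b - a) (c - a) ≠ 0) (hI : 0 ≤ inner ℝ (b - a) (c - a))
    (h : inner ℝ (b - a) (c - a) * Real.sin θ ≤ Real.cos θ * |cross (b - a) (c - a)|) :
    θ ≤ ∠ b a c := by
  have hcos : 0 ≤ Real.cos θ := Real.cos_nonneg_of_neg_pi_div_two_le_of_le (by linarith) hπ
  have hsin : 0 ≤ Real.sin θ := Real.sin_nonneg_of_nonneg_of_le_pi h0 (by linarith)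
  have hlag : inner ℝ (b - a) (c - a) ^ 2 + cross (b - a) (c - a) ^ 2
      = (‖b - a‖ * ‖c - a‖) ^ 2 := by
    rw [mul_pow, ← real_inner_self_eq_norm_sq, ← real_inner_self_eq_norm_sq]
    simp only [inner_eq_coord, cross]
    ring
  have hpos : 0 < ‖b - a‖ * ‖c - a‖ := by
    have : 0 < (‖b - a‖ * ‖c - a‖) ^ 2 := by rw [← hlag]; positivity
    exact lt_of_le_of_ne (by positivity) (by rintro h1; rw [← h1] at this; norm_num at this)
  have hsq : inner ℝ (b - a) (c - a) ^ 2 ≤ (Real.cos θ * (‖b - a‖ * ‖c - a‖)) ^ 2 := by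
    have h1 : (inner ℝ (b - a) (c - a) * Real.sin θ) ^ 2
        ≤ (Real.cos θ * |cross (b - a) (c - a)|) ^ 2 := pow_le_pow_left₀ (by positivity) h 2
    rw [mul_pow, mul_pow, sq_abs] at h1
    rw [mul_pow, ← hlag]
    nlinarith [Real.sin_sq_add_cos_sq θ]
  have hle := abs_le_of_sq_le_sq hsq (by positivity)
  rw [abs_of_nonneg hI] at hle
  have hdiv : inner ℝ (b - a) (c - a) / (‖b - a‖ * ‖c - a‖) ≤ Real.cos θ := by
    rw [div_le_iff₀ hpos]; exact hle
  calc θ = Real.arccos (Real.cos θ) := (Real.arccos_cos h0 (by linarith)).symm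
    _ ≤ _ := Real.arccos_le_arccos hdiv

/-- All angles of the triangle with the set of corners `t` lie between `θ` and `π / 2`. -/
def AnglesBetween (θ : ℝ) (t : Set Plane) : Prop :=
  ∀ a b c, t = {a, b, c} → 0 ≤ inner ℝ (b - a) (c - a) ∧
    inner ℝ (b - a) (c - a) * Real.sin θ ≤ Real.cos θ * |cross (b - a) (c - a)|

lemma anglesBetween_of_corners {θ : ℝ} {p q r : Plane} (hc : cross (q - p) (r - p) ≠ 0)
    (hp : 0 ≤ inner ℝ (q - p) (r - p) ∧
      inner ℝ (q - p) (r - p) * Real.sin θ ≤ Real.cos θ * |cross (q - p) (r - p)|)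
    (hq : 0 ≤ inner ℝ (p - q) (r - q) ∧
      inner ℝ (p - q) (r - q) * Real.sin θ ≤ Real.cos θ * |cross (q - p) (r - p)|)
    (hr : 0 ≤ inner ℝ (p - r) (q - r) ∧
      inner ℝ (p - r) (q - r) * Real.sin θ ≤ Real.cos θ * |cross (q - p) (r - p)|) :
    AnglesBetween θ {p, q, r} := by
  intro a b c heq
  have npq : p ≠ q := by rintro rfl; simp [cross] at hc
  have npr : p ≠ r := by rintro rfl; simp [cross] at hc
  have nqr : q ≠ r := by rintro rfl; apply hc; simp only [cross]; ring
  have ha : p ∈ ({a, b, c} : Set Plane) := by rw [← heq]; simp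
  have hb : q ∈ ({a, b, c} : Set Plane) := by rw [← heq]; simp
  have hc' : r ∈ ({a, b, c} : Set Plane) := by rw [← heq]; simp
  simp only [Set.mem_insert_iff, Set.mem_singleton_iff] at ha hb hc'
  have e1 : |cross (p - q) (r - q)| = |cross (q - p) (r - p)| := by
    rw [← abs_neg]; congr 1; simp only [cross, PiLp.sub_apply]; ring
  have e2 : |cross (p - r) (q - r)| = |cross (q - p) (r - p)| := by
    congr 1; simp only [cross, PiLp.sub_apply]; ring
  have e3 : ∀ u v : Plane, |cross u v| = |cross v u| := by
    intro u v; rw [← abs_neg]; congr 1; simp only [cross]; ring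
  clear heq
  rcases ha with rfl | rfl | rfl <;> rcases hb with rfl | rfl | rfl <;>
    rcases hc' with rfl | rfl | rfl <;> first
    | exact absurd rfl npq | exact absurd rfl npr | exact absurd rfl nqr
    | exact hp
    | (rw [e1]; exact hq)
    | (rw [e2]; exact hr)
    | (rw [real_inner_comm, e3]; exact hp)
    | (rw [real_inner_comm, e3, e1]; exact hq)
    | (rw [real_inner_comm, e3, e2]; exact hr)

namespace IsTriangulation

variable {𝒯 : Set (Set Plane)} {Ω : Set Plane}

theorem isFat (h : IsTriangulation 𝒯 Ω) {θ δ : ℝ} (hδ : δ ≤ θ) (h0 : 0 ≤ θ)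
    (hπ : θ ≤ Real.pi / 2) (hang : ∀ t ∈ 𝒯, AnglesBetween θ t) : h.toPlaneGraph.IsFat δ := by
  intro a b c habc
  have ht := h.mem_of_isTriangle habc
  have nab := habc.2.1.ne
  have nbc := habc.2.2.1.ne
  have nca := habc.2.2.2.1.ne
  have key : ∀ x y z, ({a, b, c} : Set Plane) = {x, y, z} → x ≠ y → y ≠ z → z ≠ x →
      δ ≤ ∠ y x z := by
    intro x y z heq hxy hyz hzx
    obtain ⟨h1, h2⟩ := hang _ ht x y z heq
    exact hδ.trans (le_angle_of_inner_le h0 hπ (h.cross_ne_zero (heq ▸ ht) hxy hyz hzx) h1 h2)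
  refine ⟨key b a c (by ext y; simp; tauto) nab.symm nca.symm nbc.symm,
    key c b a (by ext y; simp; tauto) nbc.symm nab.symm nca.symm,
    key a c b (by ext y; simp; tauto) nca.symm nbc.symm nab.symm⟩

/-! ### Cutting a triangulation along lines made of edges -/

/-- The part of a triangulation in a convex polygon around the origin, none of whose sides crosses
a triangle, is a triangulation of that polygon. -/
theorem restrict (h : IsTriangulation 𝒯 Ω) {ι : Type*} (F : ι → Plane →ₗ[ℝ] ℝ) (m : ι → ℝ)
    (hm : ∀ i, 0 < m i) (h0 : (0 : Plane) ∈ Ω)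
    (hcut : ∀ i, ∀ t ∈ 𝒯, (∀ v ∈ t, F i v ≤ m i) ∨ (∀ v ∈ t, m i ≤ F i v)) :
    IsTriangulation {t ∈ 𝒯 | ∀ i, ∀ v ∈ t, F i v ≤ m i} (Ω ∩ {x | ∀ i, F i x ≤ m i}) where
  finite := h.finite.subset (Set.sep_subset _ _)
  triangle := fun t ht => h.triangle t ht.1
  inter := fun s hs t ht => h.inter s hs.1 t ht.1
  convex := by
    refine h.convex.inter ?_
    have : {x : Plane | ∀ i, F i x ≤ m i} = ⋂ i, {x | F i x ≤ m i} := by ext; simp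
    rw [this]
    exact convex_iInter fun i => convex_halfSpace_le (F i).isLinear (m i)
  cover := by
    intro x
    constructor
    · rintro ⟨hxΩ, hx⟩
      have hx' : ∀ i, F i x ≤ m i := hx
      -- shrink `x` towards the origin, to leave the boundary of the polygon
      obtain ⟨t, ht, hxt, hfr⟩ := h.exists_triangle_of_tendsto
        (x := fun n : ℕ => x + (1 / ((n : ℝ) + 1)) • (-x)) (y := x) (fun n => by
          have hn : (0 : ℝ) ≤ n := n.cast_nonneg
          have := h.convex hxΩ h0 (a := 1 - 1 / ((n : ℝ) + 1)) (b := 1 / ((n : ℝ) + 1))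
            (by rw [sub_nonneg, div_le_one (by positivity)]; linarith) (by positivity) (by ring)
          convert this using 1
          module) (tendsto_add_smul x _)
      obtain ⟨n, hn⟩ := hfr.exists
      refine ⟨t, ⟨ht, fun i => (hcut i t ht).resolve_right fun hge => ?_⟩, hxt⟩
      have h1 : m i ≤ F i (x + (1 / ((n : ℝ) + 1)) • (-x)) :=
        convexHull_min (t := {y | m i ≤ F i y}) hge (convex_halfSpace_ge (F i).isLinear (m i)) hn
      have hn0 : (0 : ℝ) ≤ n := n.cast_nonneg
      have e : 0 < 1 / ((n : ℝ) + 1) := by positivity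
      have e' : 1 / ((n : ℝ) + 1) ≤ 1 := by rw [div_le_one (by positivity)]; linarith
      simp only [map_add, map_smul, map_neg, smul_eq_mul] at h1
      nlinarith [hm i, hx' i]
    · rintro ⟨t, ⟨ht, hle⟩, hxt⟩
      refine ⟨h.hull_subset ht hxt, fun i => ?_⟩
      exact convexHull_min (t := {y | F i y ≤ m i}) (hle i)
        (convex_halfSpace_le (F i).isLinear (m i)) hxt

lemma eq_convexHull_verts (h : IsTriangulation 𝒯 Ω) : Ω = convexHull ℝ (⋃₀ 𝒯) := by
  apply Set.Subset.antisymm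
  · intro x hx
    obtain ⟨t, ht, hxt⟩ := (h.cover x).1 hx
    exact convexHull_mono (Set.subset_sUnion_of_mem ht) hxt
  · refine convexHull_min ?_ h.convex
    rintro v ⟨t, ht, hvt⟩
    exact h.hull_subset ht (subset_convexHull ℝ t hvt)

lemma isClosed (h : IsTriangulation 𝒯 Ω) : IsClosed Ω := by
  rw [h.eq_convexHull_verts]
  exact h.finite_verts.isClosed_convexHull ℝ

variable {ι : Type*} {F : ι → Plane →ₗ[ℝ] ℝ} {m : ι → ℝ} {𝒬 : Set (Set Plane)}

lemma isOpen_strict [Finite ι] (F : ι → Plane →ₗ[ℝ] ℝ) (m : ι → ℝ) :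
    IsOpen {x : Plane | ∀ i, F i x < m i} := by
  have : {x : Plane | ∀ i, F i x < m i} = ⋂ i, {x | F i x < m i} := by ext; simp
  rw [this]
  exact isOpen_iInter_of_finite fun i =>
    isOpen_lt (LinearMap.continuous_of_finiteDimensional (F i)) continuous_const

theorem isConvexPolygon [Finite ι] (h : IsTriangulation 𝒬 {x | ∀ i, F i x ≤ m i})
    (hm : ∀ i, 0 < m i) : IsConvexPolygon {x : Plane | ∀ i, F i x ≤ m i} := by
  refine ⟨⟨h.finite_verts.toFinset, ?_⟩, 0, ?_⟩
  · rw [Set.Finite.coe_toFinset]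
    exact h.eq_convexHull_verts
  · exact interior_maximal (fun x hx i => (hx i).le) (isOpen_strict F m)
      (fun i => by simpa using hm i)

lemma mem_frontier_iff [Finite ι] (h : IsTriangulation 𝒬 {x | ∀ i, F i x ≤ m i})
    (hm : ∀ i, 0 < m i) {x : Plane} : x ∈ frontier {x : Plane | ∀ i, F i x ≤ m i} ↔
      (∀ i, F i x ≤ m i) ∧ ∃ i, F i x = m i := by
  rw [h.isClosed.frontier_eq]
  refine and_congr_right fun hx => ?_
  have hx' : ∀ i, F i x ≤ m i := hx
  constructor
  · intro hni
    by_contra hcon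
    push Not at hcon
    exact hni (interior_maximal (fun x hx i => (hx i).le) (isOpen_strict F m)
      (fun i => lt_of_le_of_ne (hx' i) (hcon i)))
  · rintro ⟨i, hi⟩ hint
    have hev := (tendsto_add_smul x x).eventually (mem_interior_iff_mem_nhds.1 hint)
    obtain ⟨n, hn⟩ := hev.exists
    have h1 := hn i
    have e : 0 < 1 / ((n : ℝ) + 1) := by positivity
    simp only [map_add, map_smul, smul_eq_mul, hi] at h1
    nlinarith [hm i]

/-- A polygon which is a union of triangles of a triangulation, and all of whose sides are
nondegenerate, has a boundary made of edges. -/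
theorem isRespectedBy [Finite ι] (hT : IsTriangulation 𝒯 Ω)
    (h : IsTriangulation 𝒬 {x | ∀ i, F i x ≤ m i}) (hsub : 𝒬 ⊆ 𝒯) (hm : ∀ i, 0 < m i)
    (hside : ∀ i, ∃ y z, y ≠ z ∧ (∀ j, F j y ≤ m j) ∧ (∀ j, F j z ≤ m j) ∧ F i y = m i ∧
      F i z = m i) :
    hT.toPlaneGraph.IsRespectedBy {x : Plane | ∀ i, F i x ≤ m i} := by
  refine ⟨{e | e.1 ≠ e.2 ∧ (∃ t ∈ 𝒬, e.1 ∈ t ∧ e.2 ∈ t) ∧ ∃ i, F i e.1 = m i ∧ F i e.2 = m i},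
    ?_, ?_⟩
  · rintro ⟨a, b⟩ ⟨hab, ⟨t, ht, ha, hb⟩, -⟩
    exact ⟨hab, t, hsub ht, ha, hb⟩
  ext x
  simp only [Set.mem_iUnion, exists_prop, Prod.exists]
  rw [h.mem_frontier_iff hm]
  constructor
  · rintro ⟨hx, i, hi⟩
    obtain ⟨z, hzx, hz, hzi⟩ : ∃ z, z ≠ x ∧ (∀ j, F j z ≤ m j) ∧ F i z = m i := by
      obtain ⟨y, z, hyz, hy, hz, hyi, hzi⟩ := hside i
      by_cases hyx : y = x
      · exact ⟨z, fun h0 => hyz (hyx.trans h0.symm), hz, hzi⟩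
      · exact ⟨y, hyx, hy, hyi⟩
    -- one triangle contains `x` and infinitely many points of the side close to `x`
    have hmemx : x ∈ {x : Plane | ∀ i, F i x ≤ m i} := hx
    have hmemz : z ∈ {x : Plane | ∀ i, F i x ≤ m i} := hz
    obtain ⟨t, ht, hxt, hfr⟩ := h.exists_triangle_of_tendsto
      (x := fun n : ℕ => x + (1 / ((n : ℝ) + 1)) • (z - x)) (y := x) (fun n => by
        have hn : (0 : ℝ) ≤ n := n.cast_nonneg
        have := h.convex hmemx hmemz (a := 1 - 1 / ((n : ℝ) + 1)) (b := 1 / ((n : ℝ) + 1))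
          (by rw [sub_nonneg, div_le_one (by positivity)]; linarith) (by positivity) (by ring)
        convert this using 1
        module) (tendsto_add_smul x _)
    obtain ⟨n, hn⟩ := hfr.exists
    have hle : ∀ v ∈ t, F i v ≤ m i := fun v hv =>
      (h.hull_subset ht (subset_convexHull ℝ t hv)) i
    set y : Plane := x + (1 / ((n : ℝ) + 1)) • (z - x) with hy
    have hyi : F i y = m i := by
      rw [hy]; simp [hi, hzi]
    have hyx : y ≠ x := by
      rw [hy]
      have hn0 : (1 / ((n : ℝ) + 1)) ≠ 0 := by positivity
      simp [sub_eq_zero, hzx, Nat.cast_add_one_ne_zero n]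
    have hxf := mem_convexHull_face (F i) hle hxt hi
    have hyf := mem_convexHull_face (F i) hle hn hyi
    -- the face of this triangle on the side is an edge
    obtain ⟨a, b, c, rfl, hc⟩ := h.triangle t ht
    have hFne : F i ≠ 0 := by
      intro h0
      have := hm i
      rw [← hi, h0] at this
      simp at this
    have hnot : ¬ (F i a = m i ∧ F i b = m i ∧ F i c = m i) := by
      rintro ⟨h1, h2, h3⟩
      apply hFne
      have e1 : F i (b - a) = 0 := by rw [map_sub, h1, h2, sub_self]
      have e2 : F i (c - a) = 0 := by rw [map_sub, h1, h3, sub_self]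
      ext w
      have hw : cross (b - a) (c - a) • w
          = cross w (c - a) • (b - a) + cross (b - a) w • (c - a) := by
        apply plane_ext <;>
        · simp only [cross, PiLp.add_apply, PiLp.smul_apply, smul_eq_mul]
          ring
      have := congrArg (F i) hw
      rw [map_add, map_smul, map_smul, map_smul, e1, e2] at this
      simp only [smul_eq_mul, mul_zero, add_zero, mul_eq_zero] at this
      exact this.resolve_left hc.ne'
    have two : ∀ p q r : Plane, ({a, b, c} : Set Plane) = {p, q, r} → p ≠ q → F i r ≠ m i →
        ∃ u v, (u ≠ v ∧ (∃ t ∈ 𝒬, u ∈ t ∧ v ∈ t) ∧ ∃ i, F i u = m i ∧ F i v = m i) ∧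
          x ∈ segment ℝ u v := by
      intro p q r hset hpq hr
      rw [hset] at hxf hyf ht
      have hsing : ∀ w : Plane, ¬ (({p, q, r} ∩ {v | F i v = m i} : Set Plane) ⊆ {w}) := by
        intro w hw
        have h1 := convexHull_mono hw hxf
        have h2 := convexHull_mono hw hyf
        rw [convexHull_singleton] at h1 h2
        exact hyx (h2.trans h1.symm)
      have hp : F i p = m i := by
        by_contra hp
        apply hsing q
        rintro w ⟨rfl | rfl | rfl, hw⟩
        · exact absurd hw hp
        · rfl
        · exact absurd hw hr
      have hq : F i q = m i := by
        by_contra hq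
        apply hsing p
        rintro w ⟨rfl | rfl | rfl, hw⟩
        · rfl
        · exact absurd hw hq
        · exact absurd hw hr
      refine ⟨p, q, ⟨hpq, ⟨_, ht, by simp, by simp⟩, i, hp, hq⟩, ?_⟩
      rw [← convexHull_pair]
      refine convexHull_mono ?_ hxf
      rintro w ⟨rfl | rfl | rfl, hw⟩
      · simp
      · simp
      · exact absurd hw hr
    obtain ⟨nab, nbc, nca⟩ := ne_of_cross_pos hc
    by_cases h3 : F i c = m i
    · by_cases h2 : F i b = m i
      · by_cases h1 : F i a = m i
        · exact absurd ⟨h1, h2, h3⟩ hnot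
        · exact two b c a (by ext y; simp; tauto) nbc h1
      · exact two c a b (by ext y; simp; tauto) nca h2
    · exact two a b c rfl nab h3
  · rintro ⟨a, b, ⟨-, ⟨t, ht, ha, hb⟩, i, hai, hbi⟩, hx⟩
    have hxt : x ∈ convexHull ℝ t := (convex_convexHull ℝ t).segment_subset
      (subset_convexHull ℝ t ha) (subset_convexHull ℝ t hb) hx
    refine ⟨h.hull_subset ht hxt, i, ?_⟩
    obtain ⟨α, β, -, -, hαβ, rfl⟩ := hx
    rw [map_add, map_smul, map_smul, hai, hbi, smul_eq_mul, smul_eq_mul, ← add_mul, hαβ, one_mul]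

end IsTriangulation

/-! ### Finiteness of the set of polygons that respect a plane graph -/

/-- A convex polygon is determined by its boundary, so that a finite graph bounds finitely many
polygons. -/
lemma eq_closure_convexHull_frontier {P : Set Plane} (hP : IsConvexPolygon P) :
    P = closure (convexHull ℝ (frontier P)) := by
  obtain ⟨⟨V, hV⟩, -⟩ := hP
  have hcomp : IsCompact P := by rw [hV]; exact V.finite_toSet.isCompact_convexHull ℝ
  have hconv : Convex ℝ P := by rw [hV]; exact convex_convexHull ℝ _
  have hext : Set.extremePoints ℝ P ⊆ frontier P := by
    intro x hx
    rw [hcomp.isClosed.frontier_eq]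
    refine ⟨hx.1, fun hint => ?_⟩
    -- an interior point is the midpoint of two other points
    set u : Plane := !₂[1, 0] with hu
    have hu0 : u ≠ 0 := fun h0 => by
      have := congrFun (congrArg WithLp.ofLp h0) 0
      simp [hu] at this
    have h1 := (IsTriangulation.tendsto_add_smul x u).eventually (mem_interior_iff_mem_nhds.1 hint)
    have h2 := (IsTriangulation.tendsto_add_smul x (-u)).eventually
      (mem_interior_iff_mem_nhds.1 hint)
    obtain ⟨n, hn1, hn2⟩ := (h1.and h2).exists
    have hmid : x ∈ openSegment ℝ (x + (1 / ((n : ℝ) + 1)) • u) (x + (1 / ((n : ℝ) + 1)) • (-u)) :=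
      ⟨1 / 2, 1 / 2, by norm_num, by norm_num, by norm_num, by module⟩
    have := hx.2 hn1 hn2 hmid
    rw [add_eq_left, smul_eq_zero] at this
    rcases this with h3 | h3
    · have : (0 : ℝ) < 1 / ((n : ℝ) + 1) := by positivity
      linarith
    · exact hu0 h3
  apply Set.Subset.antisymm
  · calc P = closure (convexHull ℝ (Set.extremePoints ℝ P)) :=
        (closure_convexHull_extremePoints hcomp hconv).symm
      _ ⊆ _ := closure_mono (convexHull_mono hext)
  · exact closure_minimal (convexHull_min hcomp.isClosed.frontier_subset hconv) hcomp.isClosed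

lemma PlaneGraph.finite_convexPolygons (G : PlaneGraph) : G.convexPolygons.Finite := by
  have hE : {e : Plane × Plane | G.graph.Adj e.1 e.2}.Finite := by
    refine ((G.verts.finite_toSet).prod (G.verts.finite_toSet)).subset ?_
    rintro ⟨a, b⟩ hab
    exact ⟨G.mem_verts_of_adj a b hab, G.mem_verts_of_adj b a (SimpleGraph.Adj.symm hab)⟩
  have hfin := hE.finite_subsets.image fun S : Set (Plane × Plane) =>
    closure (convexHull ℝ (⋃ e ∈ S, segment ℝ e.1 e.2))
  refine hfin.subset ?_
  rintro P ⟨hP, S, hS, hfr⟩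
  refine ⟨S, hS, ?_⟩
  change closure (convexHull ℝ (⋃ e ∈ S, segment ℝ e.1 e.2)) = P
  rw [← hfr]
  exact (eq_closure_convexHull_frontier hP).symm

/-! ### Rotated frames and the wedges of a regular polygon -/

/-- The point with coordinates `X`, `Y` in the orthonormal frame rotated by the angle `φ`. -/
noncomputable def frame (φ X Y : ℝ) : Plane :=
  !₂[X * Real.cos φ - Y * Real.sin φ, X * Real.sin φ + Y * Real.cos φ]

/-- The linear functional "first coordinate in the frame rotated by `φ`". -/
noncomputable def nrm (φ : ℝ) : Plane →ₗ[ℝ] ℝ where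
  toFun x := x 0 * Real.cos φ + x 1 * Real.sin φ
  map_add' x y := by simp only [PiLp.add_apply]; ring
  map_smul' s x := by simp only [PiLp.smul_apply, smul_eq_mul, RingHom.id_apply]; ring

/-- The linear functional "second coordinate in the frame rotated by `φ`". -/
noncomputable def tng (φ : ℝ) : Plane →ₗ[ℝ] ℝ where
  toFun x := x 1 * Real.cos φ - x 0 * Real.sin φ
  map_add' x y := by simp only [PiLp.add_apply]; ring
  map_smul' s x := by simp only [PiLp.smul_apply, smul_eq_mul, RingHom.id_apply]; ring

lemma nrm_apply (φ : ℝ) (x : Plane) : nrm φ x = x 0 * Real.cos φ + x 1 * Real.sin φ := rfl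

lemma tng_apply (φ : ℝ) (x : Plane) : tng φ x = x 1 * Real.cos φ - x 0 * Real.sin φ := rfl

@[simp] lemma frame_zero_coord (φ X Y : ℝ) :
    frame φ X Y 0 = X * Real.cos φ - Y * Real.sin φ := rfl

@[simp] lemma frame_one_coord (φ X Y : ℝ) :
    frame φ X Y 1 = X * Real.sin φ + Y * Real.cos φ := rfl

lemma nrm_frame_add (φ d X Y : ℝ) :
    nrm (φ + d) (frame φ X Y) = X * Real.cos d + Y * Real.sin d := by
  have := Real.sin_sq_add_cos_sq φ
  rw [nrm_apply, Real.cos_add, Real.sin_add, frame_zero_coord, frame_one_coord]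
  linear_combination (X * Real.cos d + Y * Real.sin d) * this

@[simp] lemma nrm_frame (φ X Y : ℝ) : nrm φ (frame φ X Y) = X := by
  simpa using nrm_frame_add φ 0 X Y

@[simp] lemma tng_frame (φ X Y : ℝ) : tng φ (frame φ X Y) = Y := by
  have := Real.sin_sq_add_cos_sq φ
  rw [tng_apply, frame_zero_coord, frame_one_coord]
  linear_combination Y * this

lemma frame_nrm_tng (φ : ℝ) (x : Plane) : frame φ (nrm φ x) (tng φ x) = x := by
  have := Real.sin_sq_add_cos_sq φ
  apply plane_ext
  · rw [frame_zero_coord, nrm_apply, tng_apply]; linear_combination x 0 * this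
  · rw [frame_one_coord, nrm_apply, tng_apply]; linear_combination x 1 * this

lemma cross_frame (φ X₁ Y₁ X₂ Y₂ X₃ Y₃ : ℝ) :
    cross (frame φ X₂ Y₂ - frame φ X₁ Y₁) (frame φ X₃ Y₃ - frame φ X₁ Y₁)
      = (X₂ - X₁) * (Y₃ - Y₁) - (Y₂ - Y₁) * (X₃ - X₁) := by
  have := Real.sin_sq_add_cos_sq φ
  simp only [cross, PiLp.sub_apply, frame_zero_coord, frame_one_coord]
  linear_combination ((X₂ - X₁) * (Y₃ - Y₁) - (Y₂ - Y₁) * (X₃ - X₁)) * this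

lemma inner_frame (φ X₁ Y₁ X₂ Y₂ X₃ Y₃ : ℝ) :
    inner ℝ (frame φ X₂ Y₂ - frame φ X₁ Y₁) (frame φ X₃ Y₃ - frame φ X₁ Y₁)
      = (X₂ - X₁) * (X₃ - X₁) + (Y₂ - Y₁) * (Y₃ - Y₁) := by
  have := Real.sin_sq_add_cos_sq φ
  simp only [inner_eq_coord, PiLp.sub_apply, frame_zero_coord, frame_one_coord]
  linear_combination ((X₂ - X₁) * (X₃ - X₁) + (Y₂ - Y₁) * (Y₃ - Y₁)) * this

/-- The angle `2π/k` of a wedge. -/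
noncomputable def wedgeAngle (k : ℕ) : ℝ := 2 * Real.pi / k

/-- The tangent of half the angle of a wedge. -/
noncomputable def wedgeTan (k : ℕ) : ℝ := Real.tan (wedgeAngle k / 2)

section Wedge

variable {k : ℕ}

lemma half_wedge_bounds (hk : 3 ≤ k) : 0 < wedgeAngle k / 2 ∧ wedgeAngle k / 2 ≤ Real.pi / 3 := by
  have hk' : (3 : ℝ) ≤ k := by exact_mod_cast hk
  have hpi := Real.pi_pos
  have e : wedgeAngle k / 2 = Real.pi / k := by unfold wedgeAngle; ring
  rw [e]
  exact ⟨by positivity, div_le_div_of_nonneg_left hpi.le (by norm_num) hk'⟩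

lemma cos_half_wedge_pos (hk : 3 ≤ k) : 0 < Real.cos (wedgeAngle k / 2) := by
  obtain ⟨h1, h2⟩ := half_wedge_bounds hk
  have hpi := Real.pi_pos
  exact Real.cos_pos_of_mem_Ioo ⟨by linarith, by linarith⟩

lemma sin_half_wedge_pos (hk : 3 ≤ k) : 0 < Real.sin (wedgeAngle k / 2) := by
  obtain ⟨h1, h2⟩ := half_wedge_bounds hk
  exact Real.sin_pos_of_pos_of_lt_pi h1 (by linarith [Real.pi_pos])

lemma wedgeTan_pos (hk : 3 ≤ k) : 0 < wedgeTan k := by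
  unfold wedgeTan
  rw [Real.tan_eq_sin_div_cos]
  exact div_pos (sin_half_wedge_pos hk) (cos_half_wedge_pos hk)

lemma wedgeTan_mul_cos (hk : 3 ≤ k) :
    wedgeTan k * Real.cos (wedgeAngle k / 2) = Real.sin (wedgeAngle k / 2) :=
  Real.tan_mul_cos (cos_half_wedge_pos hk).ne'

lemma cos_wedge_add (hk : 3 ≤ k) :
    Real.cos (wedgeAngle k) + wedgeTan k * Real.sin (wedgeAngle k) = 1 := by
  have h := wedgeTan_mul_cos hk
  have h2 := Real.sin_sq_add_cos_sq (wedgeAngle k / 2)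
  have e : wedgeAngle k = 2 * (wedgeAngle k / 2) := by ring
  rw [e, Real.cos_two_mul, Real.sin_two_mul]
  linear_combination 2 * Real.sin (wedgeAngle k / 2) * h + 2 * h2

lemma sin_wedge_sub (hk : 3 ≤ k) :
    Real.sin (wedgeAngle k) - wedgeTan k * Real.cos (wedgeAngle k) = wedgeTan k := by
  have h := wedgeTan_mul_cos hk
  have e : wedgeAngle k = 2 * (wedgeAngle k / 2) := by ring
  rw [e, Real.cos_two_mul, Real.sin_two_mul]
  linear_combination -2 * Real.cos (wedgeAngle k / 2) * h

lemma nrm_add_period (hk : 3 ≤ k) (j : ℕ) :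
    nrm ((j + k : ℕ) * wedgeAngle k) = nrm (j * wedgeAngle k) := by
  have hk' : (k : ℝ) ≠ 0 := by positivity
  have e : ((j + k : ℕ) : ℝ) * wedgeAngle k = j * wedgeAngle k + 2 * Real.pi := by
    unfold wedgeAngle; push_cast; field_simp
  ext x
  rw [e, nrm_apply, nrm_apply, Real.cos_add_two_pi, Real.sin_add_two_pi]

lemma nrm_mod (hk : 3 ≤ k) (j : ℕ) : nrm ((j % k : ℕ) * wedgeAngle k) = nrm (j * wedgeAngle k) := by
  conv_rhs => rw [← Nat.mod_add_div j k]
  generalize j % k = a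
  generalize j / k = b
  induction b with
  | zero => simp
  | succ b ih => rw [ih, Nat.mul_succ, ← Nat.add_assoc, nrm_add_period hk]

lemma nrm_frame_nat (i d : ℕ) (X Y : ℝ) :
    nrm ((i + d : ℕ) * wedgeAngle k) (frame (i * wedgeAngle k) X Y)
      = X * Real.cos (d * wedgeAngle k) + Y * Real.sin (d * wedgeAngle k) := by
  rw [← nrm_frame_add]; push_cast; rw [add_mul]

/-- The defect of `X cos (dθ) + Y sin (dθ) ≤ X`, as a combination of nonnegative terms. -/
lemma wedge_defect (hk : 3 ≤ k) (d : ℕ) (X Y : ℝ) :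
    wedgeTan k * Real.cos (wedgeAngle k / 2)
        * (X - (X * Real.cos (d * wedgeAngle k) + Y * Real.sin (d * wedgeAngle k))) =
      Real.sin (d * (wedgeAngle k / 2)) *
        ((X * wedgeTan k + Y) * Real.sin (d * (wedgeAngle k / 2) - wedgeAngle k / 2) +
          (X * wedgeTan k - Y) * Real.sin (d * (wedgeAngle k / 2) + wedgeAngle k / 2)) := by
  have h := wedgeTan_mul_cos hk
  have e : (d : ℝ) * wedgeAngle k = 2 * (d * (wedgeAngle k / 2)) := by ring
  rw [e, Real.cos_two_mul, Real.sin_two_mul, Real.sin_sub, Real.sin_add, ← h]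
  have h2 := Real.sin_sq_add_cos_sq (d * (wedgeAngle k / 2))
  linear_combination (-2 * X * wedgeTan k * Real.cos (wedgeAngle k / 2)) * h2

lemma mul_half_wedge_le {d e : ℕ} (hk : 3 ≤ k) (h : d ≤ e) :
    (d : ℝ) * (wedgeAngle k / 2) ≤ e * (wedgeAngle k / 2) := by
  have : (d : ℝ) ≤ e := by exact_mod_cast h
  exact mul_le_mul_of_nonneg_right this (half_wedge_bounds hk).1.le

lemma mul_half_wedge_period (hk : 3 ≤ k) : (k : ℝ) * (wedgeAngle k / 2) = Real.pi := by
  have hk' : (k : ℝ) ≠ 0 := by positivity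
  unfold wedgeAngle; field_simp

lemma sin_half_multiple_pos (hk : 3 ≤ k) {d : ℕ} (h0 : 0 < d) (hd : d < k) :
    0 < Real.sin (d * (wedgeAngle k / 2)) := by
  have h1 := (half_wedge_bounds hk).1
  refine Real.sin_pos_of_pos_of_lt_pi (by positivity) ?_
  rw [← mul_half_wedge_period hk]
  have : (d : ℝ) < k := by exact_mod_cast hd
  exact mul_lt_mul_of_pos_right this h1

lemma sin_half_multiple_sub (hk : 3 ≤ k) {d : ℕ} (h0 : 0 < d) (hd : d < k) :
    0 ≤ Real.sin (d * (wedgeAngle k / 2) - wedgeAngle k / 2) ∧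
      (d ≠ 1 → 0 < Real.sin (d * (wedgeAngle k / 2) - wedgeAngle k / 2)) := by
  obtain ⟨e, rfl⟩ : ∃ e, d = e + 1 := ⟨d - 1, by omega⟩
  have e1 : ((e + 1 : ℕ) : ℝ) * (wedgeAngle k / 2) - wedgeAngle k / 2
      = e * (wedgeAngle k / 2) := by push_cast; ring
  rw [e1]
  rcases Nat.eq_zero_or_pos e with rfl | he
  · simp
  · have := sin_half_multiple_pos hk he (by omega)
    exact ⟨this.le, fun _ => this⟩

lemma sin_half_multiple_add (hk : 3 ≤ k) {d : ℕ} (hd : d < k) :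
    0 ≤ Real.sin (d * (wedgeAngle k / 2) + wedgeAngle k / 2) ∧
      (d ≠ k - 1 → 0 < Real.sin (d * (wedgeAngle k / 2) + wedgeAngle k / 2)) := by
  have e1 : (d : ℝ) * (wedgeAngle k / 2) + wedgeAngle k / 2
      = (d + 1 : ℕ) * (wedgeAngle k / 2) := by push_cast; ring
  rw [e1]
  by_cases h : d + 1 = k
  · rw [h, mul_half_wedge_period hk, Real.sin_pi]
    exact ⟨le_rfl, fun h' => absurd (by omega) h'⟩
  · have := sin_half_multiple_pos hk (d := d + 1) (by omega) (by omega)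
    exact ⟨this.le, fun _ => this⟩

/-- In a wedge, the functional of this wedge is the largest of the `k` functionals; on another
wedge it agrees with the functional of that wedge only along a common ray. -/
lemma wedge_le (hk : 3 ≤ k) {d : ℕ} (h0 : 0 < d) (hd : d < k) {X Y : ℝ} (h1 : -(X * wedgeTan k) ≤ Y)
    (h2 : Y ≤ X * wedgeTan k) :
    X * Real.cos (d * wedgeAngle k) + Y * Real.sin (d * wedgeAngle k) ≤ X ∧
    (X * Real.cos (d * wedgeAngle k) + Y * Real.sin (d * wedgeAngle k) = X →
      (d ≠ 1 → Y = -(X * wedgeTan k)) ∧ (d ≠ k - 1 → Y = X * wedgeTan k)) := by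
  have hdef := wedge_defect hk d X Y
  have hpos : 0 < wedgeTan k * Real.cos (wedgeAngle k / 2) :=
    mul_pos (wedgeTan_pos hk) (cos_half_wedge_pos hk)
  have hs := sin_half_multiple_pos hk h0 hd
  obtain ⟨s1, s1'⟩ := sin_half_multiple_sub hk h0 hd
  obtain ⟨s2, s2'⟩ := sin_half_multiple_add hk hd
  have p1 : 0 ≤ (X * wedgeTan k + Y) * Real.sin (d * (wedgeAngle k / 2) - wedgeAngle k / 2) :=
    mul_nonneg (by linarith) s1
  have p2 : 0 ≤ (X * wedgeTan k - Y) * Real.sin (d * (wedgeAngle k / 2) + wedgeAngle k / 2) :=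
    mul_nonneg (by linarith) s2
  constructor
  · have : 0 ≤ X - (X * Real.cos (d * wedgeAngle k) + Y * Real.sin (d * wedgeAngle k)) := by
      refine nonneg_of_mul_nonneg_right ?_ hpos
      rw [hdef]
      exact mul_nonneg hs.le (by linarith)
    linarith
  · intro heq
    rw [heq, sub_self, mul_zero] at hdef
    have hz := (mul_eq_zero.1 hdef.symm).resolve_left hs.ne'
    have z1 := (mul_eq_zero.1 (by linarith :
      (X * wedgeTan k + Y) * Real.sin (d * (wedgeAngle k / 2) - wedgeAngle k / 2) = 0))
    have z2 := (mul_eq_zero.1 (by linarith :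
      (X * wedgeTan k - Y) * Real.sin (d * (wedgeAngle k / 2) + wedgeAngle k / 2) = 0))
    exact ⟨fun h => by linarith [z1.resolve_right (s1' h).ne'],
      fun h => by linarith [z2.resolve_right (s2' h).ne']⟩

lemma ray_eq (hk : 3 ≤ k) (i : ℕ) (X : ℝ) :
    frame ((i + 1 : ℕ) * wedgeAngle k) X (-(X * wedgeTan k))
      = frame (i * wedgeAngle k) X (X * wedgeTan k) := by
  have h1 := cos_wedge_add hk
  have h2 := sin_wedge_sub hk
  have e : ((i + 1 : ℕ) : ℝ) * wedgeAngle k = i * wedgeAngle k + wedgeAngle k := by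
    push_cast; ring
  apply plane_ext
  · simp only [frame_zero_coord, e, Real.cos_add, Real.sin_add]
    linear_combination X * Real.cos (i * wedgeAngle k) * h1 - X * Real.sin (i * wedgeAngle k) * h2
  · simp only [frame_one_coord, e, Real.cos_add, Real.sin_add]
    linear_combination X * Real.sin (i * wedgeAngle k) * h1 + X * Real.cos (i * wedgeAngle k) * h2

lemma frame_mod (hk : 3 ≤ k) (i : ℕ) (X Y : ℝ) :
    frame ((i % k : ℕ) * wedgeAngle k) X Y = frame (i * wedgeAngle k) X Y := by
  have h := nrm_mod hk i
  have hc : Real.cos ((i % k : ℕ) * wedgeAngle k) = Real.cos (i * wedgeAngle k) := by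
    have := congrArg (fun f => f !₂[1, 0]) h
    simpa [nrm_apply] using this
  have hs : Real.sin ((i % k : ℕ) * wedgeAngle k) = Real.sin (i * wedgeAngle k) := by
    have := congrArg (fun f => f !₂[0, 1]) h
    simpa [nrm_apply] using this
  unfold frame
  rw [hc, hs]

lemma exists_offset {i j : ℕ} (hi : i < k) (hj : j < k) (hij : i ≠ j) :
    ∃ d, 0 < d ∧ d < k ∧ (i + d) % k = j := by
  rcases Nat.lt_or_gt_of_ne hij with h | h
  · exact ⟨j - i, by omega, by omega, by rw [Nat.add_sub_cancel' h.le, Nat.mod_eq_of_lt hj]⟩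
  · refine ⟨j + k - i, by omega, by omega, ?_⟩
    rw [show i + (j + k - i) = j + k by omega, Nat.add_mod_right, Nat.mod_eq_of_lt hj]

/-- Every point lies in the wedge of the functional that is largest at it. -/
lemma exists_wedge (hk : 3 ≤ k) (x : Plane) : ∃ i < k, -(nrm (i * wedgeAngle k) x * wedgeTan k) ≤
      tng (i * wedgeAngle k) x ∧
    tng (i * wedgeAngle k) x ≤ nrm (i * wedgeAngle k) x * wedgeTan k := by
  obtain ⟨i, hi, hmax⟩ := Finset.exists_max_image (Finset.range k)
    (fun i : ℕ => nrm (i * wedgeAngle k) x) ⟨0, by simp; omega⟩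
  have hi' : i < k := by simpa using hi
  refine ⟨i, hi', ?_⟩
  have hmax' : ∀ d : ℕ, nrm ((i + d : ℕ) * wedgeAngle k) x ≤ nrm (i * wedgeAngle k) x := by
    intro d
    rw [← nrm_mod hk]
    exact hmax _ (by simpa using Nat.mod_lt _ (by omega))
  set X := nrm (i * wedgeAngle k) x with hX
  set Y := tng (i * wedgeAngle k) x with hY
  have hx : x = frame (i * wedgeAngle k) X Y := (frame_nrm_tng _ x).symm
  have hs : 0 < Real.sin (wedgeAngle k) := by
    have := sin_half_multiple_pos hk (d := 2) (by norm_num) (by omega)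
    convert this using 2; push_cast; ring
  have c1 := cos_wedge_add hk
  have m1 := hmax' 1
  rw [hx, nrm_frame_nat] at m1
  have m2 := hmax' (k - 1)
  have eprev : nrm ((i + (k - 1) : ℕ) * wedgeAngle k) = nrm (i * wedgeAngle k + -wedgeAngle k) := by
    have hk' : (k : ℝ) ≠ 0 := by positivity
    have e : ((i + (k - 1) : ℕ) : ℝ) * wedgeAngle k
        = (i * wedgeAngle k + -wedgeAngle k) + 2 * Real.pi := by
      rw [Nat.cast_add, Nat.cast_sub (by omega)]
      unfold wedgeAngle; push_cast; field_simp; ring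
    ext x
    rw [e, nrm_apply, nrm_apply, Real.cos_add_two_pi, Real.sin_add_two_pi]
  rw [eprev, hx, nrm_frame_add, Real.cos_neg, Real.sin_neg] at m2
  push_cast at m1
  rw [one_mul] at m1
  constructor
  · by_contra hcon
    push Not at hcon
    have hXc : X * Real.cos (wedgeAngle k) = X - X * (wedgeTan k * Real.sin (wedgeAngle k)) := by
      linear_combination X * c1
    have := mul_pos (sub_pos.2 hcon) hs
    nlinarith
  · by_contra hcon
    push Not at hcon
    have hXc : X * Real.cos (wedgeAngle k) = X - X * (wedgeTan k * Real.sin (wedgeAngle k)) := by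
      linear_combination X * c1
    have := mul_pos (sub_pos.2 hcon) hs
    nlinarith

end Wedge

/-! ### Meshes made of rows -/

/-- The convex hulls of `A` and `B` meet only in the convex hull of `A ∩ B`. -/
def HullCompat (A B : Set Plane) : Prop :=
  convexHull ℝ A ∩ convexHull ℝ B ⊆ convexHull ℝ (A ∩ B)

lemma HullCompat.symm {A B : Set Plane} (h : HullCompat A B) : HullCompat B A := by
  unfold HullCompat at *
  rwa [Set.inter_comm, Set.inter_comm B]

lemma hullCompat_of_subset_pair {A B : Set Plane} {u v : Plane} (hA : A ⊆ {u, v})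
    (hB : B ⊆ {u, v}) : HullCompat A B := by
  have key : ∀ {S : Set Plane}, S ⊆ {u, v} → S = {u, v} ∨ S.Subsingleton := by
    intro S hS
    rcases Set.subset_pair_iff_eq.1 hS with h | h | h | h
    · right; simp [h]
    · right; simp [h]
    · right; simp [h]
    · exact Or.inl h
  rintro x ⟨hxA, hxB⟩
  rcases key hA with rfl | h
  · rwa [Set.inter_eq_right.2 hB]
  rcases key hB with rfl | h'
  · rwa [Set.inter_eq_left.2 hA]
  rw [h.convex.convexHull_eq] at hxA
  rw [h'.convex.convexHull_eq] at hxB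
  exact subset_convexHull ℝ _ ⟨hxA, hxB⟩

/-- Two sets separated by a line are compatible as soon as their parts on that line are. -/
lemma hullCompat_of_separated (F : Plane →ₗ[ℝ] ℝ) (m : ℝ) {A B : Set Plane}
    (hA : ∀ v ∈ A, F v ≤ m) (hB : ∀ v ∈ B, m ≤ F v)
    (h : HullCompat (A ∩ {v | F v = m}) (B ∩ {v | F v = m})) : HullCompat A B := by
  rintro x ⟨hxA, hxB⟩
  have h1 : F x ≤ m := convexHull_min (t := {y | F y ≤ m}) hA (convex_halfSpace_le F.isLinear m) hxA
  have h2 : m ≤ F x := convexHull_min (t := {y | m ≤ F y}) hB (convex_halfSpace_ge F.isLinear m) hxB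
  have e := le_antisymm h1 h2
  have fA := mem_convexHull_face F hA hxA e
  have fB := mem_convexHull_face (-F) (m := -m) (fun v hv => by simpa using hB v hv) hxB
    (by simp [e])
  have eB : B ∩ {v | (-F) v = -m} = B ∩ {v | F v = m} := by ext; simp
  rw [eB] at fB
  have hsub : A ∩ {v | F v = m} ∩ (B ∩ {v | F v = m}) ⊆ A ∩ B :=
    fun y hy => ⟨hy.1.1, hy.2.1⟩
  exact convexHull_mono hsub (h ⟨fA, fB⟩)

/-- Two sides of a chain of points on which a functional increases are compatible. -/
lemma hullCompat_of_chain (F : Plane →ₗ[ℝ] ℝ) {p : ℕ → Plane} {N : ℕ}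
    (hp : ∀ n < N, F (p n) < F (p (n + 1))) {a b : ℕ} (ha : a < N) (hb : b < N) {A B : Set Plane}
    (hA : A ⊆ {p a, p (a + 1)}) (hB : B ⊆ {p b, p (b + 1)}) : HullCompat A B := by
  have hmono : ∀ c d, c ≤ d → d ≤ N → F (p c) ≤ F (p d) := by
    intro c d hcd
    induction d, hcd using Nat.le_induction with
    | base => intro _; exact le_rfl
    | succ d hcd ih => intro hd; exact (ih (by omega)).trans (hp d (by omega)).le
  have main : ∀ a b, a < b → b < N → ∀ A B : Set Plane, A ⊆ {p a, p (a + 1)} →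
      B ⊆ {p b, p (b + 1)} → HullCompat A B := by
    intro a b hab hb A B hA hB
    have e1 := hp a (by omega)
    have e2 := hmono (a + 1) b hab hb.le
    have e3 := hp b hb
    apply hullCompat_of_separated F (F (p (a + 1)))
    · intro v hv; rcases hA hv with rfl | rfl
      · exact e1.le
      · exact le_rfl
    · intro v hv; rcases hB hv with rfl | rfl
      · exact e2
      · exact e2.trans e3.le
    have hA' : A ∩ {v | F v = F (p (a + 1))} ⊆ {p (a + 1)} := by
      rintro v ⟨hv, hv'⟩; rcases hA hv with rfl | rfl
      · exact absurd hv' e1.ne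
      · rfl
    have hB' : B ∩ {v | F v = F (p (a + 1))} ⊆ {p b} := by
      rintro v ⟨hv, hv'⟩; rcases hB hv with rfl | rfl
      · rfl
      · exact absurd hv' (e2.trans_lt e3).ne'
    rcases Set.eq_empty_or_nonempty (B ∩ {v | F v = F (p (a + 1))}) with h0 | ⟨v, hv⟩
    · rw [h0]; intro x hx; simp at hx
    · have e4 : F (p b) = F (p (a + 1)) := by
        have := hB' hv; rw [Set.mem_singleton_iff] at this; rw [← this]; exact hv.2
      have e5 : b = a + 1 := by
        by_contra hne
        have := hmono (a + 2) b (by omega) hb.le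
        have := hp (a + 1) (by omega)
        linarith
      subst e5
      exact hullCompat_of_subset_pair (u := p (a + 1)) (v := p (a + 1)) (by simpa using hA')
        (by simpa using hB')
  rcases Nat.lt_trichotomy a b with h | h | h
  · exact main a b h hb A B hA hB
  · subst h; exact hullCompat_of_subset_pair hA hB
  · exact (main b a h ha B A hB hA).symm

lemma exists_step_of_le {f : ℕ → ℝ} {N : ℕ} (hN : 0 < N) {x : ℝ} (h0 : f 0 ≤ x) (h1 : x ≤ f N) :
    ∃ n < N, f n ≤ x ∧ x ≤ f (n + 1) := by
  induction N with
  | zero => omega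
  | succ N ih =>
    by_cases h : f N ≤ x
    · exact ⟨N, by omega, h, h1⟩
    · rcases Nat.eq_zero_or_pos N with rfl | hN'
      · exact absurd h0 h
      · obtain ⟨n, hn, h'⟩ := ih hN' (not_le.1 h).le
        exact ⟨n, by omega, h'⟩

/-- The data of a mesh with `k`-fold rotational symmetry. A wedge of angle `2π/k` carries the rows
`0, …, M`. Row `ρ` is the part of a line orthogonal to the axis of the wedge, at distance `X ρ`
from the origin, subdivided by the points with transversal coordinates `y ρ 0 < ⋯ < y ρ (m ρ)`.
Between the rows `ρ` and `ρ + 1` the `q`-th connecting edge runs from the point number `eb ρ q` to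
the point number `q - eb ρ q`, so that two consecutive connecting edges bound a triangle. -/
structure RowMesh (k : ℕ) where
  M : ℕ
  X : ℕ → ℝ
  m : ℕ → ℕ
  y : ℕ → ℕ → ℝ
  eb : ℕ → ℕ → ℕ
  three_le : 3 ≤ k
  M_pos : 0 < M
  X_zero : X 0 = 0
  X_lt : ∀ ρ < M, X ρ < X (ρ + 1)
  y_left : ∀ ρ ≤ M, y ρ 0 = -(X ρ * wedgeTan k)
  y_right : ∀ ρ ≤ M, y ρ (m ρ) = X ρ * wedgeTan k
  y_lt : ∀ ρ ≤ M, ∀ l < m ρ, y ρ l < y ρ (l + 1)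
  eb_zero : ∀ ρ < M, eb ρ 0 = 0
  eb_step : ∀ ρ < M, ∀ q < m ρ + m (ρ + 1), eb ρ (q + 1) = eb ρ q ∨ eb ρ (q + 1) = eb ρ q + 1
  eb_last : ∀ ρ < M, eb ρ (m ρ + m (ρ + 1)) = m ρ

namespace RowMesh

variable {k : ℕ} (R : RowMesh k)

/-- The `l`-th vertex on row `ρ` of the wedge `i`. -/
noncomputable def vertex (i ρ l : ℕ) : Plane := frame (i * wedgeAngle k) (R.X ρ) (R.y ρ l)

/-- The endpoints of the `q`-th edge that connects the rows `ρ` and `ρ + 1`. -/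
noncomputable def edge (i ρ q : ℕ) : Set Plane :=
  {R.vertex i ρ (R.eb ρ q), R.vertex i (ρ + 1) (q - R.eb ρ q)}

/-- The corners of the `q`-th triangle between the rows `ρ` and `ρ + 1`. -/
noncomputable def tri (i ρ q : ℕ) : Set Plane := R.edge i ρ q ∪ R.edge i ρ (q + 1)

/-- All triangles of the mesh. -/
def tris : Set (Set Plane) :=
  {t | ∃ i < k, ∃ ρ < R.M, ∃ q < R.m ρ + R.m (ρ + 1), t = R.tri i ρ q}

/-- The regular polygon covered by the mesh. -/
def domain : Set Plane := {x | ∀ i < k, nrm (i * wedgeAngle k) x ≤ R.X R.M}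

lemma X_mono {ρ σ : ℕ} (h : ρ ≤ σ) (hσ : σ ≤ R.M) : R.X ρ ≤ R.X σ := by
  induction σ, h using Nat.le_induction with
  | base => exact le_rfl
  | succ σ h ih => exact (ih (by omega)).trans (R.X_lt σ (by omega)).le

lemma X_strict {ρ σ : ℕ} (h : ρ < σ) (hσ : σ ≤ R.M) : R.X ρ < R.X σ :=
  (R.X_lt ρ (by omega)).trans_le (R.X_mono h hσ)

lemma X_nonneg {ρ : ℕ} (h : ρ ≤ R.M) : 0 ≤ R.X ρ := by
  have := R.X_mono (Nat.zero_le ρ) h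
  rwa [R.X_zero] at this

lemma y_mono {ρ : ℕ} (hρ : ρ ≤ R.M) {l l' : ℕ} (h : l ≤ l') (hl : l' ≤ R.m ρ) :
    R.y ρ l ≤ R.y ρ l' := by
  induction l', h using Nat.le_induction with
  | base => exact le_rfl
  | succ l' h ih => exact (ih (by omega)).trans (R.y_lt ρ hρ l' (by omega)).le

lemma y_strict {ρ : ℕ} (hρ : ρ ≤ R.M) {l l' : ℕ} (h : l < l') (hl : l' ≤ R.m ρ) :
    R.y ρ l < R.y ρ l' :=
  (R.y_lt ρ hρ l (by omega)).trans_le (R.y_mono hρ h hl)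

lemma y_bounds {ρ l : ℕ} (hρ : ρ ≤ R.M) (hl : l ≤ R.m ρ) :
    -(R.X ρ * wedgeTan k) ≤ R.y ρ l ∧ R.y ρ l ≤ R.X ρ * wedgeTan k := by
  rw [← R.y_left ρ hρ, ← R.y_right ρ hρ]
  exact ⟨R.y_mono hρ (Nat.zero_le l) hl, R.y_mono hρ hl le_rfl⟩

lemma eb_bounds {ρ : ℕ} (hρ : ρ < R.M) {q q' : ℕ} (h : q ≤ q')
    (hq : q' ≤ R.m ρ + R.m (ρ + 1)) :
    R.eb ρ q ≤ R.eb ρ q' ∧ R.eb ρ q' ≤ R.eb ρ q + (q' - q) := by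
  induction q', h using Nat.le_induction with
  | base => simp
  | succ q' h ih =>
    obtain ⟨h1, h2⟩ := ih (by omega)
    rcases R.eb_step ρ hρ q' (by omega) with h3 | h3 <;> omega

/-- The connecting edges advance monotonically on both rows, and stay on them. -/
lemma eb_facts {ρ : ℕ} (hρ : ρ < R.M) {q : ℕ} (hq : q ≤ R.m ρ + R.m (ρ + 1)) :
    R.eb ρ q ≤ q ∧ R.eb ρ q ≤ R.m ρ ∧ q - R.eb ρ q ≤ R.m (ρ + 1) := by
  have h1 := R.eb_bounds hρ (Nat.zero_le q) hq
  have h2 := R.eb_bounds hρ hq le_rfl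
  rw [R.eb_last ρ hρ] at h2
  rw [R.eb_zero ρ hρ] at h1
  omega

lemma nrm_vertex (i ρ l : ℕ) : nrm (i * wedgeAngle k) (R.vertex i ρ l) = R.X ρ := nrm_frame _ _ _

lemma tng_vertex (i ρ l : ℕ) : tng (i * wedgeAngle k) (R.vertex i ρ l) = R.y ρ l :=
  tng_frame _ _ _

lemma exists_vertex_of_mem_edge {i ρ q : ℕ} (hρ : ρ < R.M) (hq : q ≤ R.m ρ + R.m (ρ + 1))
    {v : Plane} (hv : v ∈ R.edge i ρ q) :
    ∃ σ l, v = R.vertex i σ l ∧ (σ = ρ ∨ σ = ρ + 1) ∧ l ≤ R.m σ := by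
  have h := R.eb_facts hρ hq
  rcases hv with rfl | rfl
  · exact ⟨_, _, rfl, Or.inl rfl, h.2.1⟩
  · exact ⟨_, _, rfl, Or.inr rfl, h.2.2⟩

lemma exists_vertex_of_mem_tri {i ρ q : ℕ} (hρ : ρ < R.M) (hq : q < R.m ρ + R.m (ρ + 1))
    {v : Plane} (hv : v ∈ R.tri i ρ q) :
    ∃ σ l, v = R.vertex i σ l ∧ (σ = ρ ∨ σ = ρ + 1) ∧ l ≤ R.m σ := by
  rcases hv with hv | hv
  · exact R.exists_vertex_of_mem_edge hρ hq.le hv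
  · exact R.exists_vertex_of_mem_edge hρ hq hv

/-- A functional vanishing on the direction of the `q`-th connecting edge, scaled such that its
values at vertices are easy to compare with its value on that edge. -/
noncomputable def edgeFun (i ρ q : ℕ) : Plane →ₗ[ℝ] ℝ :=
  (R.X (ρ + 1) - R.X ρ) • tng (i * wedgeAngle k)
    - (R.y (ρ + 1) (q - R.eb ρ q) - R.y ρ (R.eb ρ q)) • nrm (i * wedgeAngle k)

lemma edgeFun_bot (i ρ q l : ℕ) : R.edgeFun i ρ q (R.vertex i ρ l)
    - R.edgeFun i ρ q (R.vertex i ρ (R.eb ρ q))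
      = (R.X (ρ + 1) - R.X ρ) * (R.y ρ l - R.y ρ (R.eb ρ q)) := by
  simp only [edgeFun, LinearMap.sub_apply, LinearMap.smul_apply, smul_eq_mul, nrm_vertex,
    tng_vertex]
  ring

lemma edgeFun_top (i ρ q l : ℕ) : R.edgeFun i ρ q (R.vertex i (ρ + 1) l)
    - R.edgeFun i ρ q (R.vertex i ρ (R.eb ρ q))
      = (R.X (ρ + 1) - R.X ρ) * (R.y (ρ + 1) l - R.y (ρ + 1) (q - R.eb ρ q)) := by
  simp only [edgeFun, LinearMap.sub_apply, LinearMap.smul_apply, smul_eq_mul, nrm_vertex,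
    tng_vertex]
  ring

/-- Earlier connecting edges lie on the negative side of a connecting edge, and a common point on
its line is one of its endpoints. -/
lemma edgeFun_le {i ρ q q' : ℕ} (hρ : ρ < R.M) (h : q ≤ q') (hq : q' ≤ R.m ρ + R.m (ρ + 1))
    {v : Plane} (hv : v ∈ R.edge i ρ q) :
    R.edgeFun i ρ q' v ≤ R.edgeFun i ρ q' (R.vertex i ρ (R.eb ρ q')) ∧
      (R.edgeFun i ρ q' v = R.edgeFun i ρ q' (R.vertex i ρ (R.eb ρ q')) → v ∈ R.edge i ρ q') := by
  have hX := sub_pos.2 (R.X_lt ρ hρ)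
  have hb := R.eb_bounds hρ h hq
  have hf := R.eb_facts hρ hq
  have hf' := R.eb_facts hρ (h.trans hq)
  rcases hv with rfl | rfl
  · have e := R.edgeFun_bot i ρ q' (R.eb ρ q)
    rcases hb.1.eq_or_lt with h1 | h1
    · rw [h1]; exact ⟨le_rfl, fun _ => Or.inl rfl⟩
    · have := mul_pos hX (sub_pos.2 (R.y_strict hρ.le h1 hf.2.1))
      exact ⟨by linarith, fun h2 => by linarith⟩
  · have e := R.edgeFun_top i ρ q' (q - R.eb ρ q)
    rcases (by omega : q - R.eb ρ q ≤ q' - R.eb ρ q').eq_or_lt with h1 | h1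
    · rw [h1, sub_self, mul_zero] at e
      rw [h1]; exact ⟨by linarith, fun _ => Or.inr rfl⟩
    · have := mul_pos hX (sub_pos.2 (R.y_strict hρ h1 hf.2.2))
      exact ⟨by linarith, fun h2 => by linarith⟩

/-- Later connecting edges lie on the positive side of a connecting edge, and a common point on its
line is one of its endpoints. -/
lemma le_edgeFun {i ρ q q' : ℕ} (hρ : ρ < R.M) (h : q' ≤ q) (hq : q ≤ R.m ρ + R.m (ρ + 1))
    {v : Plane} (hv : v ∈ R.edge i ρ q) :
    R.edgeFun i ρ q' (R.vertex i ρ (R.eb ρ q')) ≤ R.edgeFun i ρ q' v ∧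
      (R.edgeFun i ρ q' v = R.edgeFun i ρ q' (R.vertex i ρ (R.eb ρ q')) → v ∈ R.edge i ρ q') := by
  have hX := sub_pos.2 (R.X_lt ρ hρ)
  have hb := R.eb_bounds hρ h hq
  have hf := R.eb_facts hρ hq
  have hf' := R.eb_facts hρ (h.trans hq)
  rcases hv with rfl | rfl
  · have e := R.edgeFun_bot i ρ q' (R.eb ρ q)
    rcases hb.1.eq_or_lt with h1 | h1
    · rw [← h1]; exact ⟨le_rfl, fun _ => Or.inl rfl⟩
    · have := mul_pos hX (sub_pos.2 (R.y_strict hρ.le h1 hf.2.1))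
      exact ⟨by linarith, fun h2 => by linarith⟩
  · have e := R.edgeFun_top i ρ q' (q - R.eb ρ q)
    rcases (by omega : q' - R.eb ρ q' ≤ q - R.eb ρ q).eq_or_lt with h1 | h1
    · rw [← h1, sub_self, mul_zero] at e
      rw [← h1]; exact ⟨by linarith, fun _ => Or.inr rfl⟩
    · have := mul_pos hX (sub_pos.2 (R.y_strict hρ h1 hf.2.2))
      exact ⟨by linarith, fun h2 => by linarith⟩

/-- Triangles between the same two rows are separated by a connecting edge. -/
lemma compat_same_strip {i ρ q q' : ℕ} (hρ : ρ < R.M) (h : q < q')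
    (hq : q' < R.m ρ + R.m (ρ + 1)) : HullCompat (R.tri i ρ q) (R.tri i ρ q') := by
  have hA : ∀ v ∈ R.tri i ρ q, _ := fun v hv => hv.elim
    (fun hv => R.edgeFun_le hρ (Nat.le_succ q) (by omega) hv)
    (fun hv => R.edgeFun_le hρ le_rfl (by omega) hv)
  have hB : ∀ v ∈ R.tri i ρ q', _ := fun v hv => hv.elim
    (fun hv => R.le_edgeFun (q' := q + 1) hρ (by omega) (by omega) hv)
    (fun hv => R.le_edgeFun (q' := q + 1) hρ (by omega) (by omega) hv)
  refine hullCompat_of_separated (R.edgeFun i ρ (q + 1)) _ (fun v hv => (hA v hv).1)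
    (fun v hv => (hB v hv).1) (hullCompat_of_subset_pair (u := R.vertex i ρ (R.eb ρ (q + 1)))
      (v := R.vertex i (ρ + 1) (q + 1 - R.eb ρ (q + 1))) ?_ ?_)
  · exact fun v hv => (hA v hv.1).2 hv.2
  · exact fun v hv => (hB v hv.1).2 hv.2

lemma m_pos {ρ : ℕ} (h0 : 0 < ρ) (hρ : ρ ≤ R.M) : 0 < R.m ρ := by
  by_contra hcon
  have e1 := R.y_left ρ hρ
  have e2 := R.y_right ρ hρ
  rw [show R.m ρ = 0 by omega, e1] at e2
  have hX := R.X_strict h0 hρ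
  rw [R.X_zero] at hX
  have := mul_pos hX (wedgeTan_pos R.three_le)
  linarith

/-- Triangles of one wedge between different rows are separated by a row. -/
lemma compat_same_wedge {i ρ ρ' q q' : ℕ} (h : ρ < ρ') (hρ : ρ' < R.M)
    (hq : q < R.m ρ + R.m (ρ + 1)) (hq' : q' < R.m ρ' + R.m (ρ' + 1)) :
    HullCompat (R.tri i ρ q) (R.tri i ρ' q') := by
  have hρ0 : ρ < R.M := by omega
  have hAX := R.X_lt ρ hρ0
  have hBX := R.X_lt ρ' hρ
  have hAB := R.X_mono (show ρ + 1 ≤ ρ' from h) hρ.le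
  have hf1 := R.eb_facts hρ0 hq.le
  have hf2 := R.eb_facts hρ0 (show q + 1 ≤ _ from hq)
  have hf3 := R.eb_facts hρ hq'.le
  have hf4 := R.eb_facts hρ (show q' + 1 ≤ _ from hq')
  have hstep := R.eb_step ρ hρ0 q hq
  have hstep' := R.eb_step ρ' hρ q' hq'
  apply hullCompat_of_separated (nrm (i * wedgeAngle k)) (R.X (ρ + 1))
  · intro v hv
    rcases hv with (rfl | rfl) | (rfl | rfl) <;> rw [nrm_vertex] <;> linarith
  · intro v hv
    rcases hv with (rfl | rfl) | (rfl | rfl) <;> rw [nrm_vertex] <;> linarith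
  have hA : R.tri i ρ q ∩ {v | nrm (i * wedgeAngle k) v = R.X (ρ + 1)} ⊆
      {R.vertex i (ρ + 1) (q - R.eb ρ q), R.vertex i (ρ + 1) (q + 1 - R.eb ρ (q + 1))} := by
    rintro v ⟨hv, hv'⟩
    rcases hv with (rfl | rfl) | (rfl | rfl)
    · rw [Set.mem_ofPred_eq, nrm_vertex] at hv'; exact absurd hv' hAX.ne
    · exact Or.inl rfl
    · rw [Set.mem_ofPred_eq, nrm_vertex] at hv'; exact absurd hv' hAX.ne
    · exact Or.inr rfl
  have hB : R.tri i ρ' q' ∩ {v | nrm (i * wedgeAngle k) v = R.X (ρ + 1)} ⊆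
      {R.vertex i ρ' (R.eb ρ' q'), R.vertex i ρ' (R.eb ρ' (q' + 1))} := by
    rintro v ⟨hv, hv'⟩
    rcases hv with (rfl | rfl) | (rfl | rfl)
    · exact Or.inl rfl
    · rw [Set.mem_ofPred_eq, nrm_vertex] at hv'; exact absurd hv' (hAB.trans_lt hBX).ne'
    · exact Or.inr rfl
    · rw [Set.mem_ofPred_eq, nrm_vertex] at hv'; exact absurd hv' (hAB.trans_lt hBX).ne'
  rcases Set.eq_empty_or_nonempty
    (R.tri i ρ' q' ∩ {v | nrm (i * wedgeAngle k) v = R.X (ρ + 1)}) with h0 | ⟨v, hv⟩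
  · rw [h0]; intro x hx; simp at hx
  have hX : R.X ρ' = R.X (ρ + 1) := by
    have h1 := hv.2
    rw [Set.mem_ofPred_eq] at h1
    rcases hB hv with rfl | rfl <;> rwa [nrm_vertex] at h1
  obtain rfl : ρ' = ρ + 1 := by
    by_contra hne
    have := R.X_strict (show ρ + 1 < ρ' by omega) hρ.le
    linarith
  -- both faces are sides of the subdivided row, or single points of it
  have widen : ∀ a b, a ≤ R.m (ρ + 1) → b ≤ R.m (ρ + 1) → b = a ∨ b = a + 1 →
      ∃ c < R.m (ρ + 1), ({R.vertex i (ρ + 1) a, R.vertex i (ρ + 1) b} : Set Plane) ⊆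
        {R.vertex i (ρ + 1) c, R.vertex i (ρ + 1) (c + 1)} := by
    intro a b ha hb hab
    have hpos : 0 < R.m (ρ + 1) := R.m_pos (Nat.succ_pos ρ) hρ.le
    rcases hab with rfl | rfl
    · rcases Nat.lt_or_ge b (R.m (ρ + 1)) with h | h
      · exact ⟨b, h, by simp⟩
      · refine ⟨b - 1, by omega, ?_⟩
        rw [Nat.sub_add_cancel (by omega)]
        simp
    · exact ⟨a, by omega, le_rfl⟩
  obtain ⟨c, hc, hc'⟩ := widen _ _ hf1.2.2 hf2.2.2 (by omega)
  obtain ⟨d, hd, hd'⟩ := widen _ _ hf3.2.1 hf4.2.1 hstep'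
  exact hullCompat_of_chain (tng (i * wedgeAngle k)) (p := R.vertex i (ρ + 1)) (N := R.m (ρ + 1))
    (fun n hn => by rw [tng_vertex, tng_vertex]; exact R.y_lt (ρ + 1) hρ.le n hn) hc hd
    (hA.trans hc') (hB.trans hd')

lemma mod_vertex (i ρ l : ℕ) : R.vertex (i % k) ρ l = R.vertex i ρ l := frame_mod R.three_le _ _ _

lemma mod_tri (i ρ q : ℕ) : R.tri (i % k) ρ q = R.tri i ρ q := by
  simp only [tri, edge, mod_vertex]

lemma vertex_succ_zero (i : ℕ) {ρ : ℕ} (hρ : ρ ≤ R.M) :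
    R.vertex (i + 1) ρ 0 = R.vertex i ρ (R.m ρ) := by
  unfold vertex
  rw [R.y_left ρ hρ, R.y_right ρ hρ, ray_eq R.three_le]

lemma nrm_add_vertex_le (i : ℕ) {d ρ l : ℕ} (h0 : 0 < d) (hd : d < k) (hρ : ρ ≤ R.M)
    (hl : l ≤ R.m ρ) :
    nrm ((i + d : ℕ) * wedgeAngle k) (R.vertex i ρ l) ≤ nrm (i * wedgeAngle k) (R.vertex i ρ l) ∧
      (nrm ((i + d : ℕ) * wedgeAngle k) (R.vertex i ρ l)
          = nrm (i * wedgeAngle k) (R.vertex i ρ l) →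
        (d ≠ 1 → R.vertex i ρ l = R.vertex i ρ 0) ∧
          (d ≠ k - 1 → R.vertex i ρ l = R.vertex i ρ (R.m ρ))) := by
  obtain ⟨hy1, hy2⟩ := R.y_bounds hρ hl
  obtain ⟨h1, h2⟩ := wedge_le R.three_le h0 hd hy1 hy2
  rw [nrm_vertex, vertex, nrm_frame_nat]
  refine ⟨h1, fun h => ?_⟩
  obtain ⟨h3, h4⟩ := h2 h
  unfold vertex
  rw [R.y_left ρ hρ, R.y_right ρ hρ]
  exact ⟨fun h => by rw [h3 h], fun h => by rw [h4 h]⟩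

/-- Two triangles in different wedges are separated by the line through the common ray of the
wedges if these are adjacent, and by a line through the origin otherwise. -/
lemma compat_different_wedge (i : ℕ) {d ρ ρ' q q' : ℕ} (h0 : 0 < d) (hd : d < k - 1)
    (hρ : ρ < R.M) (hρ' : ρ' < R.M) (hq : q < R.m ρ + R.m (ρ + 1))
    (hq' : q' < R.m ρ' + R.m (ρ' + 1)) :
    HullCompat (R.tri i ρ q) (R.tri (i + d) ρ' q') := by
  have hper : nrm ((i + d + (k - d) : ℕ) * wedgeAngle k) = nrm (i * wedgeAngle k) := by
    rw [show i + d + (k - d) = i + k by omega, nrm_add_period R.three_le]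
  have hA : ∀ v ∈ R.tri i ρ q,
      nrm ((i + d : ℕ) * wedgeAngle k) v ≤ nrm (i * wedgeAngle k) v ∧
      (nrm ((i + d : ℕ) * wedgeAngle k) v = nrm (i * wedgeAngle k) v →
        ∃ σ, (σ = ρ ∨ σ = ρ + 1) ∧ v = R.vertex i σ (R.m σ) ∧
          (d ≠ 1 → v = R.vertex i σ 0)) := by
    intro v hv
    obtain ⟨σ, l, rfl, hσ, hl⟩ := R.exists_vertex_of_mem_tri hρ hq hv
    obtain ⟨h1, h2⟩ := R.nrm_add_vertex_le i h0 (show d < k by omega) (show σ ≤ R.M by omega) hl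
    exact ⟨h1, fun h => ⟨σ, hσ, (h2 h).2 (by omega), fun h' => (h2 h).1 h'⟩⟩
  have hB : ∀ v ∈ R.tri (i + d) ρ' q',
      nrm (i * wedgeAngle k) v ≤ nrm ((i + d : ℕ) * wedgeAngle k) v ∧
      (nrm ((i + d : ℕ) * wedgeAngle k) v = nrm (i * wedgeAngle k) v →
        ∃ σ, (σ = ρ' ∨ σ = ρ' + 1) ∧ v = R.vertex (i + d) σ 0) := by
    intro v hv
    obtain ⟨σ, l, rfl, hσ, hl⟩ := R.exists_vertex_of_mem_tri hρ' hq' hv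
    obtain ⟨h1, h2⟩ := R.nrm_add_vertex_le (i + d) (show 0 < k - d by omega)
      (show k - d < k by omega) (show σ ≤ R.M by omega) hl
    rw [hper] at h1 h2
    exact ⟨h1, fun h => ⟨σ, hσ, (h2 h.symm).1 (by omega)⟩⟩
  apply hullCompat_of_separated (nrm ((i + d : ℕ) * wedgeAngle k) - nrm (i * wedgeAngle k)) 0
  · intro v hv; rw [LinearMap.sub_apply]; linarith [(hA v hv).1]
  · intro v hv; rw [LinearMap.sub_apply]; linarith [(hB v hv).1]
  rcases eq_or_ne d 1 with rfl | hd1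
  · refine hullCompat_of_chain (nrm (i * wedgeAngle k)) (p := fun σ => R.vertex i σ (R.m σ))
      (N := R.M) (fun n hn => by rw [nrm_vertex, nrm_vertex]; exact R.X_lt n hn) hρ hρ' ?_ ?_
    · rintro v ⟨hv, hv'⟩
      obtain ⟨σ, hσ, rfl, -⟩ := (hA v hv).2 (sub_eq_zero.1 hv')
      rcases hσ with rfl | rfl
      · exact Or.inl rfl
      · exact Or.inr rfl
    · rintro v ⟨hv, hv'⟩
      obtain ⟨σ, hσ, rfl⟩ := (hB v hv).2 (sub_eq_zero.1 hv')
      rw [R.vertex_succ_zero i (by omega)]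
      rcases hσ with rfl | rfl
      · exact Or.inl rfl
      · exact Or.inr rfl
  · -- the first triangle meets the separating line at most in the origin
    have hzero : ∀ v ∈ R.tri i ρ q, nrm ((i + d : ℕ) * wedgeAngle k) v = nrm (i * wedgeAngle k) v →
        v = 0 := by
      intro v hv h
      obtain ⟨σ, hσ, h1, h2⟩ := (hA v hv).2 h
      have hσ' : σ ≤ R.M := by omega
      have h3 := congrArg (tng (i * wedgeAngle k)) (h1.symm.trans (h2 hd1))
      rw [tng_vertex, tng_vertex, R.y_left σ hσ', R.y_right σ hσ'] at h3
      have h4 : R.X σ = 0 := by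
        have h5 : R.X σ * wedgeTan k = 0 := by linarith
        exact (mul_eq_zero.1 h5).resolve_right (wedgeTan_pos R.three_le).ne'
      rw [h1, vertex, R.y_right σ hσ', h4]
      apply plane_ext <;> simp
    refine hullCompat_of_separated (nrm ((i + d : ℕ) * wedgeAngle k)) 0 ?_ ?_ ?_
    · rintro v ⟨hv, hv'⟩
      rw [hzero v hv (sub_eq_zero.1 hv'), map_zero]
    · rintro v ⟨hv, hv'⟩
      obtain ⟨σ, hσ, rfl⟩ := (hB v hv).2 (sub_eq_zero.1 hv')
      rw [nrm_vertex]
      exact R.X_nonneg (by omega)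
    · refine hullCompat_of_subset_pair (u := 0) (v := 0) ?_ ?_
      · rintro v ⟨⟨hv, hv'⟩, -⟩
        left; exact hzero v hv (sub_eq_zero.1 hv')
      · rintro v ⟨⟨hv, hv'⟩, hv''⟩
        obtain ⟨σ, hσ, rfl⟩ := (hB v hv).2 (sub_eq_zero.1 hv')
        have hX : R.X σ = 0 := by rw [Set.mem_ofPred_eq, nrm_vertex] at hv''; exact hv''
        left
        rw [vertex, R.y_left σ (by omega), hX]
        apply plane_ext <;> simp

lemma compat_tri {i j ρ ρ' q q' : ℕ} (hi : i < k) (hj : j < k) (hρ : ρ < R.M) (hρ' : ρ' < R.M)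
    (hq : q < R.m ρ + R.m (ρ + 1)) (hq' : q' < R.m ρ' + R.m (ρ' + 1)) :
    HullCompat (R.tri i ρ q) (R.tri j ρ' q') := by
  rcases eq_or_ne i j with rfl | hij
  · rcases Nat.lt_trichotomy ρ ρ' with h | rfl | h
    · exact R.compat_same_wedge h hρ' hq hq'
    · rcases Nat.lt_trichotomy q q' with h | rfl | h
      · exact R.compat_same_strip hρ h hq'
      · intro x hx; simpa using hx
      · exact (R.compat_same_strip hρ h hq).symm
    · exact (R.compat_same_wedge h hρ hq' hq).symm
  · obtain ⟨d, h0, hd, hd'⟩ := exists_offset hi hj hij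
    rcases Nat.lt_or_ge d (k - 1) with h | h
    · have := R.compat_different_wedge i h0 h hρ hρ' hq hq'
      rwa [← R.mod_tri (i + d), hd'] at this
    · obtain ⟨e, h0', he, he'⟩ := exists_offset hj hi hij.symm
      have h3 := R.three_le
      have : e < k - 1 := by
        by_contra hcon
        obtain rfl : e = k - 1 := by omega
        obtain rfl : d = k - 1 := by omega
        have e1 : ∀ a < k, (a + (k - 1)) % k = if a = 0 then k - 1 else a - 1 := by
          intro a ha
          split_ifs with h0
          · rw [h0, zero_add, Nat.mod_eq_of_lt (by omega)]
          · rw [show a + (k - 1) = a - 1 + k by omega, Nat.add_mod_right,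
              Nat.mod_eq_of_lt (by omega)]
        rw [e1 i hi] at hd'
        rw [e1 j hj] at he'
        split_ifs at hd' he' <;> omega
      have := R.compat_different_wedge j h0' this hρ' hρ hq' hq
      rw [← R.mod_tri (j + e), he'] at this
      exact this.symm

lemma vertex_mem_domain {i ρ l : ℕ} (hi : i < k) (hρ : ρ ≤ R.M) (hl : l ≤ R.m ρ) :
    R.vertex i ρ l ∈ R.domain := by
  intro j hj
  have hX := R.X_mono hρ le_rfl
  rcases eq_or_ne i j with rfl | hij
  · rwa [nrm_vertex]
  · obtain ⟨d, h0, hd, hd'⟩ := exists_offset hi hj hij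
    have := (R.nrm_add_vertex_le i h0 hd hρ hl).1
    rw [nrm_vertex, ← nrm_mod R.three_le, hd'] at this
    linarith

lemma convex_domain : Convex ℝ R.domain := by
  have : R.domain = ⋂ i : ℕ, ⋂ _ : i < k, {x | nrm (i * wedgeAngle k) x ≤ R.X R.M} := by
    ext; simp [domain]
  rw [this]
  exact convex_iInter fun i => convex_iInter fun _ => convex_halfSpace_le (nrm _).isLinear _

/-- The point at the height fraction `s` on a connecting edge. -/
lemma frame_mem_hull_edge (i ρ q : ℕ) {s : ℝ} (h0 : 0 ≤ s) (h1 : s ≤ 1) :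
    frame (i * wedgeAngle k) ((1 - s) * R.X ρ + s * R.X (ρ + 1))
      ((1 - s) * R.y ρ (R.eb ρ q) + s * R.y (ρ + 1) (q - R.eb ρ q)) ∈
        convexHull ℝ (R.edge i ρ q) := by
  have hm : R.vertex i ρ (R.eb ρ q) ∈ convexHull ℝ (R.edge i ρ q) :=
    subset_convexHull ℝ _ (Or.inl rfl)
  have hm' : R.vertex i (ρ + 1) (q - R.eb ρ q) ∈ convexHull ℝ (R.edge i ρ q) :=
    subset_convexHull ℝ _ (Or.inr rfl)
  have := convex_convexHull ℝ (R.edge i ρ q) hm hm' (sub_nonneg.2 h1) h0 (by ring)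
  convert this using 1
  apply plane_ext <;>
    simp only [vertex, PiLp.add_apply, PiLp.smul_apply, smul_eq_mul, frame_zero_coord,
      frame_one_coord] <;> ring

lemma exists_tri_of_mem_domain {x : Plane} (hx : x ∈ R.domain) :
    ∃ t ∈ R.tris, x ∈ convexHull ℝ t := by
  obtain ⟨i, hi, hy1, hy2⟩ := exists_wedge R.three_le x
  have hXM := hx i hi
  have hτ := wedgeTan_pos R.three_le
  set X := nrm (i * wedgeAngle k) x with hX
  set Y := tng (i * wedgeAngle k) x with hY
  have hX0 : R.X 0 ≤ X := by
    rw [R.X_zero]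
    have : 0 ≤ X * wedgeTan k := by linarith
    exact nonneg_of_mul_nonneg_left this hτ
  obtain ⟨ρ, hρ, h1, h2⟩ := exists_step_of_le R.M_pos hX0 hXM
  have hH := sub_pos.2 (R.X_lt ρ hρ)
  set s := (X - R.X ρ) / (R.X (ρ + 1) - R.X ρ) with hs
  have hs0 : 0 ≤ s := div_nonneg (by linarith) hH.le
  have hs1 : s ≤ 1 := (div_le_one hH).2 (by linarith)
  have hsX : (1 - s) * R.X ρ + s * R.X (ρ + 1) = X := by
    rw [hs]; field_simp; ring
  let p : ℕ → ℝ := fun q => (1 - s) * R.y ρ (R.eb ρ q) + s * R.y (ρ + 1) (q - R.eb ρ q)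
  have hp0 : p 0 ≤ Y := by
    have : p 0 = -(X * wedgeTan k) := by
      simp only [p]
      rw [R.eb_zero ρ hρ, R.y_left ρ hρ.le, Nat.sub_zero, R.y_left (ρ + 1) hρ, ← hsX]
      ring
    rwa [this]
  have hpN : Y ≤ p (R.m ρ + R.m (ρ + 1)) := by
    have : p (R.m ρ + R.m (ρ + 1)) = X * wedgeTan k := by
      simp only [p]
      rw [R.eb_last ρ hρ, Nat.add_sub_cancel_left, R.y_right ρ hρ.le, R.y_right (ρ + 1) hρ, ← hsX]
      ring
    rwa [this]
  have hN : 0 < R.m ρ + R.m (ρ + 1) := by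
    by_contra hcon
    have h0 : R.m (ρ + 1) = 0 := by omega
    have e1 := R.y_left (ρ + 1) hρ
    have e2 := R.y_right (ρ + 1) hρ
    rw [h0, e1] at e2
    have := mul_pos ((R.X_nonneg hρ.le).trans_lt (R.X_lt ρ hρ)) hτ
    linarith
  obtain ⟨q, hq, hq1, hq2⟩ := exists_step_of_le hN hp0 hpN
  refine ⟨R.tri i ρ q, ⟨i, hi, ρ, hρ, q, hq, rfl⟩, ?_⟩
  have m1 := convexHull_mono (Set.subset_union_left (t := R.edge i ρ (q + 1)))
    (R.frame_mem_hull_edge i ρ q hs0 hs1)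
  have m2 := convexHull_mono (Set.subset_union_right (s := R.edge i ρ q))
    (R.frame_mem_hull_edge i ρ (q + 1) hs0 hs1)
  rw [hsX] at m1 m2
  have hseg : Y ∈ segment ℝ (p q) (p (q + 1)) := by
    rw [segment_eq_Icc (hq1.trans hq2)]; exact ⟨hq1, hq2⟩
  obtain ⟨u, v, hu, hv, huv, hY'⟩ := hseg
  have := convex_convexHull ℝ (R.tri i ρ q) m1 m2 hu hv huv
  convert this using 1
  rw [← frame_nrm_tng (i * wedgeAngle k) x, ← hX, ← hY, ← hY']
  obtain rfl : v = 1 - u := by linarith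
  apply plane_ext <;>
    simp only [p, PiLp.add_apply, PiLp.smul_apply, smul_eq_mul, frame_zero_coord,
      frame_one_coord] <;> ring

lemma tri_eq_triangle {i ρ q : ℕ} (hρ : ρ < R.M) (hq : q < R.m ρ + R.m (ρ + 1)) :
    (R.eb ρ (q + 1) = R.eb ρ q + 1 ∧ R.eb ρ q < R.m ρ ∧ R.tri i ρ q =
      {R.vertex i ρ (R.eb ρ q), R.vertex i (ρ + 1) (q - R.eb ρ q),
        R.vertex i ρ (R.eb ρ q + 1)}) ∨
    (R.eb ρ (q + 1) = R.eb ρ q ∧ q - R.eb ρ q < R.m (ρ + 1) ∧ R.tri i ρ q =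
      {R.vertex i ρ (R.eb ρ q), R.vertex i (ρ + 1) (q - R.eb ρ q),
        R.vertex i (ρ + 1) (q - R.eb ρ q + 1)}) := by
  have h1 := R.eb_facts hρ hq.le
  have h2 := R.eb_facts hρ (show q + 1 ≤ _ from hq)
  rcases R.eb_step ρ hρ q hq with h | h
  · refine Or.inr ⟨h, by omega, ?_⟩
    rw [tri, edge, edge, h, show q + 1 - R.eb ρ q = q - R.eb ρ q + 1 by omega]
    ext; simp; tauto
  · refine Or.inl ⟨h, by omega, ?_⟩
    rw [tri, edge, edge, h, show q + 1 - (R.eb ρ q + 1) = q - R.eb ρ q by omega]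
    ext; simp; tauto

theorem isTriangulation : IsTriangulation R.tris R.domain where
  finite := by
    have : R.tris ⊆ ⋃ i ∈ Finset.range k, ⋃ ρ ∈ Finset.range R.M,
        (fun q => R.tri i ρ q) '' ((Finset.range (R.m ρ + R.m (ρ + 1)) : Finset ℕ) : Set ℕ) := by
      rintro t ⟨i, hi, ρ, hρ, q, hq, rfl⟩
      simp only [Set.mem_iUnion, Finset.mem_range]
      exact ⟨i, hi, ρ, hρ, q, by simpa using hq, rfl⟩
    refine Set.Finite.subset ?_ this
    exact Set.Finite.biUnion (Finset.finite_toSet _) fun i _ =>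
      Set.Finite.biUnion (Finset.finite_toSet _) fun ρ _ => (Finset.finite_toSet _).image _
  triangle := by
    rintro t ⟨i, hi, ρ, hρ, q, hq, rfl⟩
    have hX := R.X_lt ρ hρ
    rcases R.tri_eq_triangle (i := i) hρ hq with ⟨-, hl, ht⟩ | ⟨-, hl, ht⟩
    · refine ⟨_, _, _, ht, ?_⟩
      have := mul_pos (sub_pos.2 hX) (sub_pos.2 (R.y_lt ρ hρ.le _ hl))
      rw [vertex, vertex, vertex, cross_frame]
      linarith
    · refine ⟨_, _, _, ht, ?_⟩
      have := mul_pos (sub_pos.2 hX) (sub_pos.2 (R.y_lt (ρ + 1) hρ _ hl))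
      rw [vertex, vertex, vertex, cross_frame]
      linarith
  inter := by
    rintro s ⟨i, hi, ρ, hρ, q, hq, rfl⟩ t ⟨j, hj, ρ', hρ', q', hq', rfl⟩
    exact R.compat_tri hi hj hρ hρ' hq hq'
  cover x := by
    refine ⟨R.exists_tri_of_mem_domain, ?_⟩
    rintro ⟨t, ⟨i, hi, ρ, hρ, q, hq, rfl⟩, hx⟩
    refine convexHull_min ?_ R.convex_domain hx
    intro v hv
    obtain ⟨σ, l, rfl, hσ, hl⟩ := R.exists_vertex_of_mem_tri hρ hq hv
    exact R.vertex_mem_domain hi (by omega) hl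
  convex := R.convex_domain

end RowMesh

/-! ### Trigonometry of narrow wedges -/

/-- The number `a` with `cos θ = 1 / (1 + a)`, where `θ` is the angle of a wedge. If rows are
`a / τ` apart, where `τ = tan (θ / 2)`, then the rows of a wedge extend to lines through the
vertices of the adjacent wedges. -/
noncomputable def rowGap (k : ℕ) : ℝ := 1 / Real.cos (wedgeAngle k) - 1

lemma wedgeAngle_pos {k : ℕ} (hk : 6 ≤ k) : 0 < wedgeAngle k := by
  have := (half_wedge_bounds (show 3 ≤ k by omega)).1
  linarith

lemma wedgeAngle_anti {k l : ℕ} (hk : 0 < k) (h : k ≤ l) : wedgeAngle l ≤ wedgeAngle k := by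
  have hk' : (0 : ℝ) < k := by exact_mod_cast hk
  have h' : (k : ℝ) ≤ l := by exact_mod_cast h
  exact div_le_div_of_nonneg_left (by linarith [Real.pi_pos]) hk' h'

lemma wedgeAngle_six : wedgeAngle 6 = Real.pi / 3 := by unfold wedgeAngle; push_cast; ring

lemma wedgeAngle_eight : wedgeAngle 8 = Real.pi / 4 := by unfold wedgeAngle; push_cast; ring

lemma half_le_cos_wedge {k : ℕ} (hk : 6 ≤ k) : 1 / 2 ≤ Real.cos (wedgeAngle k) := by
  rw [← Real.cos_pi_div_three, ← wedgeAngle_six]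
  refine Real.cos_le_cos_of_nonneg_of_le_pi (wedgeAngle_pos hk).le ?_
    (wedgeAngle_anti (by norm_num) hk)
  rw [wedgeAngle_six]; linarith [Real.pi_pos]

lemma cos_wedge_pos {k : ℕ} (hk : 6 ≤ k) : 0 < Real.cos (wedgeAngle k) := by
  linarith [half_le_cos_wedge hk]

lemma cos_mul_rowGap {k : ℕ} (hk : 6 ≤ k) : Real.cos (wedgeAngle k) * (1 + rowGap k) = 1 := by
  have := (cos_wedge_pos hk).ne'
  unfold rowGap; field_simp; ring

lemma rowGap_pos {k : ℕ} (hk : 6 ≤ k) : 0 < rowGap k := by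
  have hc := cos_wedge_pos hk
  have : Real.cos (wedgeAngle k) < 1 := by
    have h1 := cos_wedge_add (show 3 ≤ k by omega)
    have h2 := wedgeTan_pos (show 3 ≤ k by omega)
    have h3 : 0 < Real.sin (wedgeAngle k) := by
      refine Real.sin_pos_of_pos_of_lt_pi (wedgeAngle_pos hk) ?_
      have := wedgeAngle_anti (by norm_num) hk
      rw [wedgeAngle_six] at this
      linarith [Real.pi_pos]
    nlinarith
  have : 1 < 1 / Real.cos (wedgeAngle k) := (one_lt_div hc).2 this
  unfold rowGap; linarith

lemma rowGap_le_one {k : ℕ} (hk : 6 ≤ k) : rowGap k ≤ 1 := by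
  have h1 := half_le_cos_wedge hk
  have h2 := cos_mul_rowGap hk
  have h3 := rowGap_pos hk
  nlinarith

lemma rowGap_six : rowGap 6 = 1 := by
  unfold rowGap
  rw [wedgeAngle_six, Real.cos_pi_div_three]; norm_num

lemma sin_mul_rowGap {k : ℕ} (hk : 6 ≤ k) :
    wedgeTan k * Real.sin (wedgeAngle k) * (1 + rowGap k) = rowGap k := by
  have h1 := cos_wedge_add (show 3 ≤ k by omega)
  have h2 := cos_mul_rowGap hk
  linear_combination (1 + rowGap k) * h1 - h2

lemma sin_wedge_eq {k : ℕ} (hk : 6 ≤ k) :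
    wedgeTan k * Real.sin (wedgeAngle k) = rowGap k * Real.cos (wedgeAngle k) := by
  have h1 := cos_wedge_add (show 3 ≤ k by omega)
  have h2 := cos_mul_rowGap hk
  linear_combination h1 - h2

lemma wedgeTan_sq {k : ℕ} (hk : 6 ≤ k) : wedgeTan k ^ 2 * (2 + rowGap k) = rowGap k := by
  have h1 := sin_wedge_sub (show 3 ≤ k by omega)
  have h2 := cos_mul_rowGap hk
  have h3 := sin_mul_rowGap hk
  linear_combination -(wedgeTan k * (1 + rowGap k)) * h1 + h3 - wedgeTan k ^ 2 * h2

lemma cos_pi_div_four_sq : Real.cos (Real.pi / 4) ^ 2 = 1 / 2 := by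
  rw [Real.cos_pi_div_four, div_pow, Real.sq_sqrt (by norm_num)]; norm_num

lemma one_le_rowGap_sq {k : ℕ} (hk : 6 ≤ k) (hk' : k ≤ 8) : 1 ≤ rowGap k ^ 2 + 2 * rowGap k := by
  have h1 : Real.cos (wedgeAngle k) ≤ Real.cos (Real.pi / 4) := by
    rw [← wedgeAngle_eight]
    refine Real.cos_le_cos_of_nonneg_of_le_pi (wedgeAngle_pos (by norm_num)).le ?_
      (wedgeAngle_anti (by omega) hk')
    have := wedgeAngle_anti (by norm_num) hk
    rw [wedgeAngle_six] at this
    linarith [Real.pi_pos]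
  have h2 := cos_pi_div_four_sq
  have h3 := cos_mul_rowGap hk
  have h4 := cos_wedge_pos hk
  have h5 : Real.cos (wedgeAngle k) ^ 2 ≤ 1 / 2 := by rw [← h2]; gcongr
  have h6 : Real.cos (wedgeAngle k) ^ 2 * (1 + rowGap k) ^ 2 = 1 := by
    rw [← mul_pow, h3, one_pow]
  nlinarith [sq_nonneg (1 + rowGap k)]

lemma rowGap_sq_le_one {k : ℕ} (hk : 8 ≤ k) : rowGap k ^ 2 + 2 * rowGap k ≤ 1 := by
  have hk6 : 6 ≤ k := by omega
  have h1 : Real.cos (Real.pi / 4) ≤ Real.cos (wedgeAngle k) := by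
    rw [← wedgeAngle_eight]
    refine Real.cos_le_cos_of_nonneg_of_le_pi (wedgeAngle_pos hk6).le ?_
      (wedgeAngle_anti (by norm_num) hk)
    rw [wedgeAngle_eight]
    linarith [Real.pi_pos]
  have h2 := cos_pi_div_four_sq
  have h3 := cos_mul_rowGap hk6
  have h4 : 0 < Real.cos (Real.pi / 4) := by rw [Real.cos_pi_div_four]; positivity
  have h5 : 1 / 2 ≤ Real.cos (wedgeAngle k) ^ 2 := by rw [← h2]; gcongr
  have h6 : Real.cos (wedgeAngle k) ^ 2 * (1 + rowGap k) ^ 2 = 1 := by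
    rw [← mul_pow, h3, one_pow]
  nlinarith [sq_nonneg (1 + rowGap k)]

/-- Inequalities for a triangle with a side on a row and the opposite corner on a row at distance
`η / τ`, whose altitude splits the side into parts of lengths `α` and `β`. With `a = rowGap k` and
`τ = wedgeTan k` they say that all angles lie between `2π / k` and `π / 2`. -/
structure FatSplit (a η α β : ℝ) : Prop where
  left_nonneg : 0 ≤ α
  right_nonneg : 0 ≤ β
  left_le : α * a ≤ η
  right_le : β * a ≤ η
  apex_nonneg : α * β * a ≤ η ^ 2 * (2 + a)
  apex_le : η ^ 2 * (2 + a) - α * β * a ≤ (α + β) * η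

lemma FatSplit.symm {a η α β : ℝ} (h : FatSplit a η α β) : FatSplit a η β α where
  left_nonneg := h.right_nonneg
  right_nonneg := h.left_nonneg
  left_le := h.right_le
  right_le := h.left_le
  apex_nonneg := by linarith [h.apex_nonneg]
  apex_le := by linarith [h.apex_le]

lemma FatSplit.anglesBetween {k : ℕ} (hk : 6 ≤ k) {φ X X' y₁ y₂ y₃ η : ℝ} (hη : 0 < η)
    (hy : y₁ < y₂) (hX : (X' - X) * wedgeTan k = η ∨ (X - X') * wedgeTan k = η)
    (h : FatSplit (rowGap k) η (y₃ - y₁) (y₂ - y₃)) :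
    AnglesBetween (wedgeAngle k) {frame φ X y₁, frame φ X y₂, frame φ X' y₃} := by
  have hτ := wedgeTan_pos (show 3 ≤ k by omega)
  have ha := rowGap_pos hk
  have hc := cos_wedge_pos hk
  have hs := sin_wedge_eq hk
  have hsq := wedgeTan_sq hk
  obtain ⟨h1, h2, h3, h4, h5, h6⟩ := h
  set τ := wedgeTan k
  set a := rowGap k
  set c := Real.cos (wedgeAngle k)
  set s := Real.sin (wedgeAngle k)
  set α := y₃ - y₁ with hα
  set β := y₂ - y₃ with hβ
  have hw : y₂ - y₁ = α + β := by rw [hα, hβ]; ring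
  have hw0 : 0 < α + β := by rw [← hw]; linarith
  set H := |X' - X| with hH
  have hHτ : H * τ = η := by
    rcases hX with h | h
    · have : 0 < X' - X := pos_of_mul_pos_left (by rw [h]; exact hη) hτ.le
      rw [hH, abs_of_pos this, h]
    · have : 0 < X - X' := pos_of_mul_pos_left (by rw [h]; exact hη) hτ.le
      rw [hH, abs_sub_comm, abs_of_pos this, h]
  have hH0 : 0 < H := pos_of_mul_pos_left (by rw [hHτ]; exact hη) hτ.le
  have hHsq : H ^ 2 * a = η ^ 2 * (2 + a) := by
    rw [← hHτ]; linear_combination -H ^ 2 * hsq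
  have hHX : (X' - X) ^ 2 = H ^ 2 := by rw [hH, sq_abs]
  -- multiplication by the tangent turns sines into cosines
  have key : ∀ x z : ℝ, x * a ≤ z * τ → x * s ≤ c * z := by
    intro x z hxz
    have := mul_le_mul_of_nonneg_left hxz hc.le
    refine le_of_mul_le_mul_right ?_ hτ
    calc x * s * τ = c * (x * a) := by linear_combination x * hs
      _ ≤ c * z * τ := by linarith
  have hcross : |cross (frame φ X y₂ - frame φ X y₁) (frame φ X' y₃ - frame φ X y₁)|
      = (α + β) * H := by
    rw [cross_frame, show (X - X) * (y₃ - y₁) - (y₂ - y₁) * (X' - X) = -((α + β) * (X' - X)) by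
      rw [← hw]; ring, abs_neg, abs_mul, abs_of_pos hw0]
  have hcross0 : cross (frame φ X y₂ - frame φ X y₁) (frame φ X' y₃ - frame φ X y₁) ≠ 0 := by
    rw [← abs_pos, hcross]; positivity
  refine anglesBetween_of_corners hcross0 ?_ ?_ ?_ <;> rw [hcross, inner_frame]
  · have e : (X - X) * (X' - X) + (y₂ - y₁) * (y₃ - y₁) = (α + β) * α := by rw [hw]; ring
    rw [e]
    refine ⟨by positivity, key _ _ ?_⟩
    calc (α + β) * α * a = (α + β) * (α * a) := by ring
      _ ≤ (α + β) * η := by gcongr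
      _ = _ := by rw [← hHτ]; ring
  · have e : (X - X) * (X' - X) + (y₁ - y₂) * (y₃ - y₂) = (α + β) * β := by
      rw [hα, hβ]; ring
    rw [e]
    refine ⟨by positivity, key _ _ ?_⟩
    calc (α + β) * β * a = (α + β) * (β * a) := by ring
      _ ≤ (α + β) * η := by gcongr
      _ = _ := by rw [← hHτ]; ring
  · have e : (X - X') * (X - X') + (y₁ - y₃) * (y₂ - y₃) = H ^ 2 - α * β := by
      rw [← hHX, hα, hβ]; ring
    rw [e]
    refine ⟨?_, key _ _ ?_⟩
    · refine nonneg_of_mul_nonneg_left ?_ ha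
      rw [sub_mul, hHsq]; linarith
    · rw [sub_mul, hHsq]
      calc _ ≤ (α + β) * η := h6
        _ = _ := by rw [← hHτ]; ring

lemma RowMesh.anglesBetween {k : ℕ} (hk : 6 ≤ k) (R : RowMesh k)
    (hbot : ∀ ρ < R.M, ∀ q < R.m ρ + R.m (ρ + 1), R.eb ρ (q + 1) = R.eb ρ q + 1 →
      FatSplit (rowGap k) ((R.X (ρ + 1) - R.X ρ) * wedgeTan k)
        (R.y (ρ + 1) (q - R.eb ρ q) - R.y ρ (R.eb ρ q))
        (R.y ρ (R.eb ρ q + 1) - R.y (ρ + 1) (q - R.eb ρ q)))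
    (htop : ∀ ρ < R.M, ∀ q < R.m ρ + R.m (ρ + 1), R.eb ρ (q + 1) = R.eb ρ q →
      FatSplit (rowGap k) ((R.X (ρ + 1) - R.X ρ) * wedgeTan k)
        (R.y ρ (R.eb ρ q) - R.y (ρ + 1) (q - R.eb ρ q))
        (R.y (ρ + 1) (q - R.eb ρ q + 1) - R.y ρ (R.eb ρ q))) :
    ∀ t ∈ R.tris, AnglesBetween (wedgeAngle k) t := by
  rintro t ⟨i, hi, ρ, hρ, q, hq, rfl⟩
  have hη := mul_pos (sub_pos.2 (R.X_lt ρ hρ)) (wedgeTan_pos R.three_le)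
  rcases R.tri_eq_triangle (i := i) hρ hq with ⟨h, hl, ht⟩ | ⟨h, hl, ht⟩
  · have := FatSplit.anglesBetween hk (φ := i * wedgeAngle k) hη (R.y_lt ρ hρ.le _ hl) (Or.inl rfl)
      (hbot ρ hρ q hq h)
    rw [ht, Set.pair_comm]
    exact this
  · have := FatSplit.anglesBetween hk (φ := i * wedgeAngle k) hη (R.y_lt (ρ + 1) hρ _ hl)
      (Or.inr rfl) (htop ρ hρ q hq h)
    rw [ht, Set.insert_comm, Set.pair_comm (R.vertex i ρ (R.eb ρ q))]
    exact this

/-! ### Two fat meshes -/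

lemma cast_sub_succ (n l : ℕ) :
    ((n - (l + 1) : ℕ) : ℝ) = ((n - l : ℕ) : ℝ) - if l < n then 1 else 0 := by
  split_ifs with h
  · rw [show n - l = n - (l + 1) + 1 by omega]; push_cast; ring
  · rw [show n - l = 0 by omega, show n - (l + 1) = 0 by omega]; simp

lemma cast_succ_sub (n l : ℕ) :
    ((n + 1 - l : ℕ) : ℝ) = ((n - l : ℕ) : ℝ) + if l ≤ n then 1 else 0 := by
  split_ifs with h
  · rw [show n + 1 - l = n - l + 1 by omega]; push_cast; ring
  · rw [show n + 1 - l = 0 by omega, show n - l = 0 by omega]; simp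

/-- The mesh for `k ≤ 7`. With `τ = wedgeTan k`, the rows up to `r` are `1 / τ` apart and bound
congruent isosceles triangles with apex angle `2π / k` and base `2`. Beyond row `r` the rows are
`rowGap k / τ` apart, and the two ends of each row carry parallelograms cut out by the rows of two
adjacent wedges. -/
noncomputable def coarseMesh {k : ℕ} (hk : 6 ≤ k) (r M : ℕ) (hM : 0 < M) : RowMesh k where
  M := M
  X ρ := (ρ - (1 - rowGap k) * (ρ - r : ℕ)) / wedgeTan k
  m ρ := ρ
  y ρ l := 2 * l - ρ + (1 - rowGap k) * (ρ - r - l : ℕ) - (1 - rowGap k) * (l - r : ℕ)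
  eb _ q := q / 2
  three_le := by omega
  M_pos := hM
  X_zero := by simp
  X_lt ρ _ := by
    have hτ := wedgeTan_pos (show 3 ≤ k by omega)
    have ha := rowGap_pos hk
    refine div_lt_div_of_pos_right ?_ hτ
    rw [cast_succ_sub]
    push_cast
    split_ifs <;> linarith
  y_left ρ _ := by
    have hτ := wedgeTan_pos (show 3 ≤ k by omega)
    rw [div_mul_cancel₀ _ hτ.ne']; simp; ring
  y_right ρ _ := by
    have hτ := wedgeTan_pos (show 3 ≤ k by omega)
    rw [div_mul_cancel₀ _ hτ.ne', show ρ - r - ρ = 0 by omega]; simp; ring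
  y_lt ρ _ l _ := by
    have ha := rowGap_pos hk
    have ha' := rowGap_le_one hk
    rw [cast_sub_succ, cast_succ_sub]
    push_cast
    split_ifs <;> linarith
  eb_zero _ _ := rfl
  eb_step _ _ q _ := by omega
  eb_last ρ _ := by omega

lemma coarseMesh_anglesBetween {k : ℕ} (hk : 6 ≤ k) (hk' : k ≤ 8) {r M : ℕ} (hM : 0 < M)
    (hr : k = 6 ∨ M ≤ 2 * r) :
    ∀ t ∈ (coarseMesh hk r M hM).tris, AnglesBetween (wedgeAngle k) t := by
  have ha := rowGap_pos hk
  have ha' := rowGap_le_one hk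
  have hg := one_le_rowGap_sq hk hk'
  have hτ := wedgeTan_pos (show 3 ≤ k by omega)
  set a := rowGap k with hadef
  have good1 : FatSplit a 1 1 1 := ⟨by norm_num, by norm_num, by linarith, by linarith,
    by linarith, by linarith⟩
  have good2 : FatSplit a a 1 1 := ⟨by norm_num, by norm_num, by linarith, by linarith,
    by nlinarith, by nlinarith⟩
  have good3 : FatSplit a a a 1 := ⟨by linarith, by norm_num, by nlinarith, by linarith,
    by nlinarith, by nlinarith⟩
  have hη : ∀ ρ : ℕ, ((coarseMesh hk r M hM).X (ρ + 1) - (coarseMesh hk r M hM).X ρ) * wedgeTan k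
      = if r ≤ ρ then a else 1 := by
    intro ρ
    simp only [coarseMesh]
    rw [← sub_div, div_mul_cancel₀ _ hτ.ne', cast_succ_sub, ← hadef]
    push_cast
    split_ifs <;> ring
  have hD : ∀ ρ l : ℕ, (coarseMesh hk r M hM).y ρ l - (coarseMesh hk r M hM).y (ρ + 1) l
      = if r ≤ ρ ∧ l ≤ ρ - r then a else 1 := by
    intro ρ l
    simp only [coarseMesh, ← hadef]
    by_cases h : r ≤ ρ
    · rw [show ρ + 1 - r - l = ρ - r + 1 - l by omega, cast_succ_sub]
      push_cast
      by_cases h' : l ≤ ρ - r <;> simp [h, h'] <;> ring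
    · rw [show ρ + 1 - r - l = ρ - r - l by omega]
      push_cast
      simp [h]
  have hE : ∀ ρ l : ℕ, (coarseMesh hk r M hM).y (ρ + 1) (l + 1) - (coarseMesh hk r M hM).y ρ l
      = if r ≤ l then a else 1 := by
    intro ρ l
    simp only [coarseMesh, ← hadef]
    rw [show ρ + 1 - r - (l + 1) = ρ - r - l by omega, cast_succ_sub]
    push_cast
    split_ifs <;> ring
  have h6 : k = 6 → a = 1 := by rintro rfl; exact rowGap_six
  have good4 : k = 6 → FatSplit a a a a := by intro h; rw [h6 h] at good1 ⊢; exact good1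
  have hcase : ∀ ρ l l' : ℕ, ρ < M → l ≤ ρ → l' ≤ ρ → l ≤ l' + 1 → l' ≤ l →
      FatSplit a (if r ≤ ρ then a else 1) (if r ≤ ρ ∧ l ≤ ρ - r then a else 1)
        (if r ≤ l' then a else 1) := by
    intro ρ l l' hρ hl hl' h1 h2
    by_cases c1 : r ≤ ρ
    · by_cases c2 : l ≤ ρ - r <;> by_cases c3 : r ≤ l' <;> simp only [c1, c2, c3, if_true, if_false,
        true_and, and_true]
      · exact good4 (by omega)
      · exact good3
      · exact good3.symm
      · exact good2
    · have c3 : ¬ r ≤ l' := by omega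
      simp only [c1, c3, if_false, false_and]
      exact good1
  apply RowMesh.anglesBetween hk
  · intro ρ hρ q hq h
    have hρ' : ρ < M := hρ
    have hq' : q < ρ + (ρ + 1) := hq
    have h' : (q + 1) / 2 = q / 2 + 1 := h
    have e1 : (coarseMesh hk r M hM).eb ρ q = q / 2 := rfl
    rw [hη, e1, show q - q / 2 = q / 2 + 1 by omega, hE, hD]
    exact (hcase ρ (q / 2 + 1) (q / 2) hρ' (by omega) (by omega) (by omega) (by omega)).symm
  · intro ρ hρ q hq h
    have hρ' : ρ < M := hρ
    have hq' : q < ρ + (ρ + 1) := hq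
    have h' : (q + 1) / 2 = q / 2 := h
    have e1 : (coarseMesh hk r M hM).eb ρ q = q / 2 := rfl
    rw [hη, e1, show q - q / 2 = q / 2 by omega, hE, hD]
    exact hcase ρ (q / 2) (q / 2) hρ' (by omega) (by omega) (by omega) (by omega)

/-- The mesh for `k ≥ 8`. With `τ = wedgeTan k`, the rows up to `2 r` are `1 / (2 τ)` apart and
bound congruent isosceles triangles with apex angle `2π / k` and base `1`. Beyond row `2 r` the rows
are `rowGap k / τ` apart, the number of points per row is constant, the two ends of each row carry
parallelograms cut out by the rows of two adjacent wedges, and the part between them carries right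
triangles. -/
noncomputable def fineMesh {k : ℕ} (hk : 6 ≤ k) (r : ℕ) (hr : 0 < r) : RowMesh k where
  M := 3 * r
  X ρ := ((min ρ (2 * r) : ℕ) / 2 + rowGap k * (ρ - 2 * r : ℕ)) / wedgeTan k
  m ρ := min ρ (2 * r)
  y ρ l := l - (min ρ (2 * r) : ℕ) / 2 - rowGap k * (ρ - 2 * r - l : ℕ)
    + rowGap k * (l - (2 * r - (ρ - 2 * r)) : ℕ)
  eb ρ q := if ρ < 2 * r ∨ q < 2 * r then q / 2 else (q + 1) / 2
  three_le := by omega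
  M_pos := by omega
  X_zero := by simp
  X_lt ρ _ := by
    have hτ := wedgeTan_pos (show 3 ≤ k by omega)
    have ha := rowGap_pos hk
    refine div_lt_div_of_pos_right ?_ hτ
    rw [cast_succ_sub]
    rcases Nat.lt_or_ge ρ (2 * r) with h | h
    · rw [min_eq_left h.le, min_eq_left (show ρ + 1 ≤ 2 * r from h), if_neg (by omega)]
      push_cast; linarith
    · rw [min_eq_right h, min_eq_right (show 2 * r ≤ ρ + 1 by omega), if_pos h]
      linarith
  y_left ρ _ := by
    have hτ := wedgeTan_pos (show 3 ≤ k by omega)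
    rw [div_mul_cancel₀ _ hτ.ne']; simp; ring
  y_right ρ hρ := by
    have hτ := wedgeTan_pos (show 3 ≤ k by omega)
    have hρ' : ρ ≤ 3 * r := hρ
    rw [div_mul_cancel₀ _ hτ.ne']
    rcases Nat.lt_or_ge ρ (2 * r) with h | h
    · rw [min_eq_left h.le, show ρ - 2 * r = 0 by omega, show 0 - ρ = 0 by omega,
        show ρ - (2 * r - 0) = 0 by omega]
      push_cast; ring
    · rw [min_eq_right h, show ρ - 2 * r - 2 * r = 0 by omega,
        show 2 * r - (2 * r - (ρ - 2 * r)) = ρ - 2 * r by omega]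
      push_cast; ring
  y_lt ρ _ l _ := by
    have ha := rowGap_pos hk
    have ha' := rowGap_le_one hk
    rw [cast_sub_succ, cast_succ_sub]
    push_cast
    split_ifs <;> linarith
  eb_zero _ _ := by simp
  eb_step ρ _ q _ := by split_ifs <;> omega
  eb_last ρ _ := by split_ifs <;> omega

lemma fineMesh_anglesBetween {k : ℕ} (hk : 8 ≤ k) {r : ℕ} (hr : 0 < r) :
    ∀ t ∈ (fineMesh (show 6 ≤ k by omega) r hr).tris, AnglesBetween (wedgeAngle k) t := by
  have hk6 : 6 ≤ k := by omega
  have ha := rowGap_pos hk6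
  have ha' := rowGap_le_one hk6
  have hg := rowGap_sq_le_one hk
  have hτ := wedgeTan_pos (show 3 ≤ k by omega)
  set a := rowGap k with hadef
  have good1 : FatSplit a (1 / 2) (1 / 2) (1 / 2) := ⟨by norm_num, by norm_num, by linarith,
    by linarith, by linarith, by linarith⟩
  have good2 : FatSplit a a 0 1 := ⟨by norm_num, by norm_num, by linarith, by linarith,
    by nlinarith, by nlinarith⟩
  have good3 : FatSplit a a a 1 := ⟨by linarith, by norm_num, by nlinarith, by linarith,
    by nlinarith, by nlinarith⟩
  set R := fineMesh hk6 r hr with hR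
  have hη : ∀ ρ : ℕ, (R.X (ρ + 1) - R.X ρ) * wedgeTan k = if 2 * r ≤ ρ then a else 1 / 2 := by
    intro ρ
    simp only [hR, fineMesh]
    rw [← sub_div, div_mul_cancel₀ _ hτ.ne', cast_succ_sub, ← hadef]
    rcases Nat.lt_or_ge ρ (2 * r) with h | h
    · rw [min_eq_left h.le, min_eq_left (show ρ + 1 ≤ 2 * r from h), if_neg (by omega),
        if_neg (by omega)]
      push_cast; ring
    · rw [min_eq_right h, min_eq_right (show 2 * r ≤ ρ + 1 by omega), if_pos h, if_pos h]
      ring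
  -- the inner rows
  have hin : ∀ ρ l : ℕ, ρ ≤ 2 * r → l ≤ 2 * r → R.y ρ l = l - ρ / 2 := by
    intro ρ l h hl
    simp only [hR, fineMesh]
    rw [min_eq_left h, show ρ - 2 * r = 0 by omega, show 0 - l = 0 by omega,
      show l - (2 * r - 0) = 0 by omega]
    push_cast; ring
  -- the differences between an outer row and the next one
  have hleft : ∀ ρ l : ℕ, 2 * r ≤ ρ → ρ < 3 * r → l ≤ r →
      R.y ρ l - R.y (ρ + 1) l = if l ≤ ρ - 2 * r then a else 0 := by
    intro ρ l h1 h2 h3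
    simp only [hR, fineMesh]
    rw [min_eq_right h1, min_eq_right (show 2 * r ≤ ρ + 1 by omega),
      show ρ + 1 - 2 * r - l = ρ - 2 * r + 1 - l by omega, cast_succ_sub,
      show l - (2 * r - (ρ - 2 * r)) = 0 by omega, show l - (2 * r - (ρ + 1 - 2 * r)) = 0 by omega,
      ← hadef]
    split_ifs <;> ring
  have hleft' : ∀ ρ l : ℕ, 2 * r ≤ ρ → ρ < 3 * r → l < r →
      R.y (ρ + 1) (l + 1) - R.y ρ l = 1 := by
    intro ρ l h1 h2 h3
    simp only [hR, fineMesh]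
    rw [min_eq_right h1, min_eq_right (show 2 * r ≤ ρ + 1 by omega),
      show ρ + 1 - 2 * r - (l + 1) = ρ - 2 * r - l by omega,
      show l - (2 * r - (ρ - 2 * r)) = 0 by omega,
      show l + 1 - (2 * r - (ρ + 1 - 2 * r)) = 0 by omega]
    push_cast; ring
  have hright : ∀ ρ l : ℕ, 2 * r ≤ ρ → ρ < 3 * r → r ≤ l →
      R.y (ρ + 1) l - R.y ρ l = if 2 * r ≤ l + (ρ - 2 * r) then a else 0 := by
    intro ρ l h1 h2 h3
    simp only [hR, fineMesh]
    rw [min_eq_right h1, min_eq_right (show 2 * r ≤ ρ + 1 by omega),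
      show ρ + 1 - 2 * r - l = 0 by omega, show ρ - 2 * r - l = 0 by omega,
      show l - (2 * r - (ρ + 1 - 2 * r)) = l + (ρ - 2 * r) + 1 - 2 * r by omega,
      show l - (2 * r - (ρ - 2 * r)) = l + (ρ - 2 * r) - 2 * r by omega, cast_succ_sub, ← hadef]
    split_ifs <;> ring
  have hright' : ∀ ρ l : ℕ, 2 * r ≤ ρ → ρ < 3 * r → r ≤ l →
      R.y ρ (l + 1) - R.y (ρ + 1) l = 1 := by
    intro ρ l h1 h2 h3
    simp only [hR, fineMesh]
    rw [min_eq_right h1, min_eq_right (show 2 * r ≤ ρ + 1 by omega),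
      show ρ + 1 - 2 * r - l = 0 by omega, show ρ - 2 * r - (l + 1) = 0 by omega,
      show l - (2 * r - (ρ + 1 - 2 * r)) = l + 1 - (2 * r - (ρ - 2 * r)) by omega]
    push_cast; ring
  have hgood : ∀ P : Prop, [Decidable P] → FatSplit a a (if P then a else 0) 1 := by
    intro P _; split_ifs
    · exact good3
    · exact good2
  have hebin : ∀ ρ q, ρ < 2 * r ∨ q ≤ 2 * r → R.eb ρ q = q / 2 := by
    intro ρ q h
    simp only [hR, fineMesh]
    split_ifs <;> omega
  have hebout : ∀ ρ q, 2 * r ≤ ρ → 2 * r ≤ q → R.eb ρ q = (q + 1) / 2 := by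
    intro ρ q h h'
    simp only [hR, fineMesh]
    rw [if_neg (by omega)]
  apply RowMesh.anglesBetween hk6
  · intro ρ hρ q hq h
    have hρ' : ρ < 3 * r := hρ
    have hq' : q < min ρ (2 * r) + min (ρ + 1) (2 * r) := hq
    rw [hη]
    rcases Nat.lt_or_ge ρ (2 * r) with c | c
    · rw [hebin _ _ (Or.inl c), hebin _ _ (Or.inl c)] at h
      rw [hebin _ _ (Or.inl c), if_neg (by omega), show q - q / 2 = q / 2 + 1 by omega,
        hin (ρ + 1) _ (by omega) (by omega), hin ρ _ (by omega) (by omega),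
        hin ρ _ (by omega) (by omega)]
      convert good1 using 1 <;> (push_cast; ring)
    · rw [if_pos c]
      rcases Nat.lt_or_ge q (2 * r) with c' | c'
      · rw [hebin _ _ (Or.inr c'.le), hebin _ _ (Or.inr c')] at h
        rw [hebin _ _ (Or.inr c'.le), show q - q / 2 = q / 2 + 1 by omega,
          hleft' ρ _ c hρ' (by omega), hleft ρ _ c hρ' (by omega)]
        exact (hgood _).symm
      · rw [hebout _ _ c c', hebout _ _ c (by omega)] at h
        rw [hebout _ _ c c', show q - (q + 1) / 2 = (q + 1) / 2 by omega,
          hright' ρ _ c hρ' (by omega), hright ρ _ c hρ' (by omega)]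
        exact hgood _
  · intro ρ hρ q hq h
    have hρ' : ρ < 3 * r := hρ
    have hq' : q < min ρ (2 * r) + min (ρ + 1) (2 * r) := hq
    rw [hη]
    rcases Nat.lt_or_ge ρ (2 * r) with c | c
    · rw [hebin _ _ (Or.inl c), hebin _ _ (Or.inl c)] at h
      rw [hebin _ _ (Or.inl c), if_neg (by omega), show q - q / 2 = q / 2 by omega,
        hin (ρ + 1) _ (by omega) (by omega), hin ρ _ (by omega) (by omega),
        hin (ρ + 1) _ (by omega) (by omega)]
      convert good1 using 1 <;> (push_cast; ring)
    · rw [if_pos c]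
      rcases Nat.lt_or_ge q (2 * r) with c' | c'
      · rw [hebin _ _ (Or.inr c'.le), hebin _ _ (Or.inr c')] at h
        rw [hebin _ _ (Or.inr c'.le), show q - q / 2 = q / 2 by omega,
          hleft' ρ _ c hρ' (by omega), hleft ρ _ c hρ' (by omega)]
        exact hgood _
      · rw [hebout _ _ c c', hebout _ _ c (by omega)] at h
        obtain ⟨l, hl⟩ : ∃ l, (q + 1) / 2 = l + 1 := ⟨(q + 1) / 2 - 1, by omega⟩
        rw [hebout _ _ c c', hl, show q - (l + 1) = l by omega,
          hright' ρ _ c hρ' (by omega), hright ρ _ c hρ' (by omega)]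
        exact (hgood _).symm

/-! ### Rows that extend through the whole mesh -/

lemma nrm_frame_pred {k : ℕ} (hk : 3 ≤ k) (i : ℕ) (X Y : ℝ) :
    nrm ((i + (k - 1) : ℕ) * wedgeAngle k) (frame (i * wedgeAngle k) X Y)
      = X * Real.cos (wedgeAngle k) - Y * Real.sin (wedgeAngle k) := by
  have hk' : (k : ℝ) ≠ 0 := by positivity
  have e : ((k - 1 : ℕ) : ℝ) * wedgeAngle k = -wedgeAngle k + 2 * Real.pi := by
    rw [Nat.cast_sub (by omega)]
    unfold wedgeAngle; push_cast; field_simp; ring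
  rw [nrm_frame_nat, e, Real.cos_add_two_pi, Real.sin_add_two_pi, Real.cos_neg, Real.sin_neg]
  ring

lemma cos_half_multiple_le {k : ℕ} (hk : 3 ≤ k) {m p : ℕ} (hp : p ≤ m) (hm : m + p ≤ 2 * k) :
    Real.cos (m * (wedgeAngle k / 2)) ≤ Real.cos (p * (wedgeAngle k / 2)) := by
  have h0 := (half_wedge_bounds hk).1
  have hper := mul_half_wedge_period hk
  have main : ∀ n : ℕ, p ≤ n → n ≤ k →
      Real.cos (n * (wedgeAngle k / 2)) ≤ Real.cos (p * (wedgeAngle k / 2)) := by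
    intro n hn hn'
    refine Real.cos_le_cos_of_nonneg_of_le_pi (by positivity) ?_ ?_
    · rw [← hper]
      exact mul_half_wedge_le hk hn'
    · exact mul_half_wedge_le hk hn
  rcases le_total m k with h | h
  · exact main m hp h
  · have e : (m : ℝ) * (wedgeAngle k / 2)
        = 2 * Real.pi - ((2 * k - m : ℕ) : ℝ) * (wedgeAngle k / 2) := by
      rw [Nat.cast_sub (by omega)]; push_cast; linarith
    rw [e, Real.cos_two_pi_sub]
    exact main _ (by omega) (by omega)

/-- A bound in a wedge for the functionals that belong neither to it nor to an adjacent wedge. -/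
lemma nrm_far_le {k : ℕ} (hk : 3 ≤ k) {d : ℕ} (h2 : 2 ≤ d) (hd : d + 2 ≤ k) {X Y : ℝ}
    (h1 : -(X * wedgeTan k) ≤ Y) (h1' : Y ≤ X * wedgeTan k) :
    X * Real.cos (d * wedgeAngle k) + Y * Real.sin (d * wedgeAngle k) ≤
      X * (Real.cos (wedgeAngle k) - wedgeTan k * Real.sin (wedgeAngle k)) := by
  have hc := cos_half_wedge_pos hk
  have hs := wedgeTan_mul_cos hk
  have hX : 0 ≤ X := nonneg_of_mul_nonneg_left (by linarith : 0 ≤ X * wedgeTan k) (wedgeTan_pos hk)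
  set x := wedgeAngle k / 2 with hx
  have e0 : wedgeAngle k = 2 * x := by rw [hx]; ring
  have e3 : Real.cos (3 * x) = Real.cos x * (Real.cos (wedgeAngle k)
      - wedgeTan k * Real.sin (wedgeAngle k)) := by
    rw [show 3 * x = wedgeAngle k + x by rw [e0]; ring, Real.cos_add, ← hs]; ring
  have b1 := cos_half_multiple_le hk (m := 2 * d - 1) (p := 3) (by omega) (by omega)
  have b2 := cos_half_multiple_le hk (m := 2 * d + 1) (p := 3) (by omega) (by omega)
  rw [← hx, Nat.cast_sub (by omega)] at b1
  rw [← hx] at b2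
  push_cast at b1 b2
  rw [e3] at b1 b2
  rw [show (2 * (d : ℝ) - 1) * x = d * wedgeAngle k - x by rw [e0]; ring, Real.cos_sub, ← hs] at b1
  rw [show (2 * (d : ℝ) + 1) * x = d * wedgeAngle k + x by rw [e0]; ring, Real.cos_add, ← hs] at b2
  have b1' : Real.cos (d * wedgeAngle k) + wedgeTan k * Real.sin (d * wedgeAngle k) ≤
      Real.cos (wedgeAngle k) - wedgeTan k * Real.sin (wedgeAngle k) :=
    le_of_mul_le_mul_left (by linarith) hc
  have b2' : Real.cos (d * wedgeAngle k) - wedgeTan k * Real.sin (d * wedgeAngle k) ≤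
      Real.cos (wedgeAngle k) - wedgeTan k * Real.sin (wedgeAngle k) :=
    le_of_mul_le_mul_left (by linarith) hc
  have m1 := mul_le_mul_of_nonneg_left b1' hX
  have m2 := mul_le_mul_of_nonneg_left b2' hX
  rcases le_total 0 (Real.sin (d * wedgeAngle k)) with h | h
  · have := mul_le_mul_of_nonneg_right h1' h
    linarith
  · have := mul_le_mul_of_nonpos_right h1 h
    linarith

namespace RowMesh

variable {k : ℕ}

/-- The point number `l` of row `σ` is a corner of the `q`-th triangle above row `ρ`. -/
def IsCorner (R : RowMesh k) (ρ q σ l : ℕ) : Prop :=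
  (σ = ρ ∧ (l = R.eb ρ q ∨ l = R.eb ρ (q + 1))) ∨
    (σ = ρ + 1 ∧ (l = q - R.eb ρ q ∨ l = q + 1 - R.eb ρ (q + 1)))

lemma mem_tri_iff (R : RowMesh k) {i ρ q : ℕ} {v : Plane} :
    v ∈ R.tri i ρ q ↔ ∃ σ l, R.IsCorner ρ q σ l ∧ v = R.vertex i σ l := by
  constructor
  · rintro ((rfl | rfl) | (rfl | rfl))
    · exact ⟨_, _, Or.inl ⟨rfl, Or.inl rfl⟩, rfl⟩
    · exact ⟨_, _, Or.inr ⟨rfl, Or.inl rfl⟩, rfl⟩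
    · exact ⟨_, _, Or.inl ⟨rfl, Or.inr rfl⟩, rfl⟩
    · exact ⟨_, _, Or.inr ⟨rfl, Or.inr rfl⟩, rfl⟩
  · rintro ⟨σ, l, ⟨rfl, rfl | rfl⟩ | ⟨rfl, rfl | rfl⟩, rfl⟩
    · exact Or.inl (Or.inl rfl)
    · exact Or.inr (Or.inl rfl)
    · exact Or.inl (Or.inr rfl)
    · exact Or.inr (Or.inr rfl)

lemma IsCorner.bounds {R : RowMesh k} {ρ q σ l : ℕ} (h : R.IsCorner ρ q σ l) (hρ : ρ < R.M)
    (hq : q < R.m ρ + R.m (ρ + 1)) : (σ = ρ ∨ σ = ρ + 1) ∧ l ≤ R.m σ := by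
  have h1 := R.eb_facts hρ hq.le
  have h2 := R.eb_facts hρ (show q + 1 ≤ _ from hq)
  rcases h with ⟨rfl, rfl | rfl⟩ | ⟨rfl, rfl | rfl⟩ <;> simp <;> omega

/-- From row `b` on, the line that carries a row meets the mesh in a union of edges. By `right_eq`
and `left_eq`, in an adjacent wedge such a line passes through one point of each sufficiently
distant row; by `right_le`, `left_le` and `far_le`, all other points lie on the inner side of row
`b`; by `right_consec` and `left_consec`, each triangle lies between two consecutive lines. -/
structure Sliced (R : RowMesh k) (b : ℕ) : Prop where
  b_le : b < R.M
  right_eq : ∀ j l, b + j ≤ R.M → l ≤ R.m (b + j) → R.m (b + j) ≤ l + j →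
    R.X (b + j) * Real.cos (wedgeAngle k) + R.y (b + j) l * Real.sin (wedgeAngle k)
      = R.X (b + (l + j - R.m (b + j)))
  right_le : ∀ j l, b + j ≤ R.M → l + j ≤ R.m (b + j) →
    R.X (b + j) * Real.cos (wedgeAngle k) + R.y (b + j) l * Real.sin (wedgeAngle k) ≤ R.X b
  left_eq : ∀ j l, b + j ≤ R.M → l ≤ j →
    R.X (b + j) * Real.cos (wedgeAngle k) - R.y (b + j) l * Real.sin (wedgeAngle k)
      = R.X (b + (j - l))
  left_le : ∀ j l, b + j ≤ R.M → l ≤ R.m (b + j) → j ≤ l →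
    R.X (b + j) * Real.cos (wedgeAngle k) - R.y (b + j) l * Real.sin (wedgeAngle k) ≤ R.X b
  far_le : ∀ ρ ≤ R.M,
    R.X ρ * (Real.cos (wedgeAngle k) - wedgeTan k * Real.sin (wedgeAngle k)) ≤ R.X b
  right_consec : ∀ j q, b + j < R.M → q < R.m (b + j) + R.m (b + j + 1) →
    (∀ e l, R.IsCorner (b + j) q (b + e) l → l + e ≤ R.m (b + e)) ∨
      ∃ n, ∀ e l, R.IsCorner (b + j) q (b + e) l →
        R.m (b + e) + n ≤ l + e ∧ l + e ≤ R.m (b + e) + n + 1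
  left_consec : ∀ j q, b + j < R.M → q < R.m (b + j) + R.m (b + j + 1) →
    (∀ e l, R.IsCorner (b + j) q (b + e) l → e ≤ l) ∨
      ∃ n, ∀ e l, R.IsCorner (b + j) q (b + e) l → l + n ≤ e ∧ e ≤ l + n + 1

variable {R : RowMesh k} {b : ℕ}

lemma nrm_add_one_vertex (R : RowMesh k) (i ρ l : ℕ) :
    nrm ((i + 1 : ℕ) * wedgeAngle k) (R.vertex i ρ l)
      = R.X ρ * Real.cos (wedgeAngle k) + R.y ρ l * Real.sin (wedgeAngle k) := by
  rw [vertex, nrm_frame_nat]; simp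

lemma nrm_pred_vertex (R : RowMesh k) (i ρ l : ℕ) :
    nrm ((i + (k - 1) : ℕ) * wedgeAngle k) (R.vertex i ρ l)
      = R.X ρ * Real.cos (wedgeAngle k) - R.y ρ l * Real.sin (wedgeAngle k) := by
  rw [vertex, nrm_frame_pred R.three_le]

lemma nrm_vertex_le (R : RowMesh k) (i d : ℕ) {ρ l : ℕ} (hρ : ρ ≤ R.M) (hl : l ≤ R.m ρ) :
    nrm ((i + d : ℕ) * wedgeAngle k) (R.vertex i ρ l) ≤ R.X ρ := by
  have h3 := R.three_le
  rcases Nat.eq_zero_or_pos (d % k) with h | h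
  · obtain ⟨e, rfl⟩ := Nat.dvd_of_mod_eq_zero h
    rw [← nrm_mod h3, Nat.add_mul_mod_self_left, nrm_mod h3, nrm_vertex]
  · have := (R.nrm_add_vertex_le i h (Nat.mod_lt _ (by omega)) hρ hl).1
    rwa [nrm_vertex, ← nrm_mod h3, Nat.add_mod_mod, nrm_mod h3] at this

/-- A line that carries a row from row `b` on cuts no triangle of the mesh. -/
lemma Sliced.cut (h : R.Sliced b) {σ : ℕ} (hb : b ≤ σ) (hσ : σ ≤ R.M) (j : ℕ) {t : Set Plane}
    (ht : t ∈ R.tris) : (∀ v ∈ t, nrm (j * wedgeAngle k) v ≤ R.X σ) ∨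
      (∀ v ∈ t, R.X σ ≤ nrm (j * wedgeAngle k) v) := by
  obtain ⟨i, hi, ρ, hρ, q, hq, rfl⟩ := ht
  have h3 := R.three_le
  have hbσ := R.X_mono hb hσ
  have hjk : j % k < k := Nat.mod_lt _ (by omega)
  rw [← nrm_mod h3]
  rcases eq_or_ne i (j % k) with hij | hij
  · -- the functional of the wedge itself
    rw [← hij]
    rcases Nat.lt_or_ge ρ σ with h1 | h1
    · left
      intro v hv
      obtain ⟨ρ', l, hc, rfl⟩ := R.mem_tri_iff.1 hv
      rw [nrm_vertex]
      exact R.X_mono (by rcases (hc.bounds hρ hq).1 <;> omega) hσ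
    · right
      intro v hv
      obtain ⟨ρ', l, hc, rfl⟩ := R.mem_tri_iff.1 hv
      rw [nrm_vertex]
      have := (hc.bounds hρ hq).1
      exact R.X_mono (by omega) (by omega)
  obtain ⟨d, hd0, hdk, hd⟩ := exists_offset hi hjk hij
  rw [← hd, nrm_mod h3]
  rcases Nat.lt_or_ge ρ b with hρb | hρb
  · -- inner triangles
    left
    intro v hv
    obtain ⟨ρ', l, hc, rfl⟩ := R.mem_tri_iff.1 hv
    have hB := hc.bounds hρ hq
    refine (R.nrm_vertex_le i d (by omega) hB.2).trans ?_
    exact R.X_mono (by omega) hσ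
  obtain ⟨f, rfl⟩ := Nat.exists_eq_add_of_le hρb
  obtain ⟨s, rfl⟩ := Nat.exists_eq_add_of_le hb
  have hcorner : ∀ v ∈ R.tri i (b + f) q, ∃ e l, R.IsCorner (b + f) q (b + e) l ∧
      v = R.vertex i (b + e) l ∧ b + e ≤ R.M ∧ l ≤ R.m (b + e) := by
    intro v hv
    obtain ⟨ρ', l, hc, rfl⟩ := R.mem_tri_iff.1 hv
    have hB := hc.bounds hρ hq
    obtain ⟨e, rfl⟩ := Nat.exists_eq_add_of_le (show b ≤ ρ' by omega)
    exact ⟨e, l, hc, rfl, by omega, hB.2⟩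
  by_cases hd1 : d = 1
  · subst hd1
    rcases h.right_consec f q hρ hq with hc | ⟨n, hc⟩
    · left
      intro v hv
      obtain ⟨e, l, hcor, rfl, he, hl⟩ := hcorner v hv
      rw [nrm_add_one_vertex]
      exact (h.right_le e l he (hc e l hcor)).trans hbσ
    · rcases Nat.lt_or_ge n s with hns | hns
      · left
        intro v hv
        obtain ⟨e, l, hcor, rfl, he, hl⟩ := hcorner v hv
        have := hc e l hcor
        rw [nrm_add_one_vertex, h.right_eq e l he hl (by omega)]
        exact R.X_mono (by omega) hσ
      · right
        intro v hv
        obtain ⟨e, l, hcor, rfl, he, hl⟩ := hcorner v hv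
        have := hc e l hcor
        rw [nrm_add_one_vertex, h.right_eq e l he hl (by omega)]
        exact R.X_mono (by omega) (by omega)
  by_cases hd2 : d = k - 1
  · subst hd2
    rcases h.left_consec f q hρ hq with hc | ⟨n, hc⟩
    · left
      intro v hv
      obtain ⟨e, l, hcor, rfl, he, hl⟩ := hcorner v hv
      rw [nrm_pred_vertex]
      exact (h.left_le e l he hl (hc e l hcor)).trans hbσ
    · rcases Nat.lt_or_ge n s with hns | hns
      · left
        intro v hv
        obtain ⟨e, l, hcor, rfl, he, hl⟩ := hcorner v hv
        have := hc e l hcor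
        rw [nrm_pred_vertex, h.left_eq e l he (by omega)]
        exact R.X_mono (by omega) hσ
      · right
        intro v hv
        obtain ⟨e, l, hcor, rfl, he, hl⟩ := hcorner v hv
        have := hc e l hcor
        rw [nrm_pred_vertex, h.left_eq e l he (by omega)]
        exact R.X_mono (by omega) (by omega)
  · left
    intro v hv
    obtain ⟨e, l, hcor, rfl, he, hl⟩ := hcorner v hv
    obtain ⟨y1, y2⟩ := R.y_bounds he hl
    rw [vertex, nrm_frame_nat]
    exact ((nrm_far_le h3 (by omega) (by omega) y1 y2).trans (h.far_le _ he)).trans hbσ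

end RowMesh

/-- The criteria below are free of trigonometric functions: distances from the origin are multiplied
by `wedgeTan k`, and `cos` is replaced by `rowGap`. -/
lemma scaled_neighbor {k : ℕ} (hk : 6 ≤ k) {X Y Z : ℝ}
    (h : X * wedgeTan k + rowGap k * Y = (1 + rowGap k) * (Z * wedgeTan k)) :
    X * Real.cos (wedgeAngle k) + Y * Real.sin (wedgeAngle k) = Z := by
  have hτ := wedgeTan_pos (show 3 ≤ k by omega)
  have h1 := cos_mul_rowGap hk
  have h2 := sin_wedge_eq hk
  have h4 : (X * Real.cos (wedgeAngle k) + Y * Real.sin (wedgeAngle k)) * wedgeTan k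
      = Z * wedgeTan k := by
    linear_combination Real.cos (wedgeAngle k) * h + Y * h2 + Z * wedgeTan k * h1
  exact mul_right_cancel₀ hτ.ne' h4

lemma scaled_neighbor_le {k : ℕ} (hk : 6 ≤ k) {X Y Z : ℝ}
    (h : X * wedgeTan k + rowGap k * Y ≤ (1 + rowGap k) * (Z * wedgeTan k)) :
    X * Real.cos (wedgeAngle k) + Y * Real.sin (wedgeAngle k) ≤ Z := by
  have hτ := wedgeTan_pos (show 3 ≤ k by omega)
  have h1 := cos_mul_rowGap hk
  have h2 := sin_wedge_eq hk
  have h3 := mul_le_mul_of_nonneg_left h (cos_wedge_pos hk).le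
  refine le_of_mul_le_mul_right ?_ hτ
  calc _ = Real.cos (wedgeAngle k) * (X * wedgeTan k + rowGap k * Y) := by
        linear_combination Y * h2
    _ ≤ _ := h3
    _ = _ := by linear_combination Z * wedgeTan k * h1

lemma far_factor {k : ℕ} (hk : 6 ≤ k) :
    (Real.cos (wedgeAngle k) - wedgeTan k * Real.sin (wedgeAngle k)) * (1 + rowGap k)
      = 1 - rowGap k := by
  linear_combination cos_mul_rowGap hk - sin_mul_rowGap hk

lemma scaled_far_le {k : ℕ} (hk : 6 ≤ k) {X Z : ℝ}
    (h : X * wedgeTan k * (1 - rowGap k) ≤ (1 + rowGap k) * (Z * wedgeTan k)) :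
    X * (Real.cos (wedgeAngle k) - wedgeTan k * Real.sin (wedgeAngle k)) ≤ Z := by
  have hτ := wedgeTan_pos (show 3 ≤ k by omega)
  have ha := rowGap_pos hk
  refine le_of_mul_le_mul_right ?_ (mul_pos hτ (show 0 < 1 + rowGap k by linarith))
  calc _ = X * wedgeTan k * (1 - rowGap k) := by
        linear_combination X * wedgeTan k * far_factor hk
    _ ≤ _ := h
    _ = _ := by ring

lemma coarseMesh_sliced {k : ℕ} (hk : 6 ≤ k) {r M : ℕ} (hrM : r < M)
    (hr : k = 6 ∧ r = 0 ∨ M ≤ 2 * r) : (coarseMesh hk r M (by omega)).Sliced r := by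
  have ha := rowGap_pos hk
  have ha' := rowGap_le_one hk
  have hτ := wedgeTan_pos (show 3 ≤ k by omega)
  have h6 : k = 6 → rowGap k = 1 := by rintro rfl; exact rowGap_six
  set R := coarseMesh hk r M (by omega) with hR
  have hX : ∀ j, R.X (r + j) * wedgeTan k = r + rowGap k * j := by
    intro j
    simp only [hR, coarseMesh]
    rw [div_mul_cancel₀ _ hτ.ne', Nat.add_sub_cancel_left]
    push_cast; ring
  have hX0 : R.X r * wedgeTan k = r := by simpa using hX 0
  have hy1 : ∀ j l : ℕ, l ≤ j → l ≤ r →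
      R.y (r + j) l = -(r - j) - (1 + rowGap k) * (j - l) := by
    intro j l h h'
    simp only [hR, coarseMesh]
    rw [Nat.add_sub_cancel_left, Nat.cast_sub h, show l - r = 0 by omega]
    push_cast; ring
  have hy2 : ∀ j l : ℕ, j ≤ l → l ≤ r → R.y (r + j) l = 2 * l - r - j := by
    intro j l h h'
    simp only [hR, coarseMesh]
    rw [Nat.add_sub_cancel_left, show j - l = 0 by omega, show l - r = 0 by omega]
    push_cast; ring
  have hy3 : ∀ j l : ℕ, j ≤ l → r ≤ l → R.y (r + j) l = r - j + (1 + rowGap k) * (l - r) := by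
    intro j l h h'
    simp only [hR, coarseMesh]
    rw [Nat.add_sub_cancel_left, show j - l = 0 by omega, Nat.cast_sub h']
    push_cast; ring
  -- for `k = 6` the rows carry a triangular lattice
  have hy6 : k = 6 → ∀ j l : ℕ, R.y (r + j) l = 2 * l - r - j := by
    intro h j l
    simp only [hR, coarseMesh, h6 h]
    push_cast; ring
  have hm : ∀ ρ, R.m ρ = ρ := fun _ => rfl
  have hM : R.M = M := rfl
  have heb : ∀ ρ q, R.eb ρ q = q / 2 := fun _ _ => rfl
  refine ⟨hrM, ?_, ?_, ?_, ?_, ?_, ?_, ?_⟩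
  · intro j l hj hl hjl
    rw [hm] at hl hjl ⊢
    rw [hM] at hj
    apply scaled_neighbor hk
    rw [hX, hX, show l + j - (r + j) = l - r by omega, Nat.cast_sub (by omega)]
    rcases hr with ⟨h, h0⟩ | hr
    · rw [hy6 h, h6 h, h0]; push_cast; ring
    · rw [hy3 j l (by omega) (by omega)]; ring
  · intro j l hj hjl
    rw [hm] at hjl
    rw [hM] at hj
    apply scaled_neighbor_le hk
    rw [hX, hX0]
    have hlr : (l : ℝ) ≤ r := by exact_mod_cast (show l ≤ r by omega)
    rcases hr with ⟨h, h0⟩ | hr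
    · rw [hy6 h, h6 h]; linarith
    · rcases le_total l j with h | h
      · rw [hy1 j l h (by omega)]
        have h' : (l : ℝ) ≤ j := by exact_mod_cast h
        have h'' : (j : ℝ) ≤ r := by exact_mod_cast (show j ≤ r by omega)
        have p1 := mul_nonneg ha.le (mul_nonneg (by linarith : 0 ≤ 1 + rowGap k) (sub_nonneg.2 h'))
        have p2 := mul_nonneg ha.le (sub_nonneg.2 h'')
        linarith
      · rw [hy2 j l h (by omega)]
        have p1 := mul_nonneg ha.le (sub_nonneg.2 hlr)
        linarith
  · intro j l hj hjl
    rw [hM] at hj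
    have e : R.X (r + j) * Real.cos (wedgeAngle k) - R.y (r + j) l * Real.sin (wedgeAngle k)
        = R.X (r + j) * Real.cos (wedgeAngle k) + -R.y (r + j) l * Real.sin (wedgeAngle k) := by
      ring
    rw [e]
    apply scaled_neighbor hk
    rw [hX, hX, Nat.cast_sub hjl]
    rcases hr with ⟨h, h0⟩ | hr
    · rw [hy6 h, h6 h, h0]; push_cast; ring
    · rw [hy1 j l hjl (by omega)]; ring
  · intro j l hj hl hjl
    rw [hm] at hl
    rw [hM] at hj
    have e : R.X (r + j) * Real.cos (wedgeAngle k) - R.y (r + j) l * Real.sin (wedgeAngle k)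
        = R.X (r + j) * Real.cos (wedgeAngle k) + -R.y (r + j) l * Real.sin (wedgeAngle k) := by
      ring
    rw [e]
    apply scaled_neighbor_le hk
    rw [hX, hX0]
    have hjl' : (j : ℝ) ≤ l := by exact_mod_cast hjl
    rcases hr with ⟨h, h0⟩ | hr
    · rw [hy6 h, h6 h]; linarith
    · have h'' : (j : ℝ) ≤ r := by exact_mod_cast (show j ≤ r by omega)
      rcases le_total l r with h | h
      · rw [hy2 j l hjl h]
        have h' : (l : ℝ) ≤ r := by exact_mod_cast h
        have p1 := mul_nonneg ha.le (sub_nonneg.2 hjl')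
        linarith
      · rw [hy3 j l hjl h]
        have h' : (r : ℝ) ≤ l := by exact_mod_cast h
        have p1 := mul_nonneg ha.le (mul_nonneg (by linarith : 0 ≤ 1 + rowGap k) (sub_nonneg.2 h'))
        have p2 := mul_nonneg ha.le (sub_nonneg.2 h'')
        linarith
  · intro ρ hρ
    rw [hM] at hρ
    apply scaled_far_le hk
    rw [hX0]
    rcases hr with ⟨h, h0⟩ | hr
    · rw [h6 h, h0]; simp
    · have hXM : R.X ρ * wedgeTan k ≤ r + rowGap k * r := by
        have h1 := R.X_mono (σ := R.M) hρ le_rfl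
        rw [show R.M = r + (M - r) by omega] at h1
        have h2 := mul_le_mul_of_nonneg_right h1 hτ.le
        rw [hX] at h2
        have h3 : ((M - r : ℕ) : ℝ) ≤ r := by exact_mod_cast (show M - r ≤ r by omega)
        have := mul_le_mul_of_nonneg_left h3 ha.le
        linarith
      have h0 : 0 ≤ R.X ρ * wedgeTan k := mul_nonneg (R.X_nonneg hρ) hτ.le
      have := mul_nonneg h0 ha.le
      linarith
  · intro j q hj hq
    rw [hm, hm] at hq
    rcases Nat.lt_or_ge (q / 2) r with h | h
    · left
      rintro e l (⟨he, hl⟩ | ⟨he, hl⟩) <;> rw [heb, heb] at hl <;> rw [hm] <;> omega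
    · right
      refine ⟨q / 2 - r, ?_⟩
      rintro e l (⟨he, hl⟩ | ⟨he, hl⟩) <;> rw [heb, heb] at hl <;> rw [hm] <;> omega
  · intro j q hj hq
    rw [hm, hm] at hq
    rcases Nat.lt_or_ge j ((q + 1) / 2) with h | h
    · left
      rintro e l (⟨he, hl⟩ | ⟨he, hl⟩) <;> rw [heb, heb] at hl <;> omega
    · right
      refine ⟨j - (q + 1) / 2, ?_⟩
      rintro e l (⟨he, hl⟩ | ⟨he, hl⟩) <;> rw [heb, heb] at hl <;> omega

lemma fineMesh_sliced {k : ℕ} (hk : 6 ≤ k) {r : ℕ} (hr : 0 < r) :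
    (fineMesh hk r hr).Sliced (2 * r) := by
  have ha := rowGap_pos hk
  have ha' := rowGap_le_one hk
  have hτ := wedgeTan_pos (show 3 ≤ k by omega)
  set R := fineMesh hk r hr with hR
  have hX : ∀ j, R.X (2 * r + j) * wedgeTan k = r + rowGap k * j := by
    intro j
    simp only [hR, fineMesh]
    rw [div_mul_cancel₀ _ hτ.ne', Nat.add_sub_cancel_left, min_eq_right (by omega)]
    push_cast; ring
  have hX0 : R.X (2 * r) * wedgeTan k = r := by simpa using hX 0
  have hy1 : ∀ j l : ℕ, l ≤ j → j ≤ r → R.y (2 * r + j) l = l - r - rowGap k * (j - l) := by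
    intro j l h h'
    simp only [hR, fineMesh]
    rw [Nat.add_sub_cancel_left, Nat.cast_sub h, min_eq_right (by omega),
      show l - (2 * r - j) = 0 by omega]
    push_cast; ring
  have hy2 : ∀ j l : ℕ, j ≤ l → l + j ≤ 2 * r → R.y (2 * r + j) l = l - r := by
    intro j l h h'
    simp only [hR, fineMesh]
    rw [Nat.add_sub_cancel_left, show j - l = 0 by omega, min_eq_right (by omega),
      show l - (2 * r - j) = 0 by omega]
    push_cast; ring
  have hy3 : ∀ j l : ℕ, j ≤ r → 2 * r ≤ l + j →
      R.y (2 * r + j) l = l - r + rowGap k * (l + j - 2 * r) := by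
    intro j l h h'
    simp only [hR, fineMesh]
    rw [Nat.add_sub_cancel_left, show j - l = 0 by omega, min_eq_right (by omega),
      show l - (2 * r - j) = l + j - 2 * r by omega, Nat.cast_sub h']
    push_cast; ring
  have hm : ∀ j, R.m (2 * r + j) = 2 * r := by
    intro j; simp only [hR, fineMesh]; omega
  have hM : R.M = 3 * r := rfl
  have heb : ∀ j q, R.eb (2 * r + j) q = if q < 2 * r then q / 2 else (q + 1) / 2 := by
    intro j q
    simp only [hR, fineMesh]
    simp
  refine ⟨by omega, ?_, ?_, ?_, ?_, ?_, ?_, ?_⟩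
  · intro j l hj hl hjl
    rw [hm] at hl hjl ⊢
    rw [hM] at hj
    apply scaled_neighbor hk
    rw [hX, hX, Nat.cast_sub hjl, hy3 j l (by omega) hjl]
    push_cast; ring
  · intro j l hj hjl
    rw [hm] at hjl
    rw [hM] at hj
    apply scaled_neighbor_le hk
    rw [hX, hX0]
    have hlr : (l : ℝ) + j ≤ 2 * r := by exact_mod_cast hjl
    have p1 := mul_nonneg ha.le (sub_nonneg.2 hlr)
    rcases le_total l j with h | h
    · rw [hy1 j l h (by omega)]
      have h' : (l : ℝ) ≤ j := by exact_mod_cast h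
      have p2 := mul_nonneg ha.le (mul_nonneg ha.le (sub_nonneg.2 h'))
      linarith
    · rw [hy2 j l h hjl]
      linarith
  · intro j l hj hjl
    rw [hM] at hj
    have e : R.X (2 * r + j) * Real.cos (wedgeAngle k)
          - R.y (2 * r + j) l * Real.sin (wedgeAngle k)
        = R.X (2 * r + j) * Real.cos (wedgeAngle k)
          + -R.y (2 * r + j) l * Real.sin (wedgeAngle k) := by
      ring
    rw [e]
    apply scaled_neighbor hk
    rw [hX, hX, Nat.cast_sub hjl, hy1 j l hjl (by omega)]
    ring
  · intro j l hj hl hjl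
    rw [hm] at hl
    rw [hM] at hj
    have e : R.X (2 * r + j) * Real.cos (wedgeAngle k)
          - R.y (2 * r + j) l * Real.sin (wedgeAngle k)
        = R.X (2 * r + j) * Real.cos (wedgeAngle k)
          + -R.y (2 * r + j) l * Real.sin (wedgeAngle k) := by
      ring
    rw [e]
    apply scaled_neighbor_le hk
    rw [hX, hX0]
    have hjl' : (j : ℝ) ≤ l := by exact_mod_cast hjl
    have p1 := mul_nonneg ha.le (sub_nonneg.2 hjl')
    rcases le_total (l + j) (2 * r) with h | h
    · rw [hy2 j l hjl h]
      linarith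
    · rw [hy3 j l (by omega) h]
      have h' : 2 * (r : ℝ) ≤ l + j := by exact_mod_cast h
      have p2 := mul_nonneg ha.le (mul_nonneg ha.le (sub_nonneg.2 h'))
      linarith
  · intro ρ hρ
    rw [hM] at hρ
    apply scaled_far_le hk
    rw [hX0]
    have hXM : R.X ρ * wedgeTan k ≤ r + rowGap k * r := by
      have h1 := R.X_mono (σ := R.M) hρ le_rfl
      rw [show R.M = 2 * r + r by omega] at h1
      have h2 := mul_le_mul_of_nonneg_right h1 hτ.le
      rwa [hX] at h2
    have h0 : 0 ≤ R.X ρ * wedgeTan k := mul_nonneg (R.X_nonneg hρ) hτ.le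
    have := mul_nonneg h0 ha.le
    linarith
  · intro j q hj hq
    rw [hM] at hj
    rw [hm, add_assoc, hm] at hq
    rcases Nat.lt_or_ge ((q + 1) / 2 + j) (2 * r) with h | h
    · left
      rintro e l (⟨he, hl⟩ | ⟨he, hl⟩) <;> rw [heb, heb] at hl <;> rw [hm] <;>
        split_ifs at hl <;> omega
    · right
      refine ⟨(q + 1) / 2 + j - 2 * r, ?_⟩
      rintro e l (⟨he, hl⟩ | ⟨he, hl⟩) <;> rw [heb, heb] at hl <;> rw [hm] <;>
        split_ifs at hl <;> omega
  · intro j q hj hq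
    rw [hM] at hj
    rw [hm, add_assoc, hm] at hq
    rcases Nat.lt_or_ge j ((q + 1) / 2) with h | h
    · left
      rintro e l (⟨he, hl⟩ | ⟨he, hl⟩) <;> rw [heb, heb] at hl <;> split_ifs at hl <;> omega
    · right
      refine ⟨j - (q + 1) / 2, ?_⟩
      rintro e l (⟨he, hl⟩ | ⟨he, hl⟩) <;> rw [heb, heb] at hl <;> split_ifs at hl <;> omega

/-! ### Polygons bounded by rows -/

namespace RowMesh

variable {k : ℕ}

/-- The polygon that is bounded by the row `b + s i` of each wedge `i`. -/
def poly (R : RowMesh k) (b : ℕ) (s : ℕ → ℕ) : Set Plane :=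
  {x | ∀ i : Fin k, nrm ((i : ℕ) * wedgeAngle k) x ≤ R.X (b + s i)}

/-- The triangles inside a polygon that is bounded by rows. -/
def polyTris (R : RowMesh k) (b : ℕ) (s : ℕ → ℕ) : Set (Set Plane) :=
  {t ∈ R.tris | ∀ i : Fin k, ∀ v ∈ t, nrm ((i : ℕ) * wedgeAngle k) v ≤ R.X (b + s i)}

variable {R : RowMesh k} {b : ℕ} {s s' : ℕ → ℕ}

/-- The bounding rows are unions of edges, so that they cut no triangle. -/
theorem Sliced.isTriangulation (h : R.Sliced b) (hs : ∀ i, b + s i < R.M)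
    (hpos : ∀ i, 0 < b + s i) : IsTriangulation (R.polyTris b s) (R.poly b s) := by
  have hX : ∀ i : Fin k, 0 < R.X (b + s i) := by
    intro i
    have := R.X_strict (hpos i) (hs i).le
    rwa [R.X_zero] at this
  have h0 : (0 : Plane) ∈ R.domain := by
    intro i _
    rw [map_zero]
    exact R.X_nonneg le_rfl
  have key := R.isTriangulation.restrict (fun i : Fin k => nrm ((i : ℕ) * wedgeAngle k))
    (fun i => R.X (b + s i)) hX h0
    (fun i t ht => h.cut (by omega) (hs i).le i ht)
  have e : R.domain ∩ {x | ∀ i : Fin k, nrm ((i : ℕ) * wedgeAngle k) x ≤ R.X (b + s i)}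
      = R.poly b s := by
    refine Set.inter_eq_right.2 fun x hx i hi => ?_
    exact (hx ⟨i, hi⟩).trans (R.X_mono (hs i).le le_rfl)
  rwa [e] at key

lemma polyTris_nonempty (h : IsTriangulation (R.polyTris b s) (R.poly b s))
    (hs : ∀ i, b + s i < R.M) : (R.polyTris b s).Nonempty := by
  have h0 : (0 : Plane) ∈ R.poly b s := by
    intro i
    rw [map_zero]
    exact R.X_nonneg (hs i).le
  obtain ⟨t, ht, -⟩ := (h.cover 0).1 h0
  exact ⟨t, ht⟩

/-- Each row that bounds the polygon contributes a nondegenerate side. -/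
lemma exists_side (hk : 4 ≤ k) (hpos : ∀ i, 0 < R.X (b + s i))
    (hwin : ∀ i j, R.X (b + s i) * Real.cos (wedgeAngle k) < R.X (b + s j)) (i : Fin k) :
    ∃ y z, y ≠ z ∧ y ∈ R.poly b s ∧ z ∈ R.poly b s ∧
      nrm ((i : ℕ) * wedgeAngle k) y = R.X (b + s i) ∧
      nrm ((i : ℕ) * wedgeAngle k) z = R.X (b + s i) := by
  have h3 : 3 ≤ k := by omega
  -- points close to the foot of the perpendicular from the origin
  have hev : ∀ j : Fin k, ∀ᶠ Y in nhds (0 : ℝ),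
      nrm ((j : ℕ) * wedgeAngle k) (frame ((i : ℕ) * wedgeAngle k) (R.X (b + s i)) Y)
        ≤ R.X (b + s j) := by
    intro j
    rcases eq_or_ne (i : ℕ) (j : ℕ) with hij | hij
    · refine Filter.Eventually.of_forall fun Y => ?_
      rw [← hij, nrm_frame]
    · obtain ⟨d, hd0, hdk, hd⟩ := exists_offset i.2 j.2 hij
      have hcos : Real.cos (d * wedgeAngle k) ≤ Real.cos (wedgeAngle k) := by
        have := cos_half_multiple_le h3 (m := 2 * d) (p := 2) (by omega) (by omega)
        push_cast at this
        rwa [show 2 * (d : ℝ) * (wedgeAngle k / 2) = d * wedgeAngle k by ring,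
          show 2 * (wedgeAngle k / 2) = wedgeAngle k by ring] at this
      have hlt : R.X (b + s i) * Real.cos (d * wedgeAngle k)
          + 0 * Real.sin (d * wedgeAngle k) < R.X (b + s j) := by
        rw [zero_mul, add_zero]
        exact (mul_le_mul_of_nonneg_left hcos (hpos i).le).trans_lt (hwin i j)
      have hcont : Continuous fun Y : ℝ => R.X (b + s i) * Real.cos (d * wedgeAngle k)
          + Y * Real.sin (d * wedgeAngle k) := by fun_prop
      filter_upwards [hcont.continuousAt.eventually (gt_mem_nhds hlt)] with Y hY
      rw [← hd, nrm_mod h3, nrm_frame_nat, hd]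
      exact hY.le
  have hall := Filter.eventually_all.2 hev
  obtain ⟨Y, hY, hY0⟩ := ((hall.filter_mono nhdsWithin_le_nhds).and
    (self_mem_nhdsWithin (a := (0 : ℝ)) (s := Set.Ioi 0))).exists
  refine ⟨frame ((i : ℕ) * wedgeAngle k) (R.X (b + s i)) 0,
    frame ((i : ℕ) * wedgeAngle k) (R.X (b + s i)) Y, ?_, hall.self_of_nhds, hY, nrm_frame _ _ _,
    nrm_frame _ _ _⟩
  intro heq
  have := congrArg (tng ((i : ℕ) * wedgeAngle k)) heq
  rw [tng_frame, tng_frame] at this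
  exact (ne_of_gt hY0) this.symm

lemma poly_mem_convexPolygons (hk : 4 ≤ k) (h : R.Sliced b) (hs : ∀ i, b + s i < R.M)
    (hpos : ∀ i, 0 < b + s i) (hle : ∀ i, s' i ≤ s i) (hpos' : ∀ i, 0 < b + s' i)
    (hwin : ∀ i j, R.X (b + s' i) * Real.cos (wedgeAngle k) < R.X (b + s' j)) :
    R.poly b s' ∈ (h.isTriangulation hs hpos).toPlaneGraph.convexPolygons := by
  have hs' : ∀ i, b + s' i < R.M := fun i => (Nat.add_le_add_left (hle i) b).trans_lt (hs i)
  have hX : ∀ i, 0 < R.X (b + s' i) := by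
    intro i
    have := R.X_strict (hpos' i) (hs' i).le
    rwa [R.X_zero] at this
  have hT := h.isTriangulation hs' hpos'
  have hm : ∀ i : Fin k, 0 < R.X (b + s' i) := fun i => hX i
  refine ⟨IsTriangulation.isConvexPolygon hT hm,
    IsTriangulation.isRespectedBy (h.isTriangulation hs hpos) hT ?_ hm ?_⟩
  · rintro t ⟨ht, ht'⟩
    exact ⟨ht, fun i v hv => (ht' i v hv).trans
      (R.X_mono (Nat.add_le_add_left (hle i) b) (hs i).le)⟩
  · exact exists_side hk hX hwin

/-- Different choices of rows bound different polygons, since each of the rows contributes a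
side. -/
lemma poly_injective (hk : 4 ≤ k) (hs : ∀ i, b + s i ≤ R.M) (hs' : ∀ i, b + s' i ≤ R.M)
    (hpos : ∀ i, 0 < R.X (b + s i)) (hpos' : ∀ i, 0 < R.X (b + s' i))
    (hwin : ∀ i j, R.X (b + s i) * Real.cos (wedgeAngle k) < R.X (b + s j))
    (hwin' : ∀ i j, R.X (b + s' i) * Real.cos (wedgeAngle k) < R.X (b + s' j))
    (heq : R.poly b s = R.poly b s') (i : Fin k) : s i = s' i := by
  obtain ⟨y, -, -, hy, -, hyi, -⟩ := exists_side hk hpos hwin i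
  obtain ⟨z, -, -, hz, -, hzi, -⟩ := exists_side hk hpos' hwin' i
  rw [heq] at hy
  rw [← heq] at hz
  have h1 := hy i
  have h2 := hz i
  rw [hyi] at h1
  rw [hzi] at h2
  rcases Nat.lt_trichotomy (s i) (s' i) with hlt | h | hlt
  · exact absurd (R.X_strict (Nat.add_lt_add_left hlt b) (hs' i)) (not_lt.2 h2)
  · exact h
  · exact absurd (R.X_strict (Nat.add_lt_add_left hlt b) (hs i)) (not_lt.2 h1)

/-- The polygons bounded by rows with numbers from an interval of length `W` respect the mesh, and
the row can be chosen independently in each of the `k` wedges. -/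
theorem pow_le_ncard_convexPolygons (hk : 4 ≤ k) (h : R.Sliced b) (hs : ∀ i, b + s i < R.M)
    (hpos : ∀ i, 0 < b + s i) {lo W : ℕ} (hlo : 0 < b + lo) (hW : ∀ i, lo + W ≤ s i + 1)
    (hwin : ∀ i < W, ∀ j < W,
      R.X (b + (lo + i)) * Real.cos (wedgeAngle k) < R.X (b + (lo + j))) :
    W ^ k ≤ (h.isTriangulation hs hpos).toPlaneGraph.convexPolygons.ncard := by
  classical
  have hk0 : 0 < k := by omega
  let S : (Fin k → Fin W) → ℕ → ℕ := fun f i => lo + f ⟨i % k, Nat.mod_lt _ hk0⟩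
  have hS : ∀ f i, ∃ w < W, S f i = lo + w := fun f i => ⟨_, (f _).2, rfl⟩
  have hle : ∀ f i, S f i ≤ s i := by
    intro f i
    obtain ⟨w, hw, e⟩ := hS f i
    have := hW i
    omega
  have hlt : ∀ f i, b + S f i < R.M := fun f i => by have := hle f i; have := hs i; omega
  have hpos' : ∀ f i, 0 < b + S f i := by
    intro f i
    obtain ⟨w, hw, e⟩ := hS f i
    omega
  have hX : ∀ f i, 0 < R.X (b + S f i) := by
    intro f i
    have := R.X_strict (hpos' f i) (hlt f i).le
    rwa [R.X_zero] at this
  have hwin' : ∀ f i j, R.X (b + S f i) * Real.cos (wedgeAngle k) < R.X (b + S f j) := by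
    intro f i j
    obtain ⟨w, hw, e⟩ := hS f i
    obtain ⟨w', hw', e'⟩ := hS f j
    rw [e, e']
    exact hwin w hw w' hw'
  have hinj : Function.Injective fun f => R.poly b (S f) := by
    intro f g hfg
    funext i
    have := poly_injective hk (fun i => (hlt f i).le) (fun i => (hlt g i).le) (hX f) (hX g)
      (hwin' f) (hwin' g) hfg i
    have hi : (⟨(i : ℕ) % k, Nat.mod_lt _ hk0⟩ : Fin k) = i := Fin.ext (Nat.mod_eq_of_lt i.2)
    simp only [S, hi] at this
    exact Fin.ext (by omega)
  have hsub : Set.range (fun f => R.poly b (S f)) ⊆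
      (h.isTriangulation hs hpos).toPlaneGraph.convexPolygons := by
    rintro _ ⟨f, rfl⟩
    exact poly_mem_convexPolygons hk h hs hpos (hle f) (hpos' f) (hwin' f)
  have hcard : (Set.range fun f => R.poly b (S f)).ncard = W ^ k := by
    rw [← Set.image_univ, Set.ncard_image_of_injective _ hinj, Set.ncard_univ]
    simp
  rw [← hcard]
  exact Set.ncard_le_ncard hsub (PlaneGraph.finite_convexPolygons _)

/-! ### The number of vertices in a polygon bounded by rows -/

/-- From row `b` on, each of the two adjacent wedges cuts off the points at one end of a row; the
other wedges impose no condition. -/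
lemma vertex_mem_poly_iff (h : R.Sliced b) (hs : ∀ i, b + s i < R.M)
    (hper : ∀ i, s (i + k) = s i) {i ρ l : ℕ} (hi : i < k) (hρ : ρ ≤ R.M) (hl : l ≤ R.m ρ) :
    R.vertex i ρ l ∈ R.poly b s ↔
      ρ ≤ b + s i ∧ l + (ρ - b) ≤ R.m ρ + s (i + 1) ∧ ρ - b ≤ l + s (i + (k - 1)) := by
  have h3 := R.three_le
  have hmod : ∀ j, s (j % k) = s j := Function.Periodic.map_mod_nat hper
  have hXle : ∀ {σ τ : ℕ}, σ ≤ R.M → R.X σ ≤ R.X τ → σ ≤ τ := by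
    intro σ τ hσ hle
    by_contra hcon
    exact absurd (R.X_strict (not_le.1 hcon) hσ) (not_lt.2 hle)
  constructor
  · intro hv
    have hv' : ∀ d, nrm ((i + d : ℕ) * wedgeAngle k) (R.vertex i ρ l) ≤ R.X (b + s (i + d)) := by
      intro d
      rw [← nrm_mod h3, ← hmod]
      exact hv ⟨(i + d) % k, Nat.mod_lt _ (by omega)⟩
    refine ⟨?_, ?_, ?_⟩
    · have := hv' 0
      rw [Nat.add_zero, nrm_vertex] at this
      exact hXle hρ this
    · by_contra hcon
      have hb : b ≤ ρ := by omega
      obtain ⟨j, rfl⟩ := Nat.exists_eq_add_of_le hb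
      rw [Nat.add_sub_cancel_left] at hcon
      have := hv' 1
      rw [nrm_add_one_vertex, h.right_eq j l hρ hl (by omega)] at this
      have := hXle (by omega) this
      omega
    · by_contra hcon
      have hb : b ≤ ρ := by omega
      obtain ⟨j, rfl⟩ := Nat.exists_eq_add_of_le hb
      rw [Nat.add_sub_cancel_left] at hcon
      have := hv' (k - 1)
      rw [nrm_pred_vertex, h.left_eq j l hρ (by omega)] at this
      have := hXle (by omega) this
      omega
  · rintro ⟨c0, c1, c2⟩ j
    have hXb : R.X b ≤ R.X (b + s j) := R.X_mono (by omega) (hs j).le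
    rcases eq_or_ne i (j : ℕ) with hij | hij
    · rw [← hij, nrm_vertex]
      exact R.X_mono c0 (hs i).le
    obtain ⟨d, hd0, hdk, hd⟩ := exists_offset hi j.2 hij
    have hsd : s j = s (i + d) := by rw [← hd, hmod]
    rw [← hd, nrm_mod h3, hd]
    rcases Nat.lt_or_ge ρ b with hb | hb
    · exact ((R.nrm_vertex_le i d hρ hl).trans (R.X_mono hb.le (by have := h.b_le; omega))).trans
        hXb
    obtain ⟨e, rfl⟩ := Nat.exists_eq_add_of_le hb
    rw [Nat.add_sub_cancel_left] at c1 c2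
    by_cases hd1 : d = 1
    · subst hd1
      rw [nrm_add_one_vertex]
      rcases le_total (R.m (b + e)) (l + e) with h1 | h1
      · rw [h.right_eq e l hρ hl h1]
        exact R.X_mono (by omega) (hs j).le
      · exact (h.right_le e l hρ h1).trans hXb
    by_cases hd2 : d = k - 1
    · subst hd2
      rw [nrm_pred_vertex]
      rcases le_total l e with h1 | h1
      · rw [h.left_eq e l hρ h1]
        exact R.X_mono (by omega) (hs j).le
      · exact (h.left_le e l hρ hl h1).trans hXb
    · obtain ⟨y1, y2⟩ := R.y_bounds hρ hl
      rw [vertex, nrm_frame_nat]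
      exact ((nrm_far_le h3 (by omega) (by omega) y1 y2).trans (h.far_le _ hρ)).trans hXb

lemma vertex_mem_sUnion_tris (R : RowMesh k) {i ρ l : ℕ} (hi : i < k) (hρ : ρ < R.M)
    (hl : l ≤ R.m ρ) : R.vertex i ρ l ∈ ⋃₀ R.tris := by
  have key : ∀ N ≤ R.m ρ + R.m (ρ + 1), l ≤ R.eb ρ N → ∃ q ≤ N, R.eb ρ q = l := by
    intro N
    induction N with
    | zero =>
      intro _ h
      rw [R.eb_zero ρ hρ] at h
      exact ⟨0, le_rfl, by rw [R.eb_zero ρ hρ]; omega⟩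
    | succ N ih =>
      intro hN h
      rcases h.eq_or_lt with h' | h'
      · exact ⟨N + 1, le_rfl, h'.symm⟩
      · obtain ⟨q, hq, e⟩ := ih (by omega) (by
          rcases R.eb_step ρ hρ N (by omega) with h'' | h'' <;> omega)
        exact ⟨q, by omega, e⟩
  obtain ⟨q, hq, e⟩ := key _ le_rfl (by rw [R.eb_last ρ hρ]; exact hl)
  have hm := R.m_pos (show 0 < ρ + 1 by omega) hρ
  have hv : R.vertex i ρ l ∈ R.edge i ρ q := Or.inl (by rw [e])
  rcases hq.lt_or_eq with h | h
  · exact ⟨_, ⟨i, hi, ρ, hρ, q, h, rfl⟩, Or.inl hv⟩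
  · refine ⟨_, ⟨i, hi, ρ, hρ, q - 1, by omega, rfl⟩, Or.inr ?_⟩
    rwa [Nat.sub_add_cancel (by omega)]

lemma vertex_row_zero (R : RowMesh k) (i : ℕ) {l : ℕ} (hl : l ≤ R.m 0) : R.vertex i 0 l = 0 := by
  have h := R.y_bounds (Nat.zero_le _) hl
  rw [R.X_zero, zero_mul, neg_zero] at h
  have : R.y 0 l = 0 := le_antisymm h.2 h.1
  rw [vertex, R.X_zero, this]
  apply plane_ext <;> simp

/-- Each vertex other than the origin has a unique name `vertex i ρ l` with `i < k` and `0 < l`. -/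
lemma exists_vertex_name (R : RowMesh k) {v : Plane} (hv : v ∈ ⋃₀ R.tris) :
    v = 0 ∨ ∃ i < k, ∃ ρ, 0 < ρ ∧ ρ ≤ R.M ∧ ∃ l, 0 < l ∧ l ≤ R.m ρ ∧ v = R.vertex i ρ l := by
  obtain ⟨t, ⟨i, hi, ρ, hρ, q, hq, rfl⟩, hvt⟩ := hv
  obtain ⟨σ, l, rfl, hσ, hl⟩ := R.exists_vertex_of_mem_tri hρ hq hvt
  rcases Nat.eq_zero_or_pos σ with rfl | hσ0
  · exact Or.inl (R.vertex_row_zero i hl)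
  right
  have hσM : σ ≤ R.M := by omega
  rcases Nat.eq_zero_or_pos l with rfl | hl0
  · have hm := R.m_pos hσ0 hσM
    have h3 := R.three_le
    refine ⟨(i + (k - 1)) % k, Nat.mod_lt _ (by omega), σ, hσ0, hσM, R.m σ, hm, le_rfl, ?_⟩
    rw [mod_vertex, ← R.vertex_succ_zero _ hσM, show i + (k - 1) + 1 = i + k by omega,
      ← R.mod_vertex (i + k), Nat.add_mod_right, mod_vertex]
  · exact ⟨i, hi, σ, hσ0, hσM, l, hl0, hl, rfl⟩

lemma vertex_name_injective (R : RowMesh k) {i i' ρ ρ' l l' : ℕ} (hi : i < k) (hi' : i' < k)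
    (hρ : ρ ≤ R.M) (hρ' : ρ' ≤ R.M) (hl0 : 0 < l) (hl : l ≤ R.m ρ)
    (hl0' : 0 < l') (hl' : l' ≤ R.m ρ') (heq : R.vertex i ρ l = R.vertex i' ρ' l') :
    i = i' ∧ ρ = ρ' ∧ l = l' := by
  have h3 := R.three_le
  have hzero : ∀ {i ρ l}, ρ ≤ R.M → 0 < l → l ≤ R.m ρ → R.vertex i ρ l ≠ R.vertex i ρ 0 := by
    intro i ρ l hρ hl0 hl h
    have := congrArg (tng (i * wedgeAngle k)) h
    rw [tng_vertex, tng_vertex] at this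
    exact absurd (R.y_strict hρ hl0 hl) (by rw [this]; exact lt_irrefl _)
  have hii : i = i' := by
    by_contra hne
    obtain ⟨d, hd0, hdk, hd⟩ := exists_offset hi hi' hne
    obtain ⟨e, he0, hek, he⟩ := exists_offset hi' hi (Ne.symm hne)
    obtain ⟨a1, a2⟩ := R.nrm_add_vertex_le i hd0 hdk hρ hl
    obtain ⟨b1, b2⟩ := R.nrm_add_vertex_le i' he0 hek hρ' hl'
    rw [← nrm_mod h3 (i + d), hd] at a1 a2
    rw [← nrm_mod h3 (i' + e), he, ← heq] at b1 b2
    have e1 := le_antisymm a1 b1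
    have c1 : d = 1 := by
      by_contra hd1
      exact hzero hρ hl0 hl ((a2 e1).1 hd1)
    have c2 : e = 1 := by
      by_contra he1
      exact hzero hρ' hl0' hl' (heq ▸ (b2 e1.symm).1 he1)
    subst c1 c2
    -- each of two wedges cannot be the successor of the other one
    rw [← hd] at he
    have : (i + 2) % k = i % k := by
      rw [Nat.mod_add_mod, add_assoc] at he
      rw [Nat.mod_eq_of_lt hi]; exact he
    have h2 : 2 % k = 0 := by
      have := (Nat.ModEq.add_left_cancel' i (show i + 2 ≡ i + 0 [MOD k] from this))
      exact this
    rw [Nat.mod_eq_of_lt (by omega)] at h2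
    omega
  subst hii
  have hX := congrArg (nrm (i * wedgeAngle k)) heq
  have hY := congrArg (tng (i * wedgeAngle k)) heq
  rw [nrm_vertex, nrm_vertex] at hX
  rw [tng_vertex, tng_vertex] at hY
  have hρρ : ρ = ρ' := by
    rcases Nat.lt_trichotomy ρ ρ' with hlt | h | hlt
    · exact absurd (R.X_strict hlt hρ') (by rw [hX]; exact lt_irrefl _)
    · exact h
    · exact absurd (R.X_strict hlt hρ) (by rw [hX]; exact lt_irrefl _)
  subst hρρ
  refine ⟨rfl, rfl, ?_⟩
  rcases Nat.lt_trichotomy l l' with hlt | h | hlt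
  · exact absurd (R.y_strict hρ hlt hl') (by rw [hY]; exact lt_irrefl _)
  · exact h
  · exact absurd (R.y_strict hρ hlt hl) (by rw [hY]; exact lt_irrefl _)

/-- The numbers of the points of row `ρ` of the wedge `i` that lie in a polygon; the first point
of the row is left out, since it belongs to the preceding wedge as well. -/
def rowPoints (R : RowMesh k) (b : ℕ) (s : ℕ → ℕ) (i ρ : ℕ) : Finset ℕ :=
  (Finset.Icc 1 (R.m ρ)).filter fun l =>
    l + (ρ - b) ≤ R.m ρ + s (i + 1) ∧ ρ - b ≤ l + s (i + (k - 1))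

lemma sUnion_polyTris (h : R.Sliced b) (hs : ∀ i, b + s i < R.M) (hpos : ∀ i, 0 < b + s i) :
    ⋃₀ R.polyTris b s = ⋃₀ R.tris ∩ R.poly b s := by
  have hT := h.isTriangulation hs hpos
  ext v
  constructor
  · rintro ⟨t, ht, hv⟩
    exact ⟨⟨t, ht.1, hv⟩, fun i => ht.2 i v hv⟩
  · rintro ⟨hv, hP⟩
    obtain ⟨t, ht, hvt⟩ := (hT.cover v).1 hP
    exact ⟨t, ht, R.isTriangulation.mem_of_mem_hull hv ht.1 hvt⟩

lemma size_eq_sum_rowPoints (h : R.Sliced b) (hs : ∀ i, b + s i < R.M) (hpos : ∀ i, 0 < b + s i)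
    (hper : ∀ i, s (i + k) = s i) : (h.isTriangulation hs hpos).toPlaneGraph.size =
      1 + ∑ i ∈ Finset.range k, ∑ ρ ∈ Finset.Icc 1 (b + s i), (R.rowPoints b s i ρ).card := by
  classical
  have h3 := R.three_le
  let I : Finset (Σ _ : ℕ, Σ _ : ℕ, ℕ) := (Finset.range k).sigma fun i =>
    (Finset.Icc 1 (b + s i)).sigma fun ρ => R.rowPoints b s i ρ
  let f : (Σ _ : ℕ, Σ _ : ℕ, ℕ) → Plane := fun p => R.vertex p.1 p.2.1 p.2.2
  have hmemI : ∀ p ∈ I, p.1 < k ∧ 0 < p.2.1 ∧ p.2.1 ≤ R.M ∧ p.2.1 ≤ b + s p.1 ∧ 0 < p.2.2 ∧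
      p.2.2 ≤ R.m p.2.1 ∧ p.2.2 + (p.2.1 - b) ≤ R.m p.2.1 + s (p.1 + 1) ∧
      p.2.1 - b ≤ p.2.2 + s (p.1 + (k - 1)) := by
    rintro ⟨i, ρ, l⟩ hp
    simp only [I, rowPoints, Finset.mem_sigma, Finset.mem_range, Finset.mem_Icc,
      Finset.mem_filter] at hp
    have := hs i
    obtain ⟨h1, ⟨h2, h2'⟩, ⟨h4, h4'⟩, h5, h6⟩ := hp
    exact ⟨h1, h2, h2'.trans this.le, h2', h4, h4', h5, h6⟩
  have hinj : Set.InjOn f I := by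
    rintro ⟨i, ρ, l⟩ hp ⟨i', ρ', l'⟩ hp' heq
    obtain ⟨a1, a2, a3, -, a4, a5, -⟩ := hmemI _ hp
    obtain ⟨b1, b2, b3, -, b4, b5, -⟩ := hmemI _ hp'
    obtain ⟨rfl, rfl, rfl⟩ := R.vertex_name_injective a1 b1 a3 b3 a4 a5 b4 b5 heq
    rfl
  have hzero : (0 : Plane) ∉ I.image f := by
    intro h0
    obtain ⟨p, hp, hp0⟩ := Finset.mem_image.1 h0
    obtain ⟨-, a2, a3, -⟩ := hmemI p hp
    have h1 := congrArg (nrm (p.1 * wedgeAngle k)) hp0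
    rw [map_zero] at h1
    have h2 : R.X p.2.1 = 0 := (R.nrm_vertex p.1 p.2.1 p.2.2).symm.trans h1
    have h4 := R.X_strict a2 a3
    rw [R.X_zero, h2] at h4
    exact lt_irrefl _ h4
  have hverts : (h.isTriangulation hs hpos).toPlaneGraph.verts = insert 0 (I.image f) := by
    ext v
    rw [IsTriangulation.mem_verts_toPlaneGraph, sUnion_polyTris h hs hpos, Finset.mem_insert,
      Finset.mem_image]
    constructor
    · rintro ⟨hv, hP⟩
      rcases R.exists_vertex_name hv with rfl | ⟨i, hi, ρ, hρ0, hρ, l, hl0, hl, rfl⟩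
      · exact Or.inl rfl
      · right
        obtain ⟨c0, c1, c2⟩ := (vertex_mem_poly_iff h hs hper hi hρ hl).1 hP
        refine ⟨⟨i, ρ, l⟩, ?_, rfl⟩
        simp only [I, rowPoints, Finset.mem_sigma, Finset.mem_range, Finset.mem_Icc,
          Finset.mem_filter]
        exact ⟨hi, ⟨hρ0, c0⟩, ⟨hl0, hl⟩, c1, c2⟩
    · rintro (rfl | ⟨p, hp, rfl⟩)
      · have h0 := R.vertex_mem_sUnion_tris (i := 0) (l := 0) (by omega) R.M_pos (Nat.zero_le _)
        rw [R.vertex_row_zero 0 (Nat.zero_le _)] at h0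
        refine ⟨h0, fun i => ?_⟩
        rw [map_zero]
        exact R.X_nonneg (hs i).le
      · obtain ⟨a1, a2, a3, a3', a4, a5, a6, a7⟩ := hmemI p hp
        refine ⟨R.vertex_mem_sUnion_tris a1 (a3'.trans_lt (hs _)) a5, ?_⟩
        exact (vertex_mem_poly_iff h hs hper a1 a3 a5).2 ⟨a3', a6, a7⟩
  rw [PlaneGraph.size, hverts, Finset.card_insert_of_notMem hzero, Finset.card_image_of_injOn hinj,
    Finset.card_sigma, add_comm]
  simp only [Finset.card_sigma]

end RowMesh

/-! ### Closed formulas for the number of vertices -/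

lemma sum_min_pred_succ (p q : ℕ) :
    ∑ j ∈ Finset.Icc 1 q, min (j - 1) (p + 1) = ∑ j ∈ Finset.Icc 1 q, min (j - 1) p
      + (q - (p + 1)) := by
  induction q with
  | zero => simp
  | succ q ih =>
    rw [Finset.sum_Icc_succ_top (by omega), Finset.sum_Icc_succ_top (by omega), ih]
    omega

/-- The lattice points of a `p × q` rectangle, counted on both sides of a diagonal. -/
lemma sum_min_add_sum_min (p q : ℕ) :
    ∑ j ∈ Finset.Icc 1 p, min j q + ∑ j ∈ Finset.Icc 1 q, min (j - 1) p = p * q := by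
  induction p with
  | zero => simp
  | succ p ih =>
    rw [Finset.sum_Icc_succ_top (by omega), sum_min_pred_succ, Nat.succ_mul, ← ih]
    omega

lemma sum_range_shift_of_periodic {k : ℕ} {g : ℕ → ℕ} (hg : ∀ i, g (i + k) = g i) :
    ∑ i ∈ Finset.range k, g (i + (k - 1)) = ∑ i ∈ Finset.range k, g i := by
  rcases Nat.eq_zero_or_pos k with rfl | hk
  · simp
  have h : ∀ f : ℕ → ℕ, (∀ i, f (i + k) = f i) →
      ∑ i ∈ Finset.range k, f (i + 1) = ∑ i ∈ Finset.range k, f i := by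
    intro f hf
    have h1 := Finset.sum_range_succ f k
    have h2 := Finset.sum_range_succ' f k
    have h3 := hf 0
    rw [Nat.zero_add] at h3
    omega
  rw [← h (fun i => g (i + (k - 1))) (fun i => by
    rw [show i + k + (k - 1) = i + (k - 1) + k by omega, hg])]
  refine Finset.sum_congr rfl fun i _ => ?_
  rw [show i + 1 + (k - 1) = i + k by omega, hg]

namespace RowMesh

variable {k : ℕ} {R : RowMesh k} {b : ℕ} {s : ℕ → ℕ}

lemma card_rowPoints_inner (R : RowMesh k) {b : ℕ} (s : ℕ → ℕ) (i : ℕ) {ρ : ℕ} (h : ρ ≤ b) :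
    (R.rowPoints b s i ρ).card = R.m ρ := by
  have : R.rowPoints b s i ρ = Finset.Icc 1 (R.m ρ) := by
    refine Finset.filter_true_of_mem fun l hl => ?_
    have := Finset.mem_Icc.1 hl
    omega
  rw [this, Nat.card_Icc]
  omega

lemma card_rowPoints_outer (R : RowMesh k) (b : ℕ) (s : ℕ → ℕ) (i : ℕ) {j : ℕ} (hj : 1 ≤ j)
    (hv : 2 * j ≤ R.m (b + j) + 1 + min j (s (i + 1)) + min (j - 1) (s (i + (k - 1)))) :
    ((R.rowPoints b s i (b + j)).card : ℤ) = (R.m (b + j) + 1 - 2 * j)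
      + min j (s (i + 1)) + min (j - 1) (s (i + (k - 1))) := by
  have : R.rowPoints b s i (b + j) = Finset.Icc (max 1 (j - s (i + (k - 1))))
      (R.m (b + j) + min j (s (i + 1)) - j) := by
    ext l
    simp only [rowPoints, Finset.mem_filter, Finset.mem_Icc, Nat.add_sub_cancel_left]
    omega
  rw [this, Nat.card_Icc]
  omega

/-- The number of vertices in a polygon that is bounded by rows. The products `s i * s (i + 1)`
count the points in the parallelograms between adjacent wedges; by `hv` the parts that are cut off
at the two ends of a row are disjoint. -/
theorem size_formula (h : R.Sliced b) (hs : ∀ i, b + s i < R.M) (hpos : ∀ i, 0 < b + s i)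
    (hper : ∀ i, s (i + k) = s i)
    (hv : ∀ i j, 1 ≤ j → j ≤ s i →
      2 * j ≤ R.m (b + j) + 1 + min j (s (i + 1)) + min (j - 1) (s (i + (k - 1)))) :
    ((h.isTriangulation hs hpos).toPlaneGraph.size : ℤ) =
      1 + ∑ i ∈ Finset.range k, (∑ ρ ∈ Finset.Icc 1 b, (R.m ρ : ℤ)
        + ∑ j ∈ Finset.Icc 1 (s i), ((R.m (b + j) : ℤ) + 1 - 2 * j) + s i * s (i + 1)) := by
  have hrow : ∀ i, ((∑ ρ ∈ Finset.Icc 1 (b + s i), (R.rowPoints b s i ρ).card : ℕ) : ℤ) =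
      ∑ ρ ∈ Finset.Icc 1 b, (R.m ρ : ℤ)
        + ∑ j ∈ Finset.Icc 1 (s i), ((R.m (b + j) : ℤ) + 1 - 2 * j)
        + ((∑ j ∈ Finset.Icc 1 (s i), min j (s (i + 1)) : ℕ) : ℤ)
        + ((∑ j ∈ Finset.Icc 1 (s i), min (j - 1) (s (i + (k - 1))) : ℕ) : ℤ) := by
    intro i
    have hsplit : ∀ t ≤ s i, ((∑ ρ ∈ Finset.Icc 1 (b + t), (R.rowPoints b s i ρ).card : ℕ) : ℤ) =
        ∑ ρ ∈ Finset.Icc 1 b, (R.m ρ : ℤ)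
          + ∑ j ∈ Finset.Icc 1 t, ((R.m (b + j) : ℤ) + 1 - 2 * j)
          + ((∑ j ∈ Finset.Icc 1 t, min j (s (i + 1)) : ℕ) : ℤ)
          + ((∑ j ∈ Finset.Icc 1 t, min (j - 1) (s (i + (k - 1))) : ℕ) : ℤ) := by
      intro t
      induction t with
      | zero =>
        intro _
        have : ∑ ρ ∈ Finset.Icc 1 b, (R.rowPoints b s i ρ).card = ∑ ρ ∈ Finset.Icc 1 b, R.m ρ :=
          Finset.sum_congr rfl fun ρ hρ =>
            R.card_rowPoints_inner s i (Finset.mem_Icc.1 hρ).2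
        simp [this]
      | succ t ih =>
        intro ht
        have h1 := R.card_rowPoints_outer b s i (j := t + 1) (by omega)
          (hv i (t + 1) (by omega) ht)
        rw [← Nat.add_assoc, Finset.sum_Icc_succ_top (by omega),
          Finset.sum_Icc_succ_top (by omega), Finset.sum_Icc_succ_top (by omega),
          Finset.sum_Icc_succ_top (by omega), Nat.cast_add, ih (by omega), Nat.add_assoc, h1]
        push_cast
        ring
    exact hsplit (s i) le_rfl
  have hpair : ∑ i ∈ Finset.range k, (∑ j ∈ Finset.Icc 1 (s i), min j (s (i + 1))
      + ∑ j ∈ Finset.Icc 1 (s i), min (j - 1) (s (i + (k - 1))))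
      = ∑ i ∈ Finset.range k, s i * s (i + 1) := by
    have h3 := R.three_le
    have hg : ∑ i ∈ Finset.range k, ∑ j ∈ Finset.Icc 1 (s i), min (j - 1) (s (i + (k - 1)))
        = ∑ i ∈ Finset.range k, ∑ j ∈ Finset.Icc 1 (s (i + 1)), min (j - 1) (s i) := by
      rw [← sum_range_shift_of_periodic
        (g := fun i => ∑ j ∈ Finset.Icc 1 (s (i + 1)), min (j - 1) (s i)) (fun i => by
          simp only [show i + k + 1 = i + 1 + k by omega, hper])]
      refine Finset.sum_congr rfl fun i _ => ?_
      rw [show i + (k - 1) + 1 = i + k by omega, hper]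
    rw [Finset.sum_add_distrib, hg, ← Finset.sum_add_distrib]
    exact Finset.sum_congr rfl fun i _ => sum_min_add_sum_min _ _
  have hpair' := congrArg (Nat.cast : ℕ → ℤ) hpair
  push_cast at hpair'
  rw [size_eq_sum_rowPoints h hs hpos hper, Nat.cast_add, Nat.cast_sum,
    Finset.sum_congr rfl fun i _ => hrow i]
  push_cast
  simp only [Finset.sum_add_distrib] at hpair' ⊢
  linarith

end RowMesh

lemma two_mul_sum_Icc (n : ℕ) : 2 * ∑ ρ ∈ Finset.Icc 1 n, (ρ : ℤ) = n * (n + 1) := by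
  induction n with
  | zero => simp
  | succ n ih => rw [Finset.sum_Icc_succ_top (by omega), mul_add, ih]; push_cast; ring

lemma coarseMesh_size {k : ℕ} (hk : 6 ≤ k) {r M : ℕ} (hM : 0 < M) {s : ℕ → ℕ}
    (h : (coarseMesh hk r M hM).Sliced r) (hs : ∀ i, r + s i < M) (hpos : ∀ i, 0 < r + s i)
    (hper : ∀ i, s (i + k) = s i)
    (hv : ∀ i, s i ≤ r ∨ s i ≤ r + 1 + s (i + 1) + s (i + (k - 1))) :
    2 * ((h.isTriangulation hs hpos).toPlaneGraph.size : ℤ) =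
      2 + ∑ i ∈ Finset.range k,
        ((r : ℤ) * (r + 1) + (2 * r + 1) * s i - s i ^ 2 + 2 * (s i * s (i + 1))) := by
  have hrow : ∀ t : ℕ, 2 * ∑ j ∈ Finset.Icc 1 t, (((r + j : ℕ) : ℤ) + 1 - 2 * j)
      = (2 * r + 1) * t - (t : ℤ) ^ 2 := by
    intro t
    induction t with
    | zero => simp
    | succ t ih => rw [Finset.sum_Icc_succ_top (by omega), mul_add, ih]; push_cast; ring
  rw [RowMesh.size_formula h hs hpos hper]
  · rw [mul_add, Finset.mul_sum]
    congr 1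
    refine Finset.sum_congr rfl fun i _ => ?_
    have h1 := two_mul_sum_Icc r
    have h2 := hrow (s i)
    change 2 * (∑ ρ ∈ Finset.Icc 1 r, (ρ : ℤ)
      + ∑ j ∈ Finset.Icc 1 (s i), (((r + j : ℕ) : ℤ) + 1 - 2 * j) + s i * s (i + 1)) = _
    linarith
  · intro i j hj hji
    change 2 * j ≤ r + j + 1 + min j (s (i + 1)) + min (j - 1) (s (i + (k - 1)))
    have := hv i
    omega

lemma fineMesh_size {k : ℕ} (hk : 6 ≤ k) {r : ℕ} (hr : 0 < r) {s : ℕ → ℕ}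
    (h : (fineMesh hk r hr).Sliced (2 * r)) (hs : ∀ i, 2 * r + s i < 3 * r)
    (hpos : ∀ i, 0 < 2 * r + s i) (hper : ∀ i, s (i + k) = s i) :
    ((h.isTriangulation hs hpos).toPlaneGraph.size : ℤ) =
      1 + ∑ i ∈ Finset.range k,
        ((r : ℤ) * (2 * r + 1) + 2 * r * s i - s i ^ 2 + s i * s (i + 1)) := by
  have hm : ∀ j, (fineMesh hk r hr).m (2 * r + j) = 2 * r := by
    intro j; simp only [fineMesh]; omega
  have hm' : ∑ ρ ∈ Finset.Icc 1 (2 * r), ((fineMesh hk r hr).m ρ : ℤ)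
      = ∑ ρ ∈ Finset.Icc 1 (2 * r), (ρ : ℤ) := by
    refine Finset.sum_congr rfl fun ρ hρ => ?_
    have := (Finset.mem_Icc.1 hρ).2
    simp only [fineMesh]
    rw [min_eq_left this]
  have hrow : ∀ t : ℕ, ∑ j ∈ Finset.Icc 1 t, (((2 * r : ℕ) : ℤ) + 1 - 2 * j)
      = 2 * r * t - (t : ℤ) ^ 2 := by
    intro t
    induction t with
    | zero => simp
    | succ t ih => rw [Finset.sum_Icc_succ_top (by omega), ih]; push_cast; ring
  rw [RowMesh.size_formula h hs hpos hper]
  · congr 1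
    refine Finset.sum_congr rfl fun i _ => ?_
    have h1 := two_mul_sum_Icc (2 * r)
    simp only [hm]
    rw [hrow, hm']
    push_cast at h1 ⊢
    linarith
  · intro i j hj hji
    rw [hm]
    have := hs i
    omega

/-! ### Numbers of polygons -/

/-- There is a Delaunay mesh of size `n` with all angles at least `2π / k` that is respected by at
least `W ^ k` convex polygons, where `n ≤ C W ^ 2`. -/
def HasManyPolygons (k n C : ℕ) : Prop :=
  ∃ G : PlaneGraph, G.IsMesh ∧ G.size = n ∧ (∀ δ ≤ wedgeAngle k, G.IsFat δ) ∧ G.IsDelaunay ∧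
    ∃ W : ℕ, n ≤ C * W ^ 2 ∧ W ^ k ≤ G.convexPolygons.ncard

lemma RowMesh.Sliced.hasManyPolygons {k : ℕ} (hk : 6 ≤ k) {R : RowMesh k} {b : ℕ} {s : ℕ → ℕ}
    (hang : ∀ t ∈ R.tris, AnglesBetween (wedgeAngle k) t)
    (h : R.Sliced b) (hs : ∀ i, b + s i < R.M) (hpos : ∀ i, 0 < b + s i)
    {n C W lo : ℕ} (hsize : (h.isTriangulation hs hpos).toPlaneGraph.size = n)
    (hn : n ≤ C * W ^ 2) (hlo : 0 < b + lo) (hW : ∀ i, lo + W ≤ s i + 1)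
    (hwin : ∀ i < W, ∀ j < W,
      R.X (b + (lo + i)) * Real.cos (wedgeAngle k) < R.X (b + (lo + j))) :
    HasManyPolygons k n C := by
  have hT := h.isTriangulation hs hpos
  have hne := polyTris_nonempty hT hs
  have hang' : ∀ t ∈ R.polyTris b s, AnglesBetween (wedgeAngle k) t := fun t ht => hang t ht.1
  have hle : wedgeAngle k ≤ Real.pi / 2 := by
    have := wedgeAngle_anti (by norm_num) hk
    rw [wedgeAngle_six] at this
    linarith [Real.pi_pos]
  refine ⟨hT.toPlaneGraph, hT.isMesh hne, hsize,
    fun δ hδ => hT.isFat hδ (wedgeAngle_pos hk).le hle hang',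
    hT.isDelaunay hne fun t ht a b c e => (hang' t ht a b c e).1, W, hn, ?_⟩
  exact RowMesh.pow_le_ncard_convexPolygons (by omega) h hs hpos hlo hW hwin

/-- Rows whose distances from the origin differ by a factor less than `1 + rowGap k` bound a polygon
with `k` nondegenerate sides. -/
lemma window_of_scaled {k : ℕ} (hk : 6 ≤ k) {r x y : ℕ} (hx : x < r) {X Y : ℝ}
    (hX : X * wedgeTan k = r + rowGap k * x) (hY : Y * wedgeTan k = r + rowGap k * y) :
    X * Real.cos (wedgeAngle k) < Y := by
  have hτ := wedgeTan_pos (show 3 ≤ k by omega)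
  have ha := rowGap_pos hk
  have hc := cos_wedge_pos hk
  refine lt_of_mul_lt_mul_right ?_ hτ.le
  have hx' : (x : ℝ) < r := by exact_mod_cast hx
  have h1 : X * wedgeTan k < r * (1 + rowGap k) := by
    rw [hX]; have := mul_lt_mul_of_pos_left hx' ha; linarith
  calc X * Real.cos (wedgeAngle k) * wedgeTan k
      = X * wedgeTan k * Real.cos (wedgeAngle k) := by ring
    _ < r * (1 + rowGap k) * Real.cos (wedgeAngle k) := by gcongr
    _ = r := by linear_combination r * cos_mul_rowGap hk
    _ ≤ Y * wedgeTan k := by rw [hY]; have : 0 ≤ rowGap k * y := by positivity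
                             linarith

lemma fineMesh_hasManyPolygons {k : ℕ} (hk : 8 ≤ k) {r : ℕ} (hr : 0 < r) {s : ℕ → ℕ}
    (hs : ∀ i, s i < r) (hper : ∀ i, s (i + k) = s i) {n C W : ℕ}
    (hsize : (n : ℤ) = 1 + ∑ i ∈ Finset.range k,
        ((r : ℤ) * (2 * r + 1) + 2 * r * s i - s i ^ 2 + s i * s (i + 1)))
    (hn : n ≤ C * W ^ 2) (hW : ∀ i, W ≤ s i + 1) : HasManyPolygons k n C := by
  have hk6 : 6 ≤ k := by omega
  have hsl := fineMesh_sliced hk6 hr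
  have hs' : ∀ i, 2 * r + s i < 3 * r := fun i => by have := hs i; omega
  have hpos : ∀ i, 0 < 2 * r + s i := fun i => by omega
  refine RowMesh.Sliced.hasManyPolygons hk6 (fineMesh_anglesBetween hk hr) hsl hs' hpos (lo := 0)
    ?_ hn (by omega) (fun i => by have := hW i; omega) ?_
  · have := fineMesh_size hk6 hr hsl hs' hpos hper
    rw [← hsize] at this
    exact_mod_cast this
  · have hτ := wedgeTan_pos (show 3 ≤ k by omega)
    have hX : ∀ j : ℕ, (fineMesh hk6 r hr).X (2 * r + (0 + j)) * wedgeTan k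
        = r + rowGap k * j := by
      intro j
      simp only [fineMesh]
      rw [div_mul_cancel₀ _ hτ.ne', Nat.add_sub_cancel_left, min_eq_right (by omega), zero_add]
      push_cast; ring
    intro i hi j hj
    have := hW 0
    have := hs 0
    exact window_of_scaled hk6 (by omega) (hX i) (hX j)

lemma coarseMesh_hasManyPolygons {k : ℕ} (hk : 6 ≤ k) (hk' : k ≤ 8) {r : ℕ} (hr : 0 < r)
    {s : ℕ → ℕ} (hs : ∀ i, s i < r) (hper : ∀ i, s (i + k) = s i) {n C W : ℕ}
    (hsize : 2 * (n : ℤ) = 2 + ∑ i ∈ Finset.range k,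
        ((r : ℤ) * (r + 1) + (2 * r + 1) * s i - s i ^ 2 + 2 * (s i * s (i + 1))))
    (hn : n ≤ C * W ^ 2) (hW : ∀ i, W ≤ s i + 1) : HasManyPolygons k n C := by
  have hsl := coarseMesh_sliced hk (show r < 2 * r by omega) (Or.inr le_rfl)
  have hs' : ∀ i, r + s i < 2 * r := fun i => by have := hs i; omega
  have hpos : ∀ i, 0 < r + s i := fun i => by omega
  refine RowMesh.Sliced.hasManyPolygons hk
    (coarseMesh_anglesBetween hk hk' (by omega) (Or.inr le_rfl)) hsl hs' hpos (lo := 0)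
    ?_ hn (by omega) (fun i => by have := hW i; omega) ?_
  · have := coarseMesh_size hk (by omega) hsl hs' hpos hper (fun i => Or.inl (hs i).le)
    rw [← hsize] at this
    exact_mod_cast mul_left_cancel₀ two_ne_zero this
  · have hτ := wedgeTan_pos (show 3 ≤ k by omega)
    have hX : ∀ j : ℕ, (coarseMesh hk r (2 * r) (by omega)).X (r + (0 + j)) * wedgeTan k
        = r + rowGap k * j := by
      intro j
      simp only [coarseMesh]
      rw [div_mul_cancel₀ _ hτ.ne', Nat.add_sub_cancel_left, zero_add]
      push_cast; ring
    intro i hi j hj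
    have := hW 0
    have := hs 0
    exact window_of_scaled hk (by omega) (hX i) (hX j)

/-- For `k = 6` all rows extend through the whole mesh, which is part of a triangular lattice. -/
lemma triangularLattice_hasManyPolygons {s : ℕ → ℕ} (hpos : ∀ i, 0 < s i)
    (hper : ∀ i, s (i + 6) = s i) (hv : ∀ i, s i ≤ 1 + s (i + 1) + s (i + 5)) {n C W : ℕ}
    (hsize : 2 * (n : ℤ) = 2 + ∑ i ∈ Finset.range 6, (s i - s i ^ 2 + 2 * (s i * s (i + 1) : ℤ)))
    (hn : n ≤ C * W ^ 2) (hW0 : 0 < W) (hW : ∀ i, 2 * W ≤ s i + 1) : HasManyPolygons 6 n C := by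
  have hbdd : ∃ M, 0 < M ∧ ∀ i, s i < M := by
    refine ⟨∑ i ∈ Finset.range 6, s i + 1, by omega, fun i => ?_⟩
    rw [← Function.Periodic.map_mod_nat hper i]
    exact Nat.lt_succ_of_le (Finset.single_le_sum (f := s) (fun _ _ => Nat.zero_le _)
      (Finset.mem_range.2 (Nat.mod_lt i (by norm_num))))
  obtain ⟨M, hM, hsM⟩ := hbdd
  have hsl := coarseMesh_sliced (k := 6) le_rfl hM (Or.inl ⟨rfl, rfl⟩)
  have hs' : ∀ i, 0 + s i < M := fun i => by rw [zero_add]; exact hsM i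
  have hpos' : ∀ i, 0 < 0 + s i := fun i => by rw [zero_add]; exact hpos i
  refine RowMesh.Sliced.hasManyPolygons le_rfl
    (coarseMesh_anglesBetween le_rfl (by norm_num) hM (Or.inl rfl)) hsl hs' hpos' (lo := W)
    ?_ hn (by omega) (fun i => by have := hW i; omega) ?_
  · have := coarseMesh_size le_rfl hM hsl hs' hpos' hper (fun i => by
      have := hv i
      change s i ≤ 0 ∨ s i ≤ 0 + 1 + s (i + 1) + s (i + 5)
      omega)
    have e : 2 * (n : ℤ) = 2 * ((hsl.isTriangulation hs' hpos').toPlaneGraph.size : ℤ) := by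
      rw [this, hsize]
      congr 1
      refine Finset.sum_congr rfl fun i _ => ?_
      push_cast; ring
    exact_mod_cast (mul_left_cancel₀ two_ne_zero e).symm
  · have hτ := wedgeTan_pos (show 3 ≤ 6 by norm_num)
    intro i hi j hj
    simp only [coarseMesh, rowGap_six]
    rw [wedgeAngle_six, Real.cos_pi_div_three, div_mul_eq_mul_div]
    refine div_lt_div_of_pos_right ?_ hτ
    have : ((W + i : ℕ) : ℝ) < 2 * (W + j : ℕ) := by exact_mod_cast (by omega)
    push_cast at this ⊢
    linarith

/-! ### Meshes of every size -/

/-- A form of the four squares theorem: four integers with even sum represent each `D ≥ 1`. -/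
lemma exists_sq_add_eq {D : ℕ} (hD : 1 ≤ D) :
    ∃ a b c d e : ℤ, a + b + c + d = 2 * e ∧ a ^ 2 + b ^ 2 + c ^ 2 + d ^ 2 + d + 1 = D := by
  have fin : ∀ a b c d : ℤ, a ^ 2 + b ^ 2 + c ^ 2 + d ^ 2 + d + 1 = D →
      ∃ a b c d e : ℤ, a + b + c + d = 2 * e ∧ a ^ 2 + b ^ 2 + c ^ 2 + d ^ 2 + d + 1 = D := by
    intro a b c d h
    rcases Int.even_or_odd' (a + b + c + d) with ⟨e, he | he⟩
    · exact ⟨a, b, c, d, e, he, h⟩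
    · -- the map `d ↦ -1 - d` preserves `d ^ 2 + d` and changes the parity
      exact ⟨a, b, c, -1 - d, e - d, by linarith, by rw [← h]; ring⟩
  obtain ⟨p, q, r, t, h⟩ := Nat.sum_four_squares (4 * (D - 1) + 1)
  have h' : (p : ℤ) ^ 2 + q ^ 2 + r ^ 2 + t ^ 2 = 4 * D - 3 := by
    have : ((p ^ 2 + q ^ 2 + r ^ 2 + t ^ 2 : ℕ) : ℤ) = ((4 * (D - 1) + 1 : ℕ) : ℤ) := by rw [h]
    push_cast [Nat.cast_sub hD] at this
    linarith
  obtain ⟨p', hp⟩ := Int.even_or_odd' (p : ℤ)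
  obtain ⟨q', hq⟩ := Int.even_or_odd' (q : ℤ)
  obtain ⟨r', hr⟩ := Int.even_or_odd' (r : ℤ)
  obtain ⟨t', ht⟩ := Int.even_or_odd' (t : ℤ)
  have sq0 : ∀ x : ℤ, (2 * x) ^ 2 = 4 * x ^ 2 := fun x => by ring
  have sq1 : ∀ x : ℤ, (2 * x + 1) ^ 2 = 4 * (x ^ 2 + x) + 1 := fun x => by ring
  -- squares are `0` or `1` modulo `4`, so that exactly one of the numbers is odd
  rcases hp with hp | hp <;> rcases hq with hq | hq <;> rcases hr with hr | hr <;>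
    rcases ht with ht | ht <;> rw [hp, hq, hr, ht] at h' <;> simp only [sq0, sq1] at h' <;>
    first
    | exact absurd h' (by omega)
    | exact fin p' q' r' t' (by linarith)
    | exact fin p' q' t' r' (by linarith)
    | exact fin p' r' t' q' (by linarith)
    | exact fin q' r' t' p' (by linarith)

/-- For `k ≥ 8`, moving the sides of a polygon a little realizes each number of vertices up to a
defect given by the four squares theorem. -/
lemma fine_exact {k : ℕ} (hk : 8 ≤ k) {r u B n C W D : ℕ}
    (hD : n + D = 1 + k * (r * (2 * r + 1)) + 2 * r * (k * u + 7)) (hD1 : 1 ≤ D)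
    (hDB : D ≤ B ^ 2) (hW : W + 4 * B ≤ u) (hur : u + 4 * B + 1 < r) (hn : n ≤ C * W ^ 2) :
    HasManyPolygons k n C := by
  obtain ⟨a, b, c, d, e, he, hsq⟩ := exists_sq_add_eq hD1
  obtain ⟨f, rfl⟩ := Nat.exists_eq_add_of_le hk
  have hDB' : (D : ℤ) ≤ (B : ℤ) ^ 2 := by exact_mod_cast hDB
  have hB : (0 : ℤ) ≤ B := by positivity
  have hdd : 0 ≤ d ^ 2 + d := by
    rcases le_or_gt 0 d with h | h
    · positivity
    · nlinarith
  have ba := abs_le.1 (abs_le_of_sq_le_sq (show a ^ 2 ≤ (B : ℤ) ^ 2 by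
    linarith [sq_nonneg b, sq_nonneg c]) hB)
  have bb := abs_le.1 (abs_le_of_sq_le_sq (show b ^ 2 ≤ (B : ℤ) ^ 2 by
    linarith [sq_nonneg a, sq_nonneg c]) hB)
  have bc := abs_le.1 (abs_le_of_sq_le_sq (show c ^ 2 ≤ (B : ℤ) ^ 2 by
    linarith [sq_nonneg a, sq_nonneg b]) hB)
  have hd2 : d ^ 2 + d < (B : ℤ) ^ 2 := by
    linarith [sq_nonneg a, sq_nonneg b, sq_nonneg c]
  have bd1 : -(B : ℤ) ≤ d := by
    by_contra hcon
    have h1 : d + 1 ≤ -(B : ℤ) := by omega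
    nlinarith
  have bd2 : d ≤ B := by
    by_contra hcon
    have h1 : (B : ℤ) + 1 ≤ d := by omega
    nlinarith
  -- the entries have the sum `7`, and the cyclic sum of `x i ^ 2 - x i * x (i + 1)` is `D`
  let x : ℕ → ℤ := fun i =>
    [1 + e, 1 + a, 1 + a + b - e, 1, 1 + c - e, 1 - a, 1 + d - e].getD i 0
  have hx7 : ∀ i, x (7 + i) = 0 := fun i => by simp [x, Nat.add_comm 7 i]
  have hx : ∀ i, -(4 * B : ℤ) ≤ x i ∧ x i ≤ 4 * B + 1 := by
    intro i
    rcases Nat.lt_or_ge i 7 with h | h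
    · interval_cases i <;> simp only [x, List.getD_cons_zero, List.getD_cons_succ] <;>
        constructor <;> linarith
    · obtain ⟨j, rfl⟩ := Nat.exists_eq_add_of_le h
      rw [hx7]; constructor <;> linarith
  let s : ℕ → ℕ := fun i => (u + x (i % (8 + f))).toNat
  have hs : ∀ i, (s i : ℤ) = u + x (i % (8 + f)) := by
    intro i
    have := hx (i % (8 + f))
    exact Int.toNat_of_nonneg (by omega)
  have hs' : ∀ i, i < 8 + f → (s i : ℤ) = u + x i := by
    intro i hi
    rw [hs, Nat.mod_eq_of_lt hi]
  refine fineMesh_hasManyPolygons hk (r := r) (s := s) (W := W) (by omega) ?_ ?_ ?_ hn ?_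
  · intro i
    have h1 := hs i
    have := hx (i % (8 + f))
    omega
  · intro i
    simp only [s, Nat.add_mod_right]
  · have hlast : (s (7 + f + 1) : ℤ) = u + x 0 := by
      rw [hs, show 7 + f + 1 = 8 + f by omega, Nat.mod_self]
    have hmid : ∀ i ∈ Finset.range f, ((r : ℤ) * (2 * r + 1) + 2 * r * s (7 + i)
        - (s (7 + i) : ℤ) ^ 2 + s (7 + i) * s (7 + i + 1)) = r * (2 * r + 1) + 2 * r * u := by
      intro i hi
      have hi' := Finset.mem_range.1 hi
      rw [hs' _ (by omega), hs' _ (by omega), hx7, Nat.add_assoc, hx7]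
      ring
    rw [show 8 + f = 7 + (f + 1) by omega, Finset.sum_range_add, Finset.sum_range_succ _ f,
      Finset.sum_congr rfl hmid, Finset.sum_const, Finset.card_range, nsmul_eq_mul,
      hlast, hs' (7 + f) (by omega), hx7]
    simp only [Finset.sum_range_succ, Finset.sum_range_zero, Nat.reduceAdd, zero_add]
    rw [hs' 0 (by omega), hs' 1 (by omega), hs' 2 (by omega), hs' 3 (by omega), hs' 4 (by omega),
      hs' 5 (by omega), hs' 6 (by omega), hs' 7 (by omega)]
    simp only [x, List.getD_cons_zero, List.getD_cons_succ, List.getD_nil]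
    have hD' : (n : ℤ) + D = 1 + (8 + f) * (r * (2 * r + 1)) + 2 * r * ((8 + f) * u + 7) := by
      exact_mod_cast hD
    have he' : d = 2 * e - a - b - c := by linarith
    subst he'
    linear_combination hD' + hsq
  · intro i
    have h1 := hs i
    have := hx (i % (8 + f))
    omega

/-- For `k ≥ 8`, a mesh with all sides at row distance `u ≈ r / 2` has about `3 k r ^ 2` vertices.
The parameter `u` is chosen such that the defect is at most `2 k r + 1`, which is a small multiple
of `r ^ 2` and can be removed by `fine_exact`. -/
lemma exists_fine_parameters {k n : ℕ} (hk : 8 ≤ k) (hn : 3 * k * (4000 * k) ^ 2 ≤ n) :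
    HasManyPolygons k n (75 * k) := by
  set r := Nat.sqrt (n / (3 * k)) + 1 with hr
  have h1 : (r - 1) ^ 2 ≤ n / (3 * k) := by rw [hr, Nat.add_sub_cancel]; exact Nat.sqrt_le' _
  have h2 : n / (3 * k) < r ^ 2 := Nat.lt_succ_sqrt' _
  have h1' : 3 * k * (r - 1) ^ 2 ≤ n :=
    (Nat.mul_le_mul_left _ h1).trans (Nat.mul_div_le n (3 * k))
  have h2' : n < 3 * k * r ^ 2 := by
    rw [mul_comm]; exact (Nat.div_lt_iff_lt_mul (by omega)).1 h2
  have h3 : 4000 * k < r := by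
    rw [hr]
    refine Nat.lt_succ_of_le (Nat.le_sqrt'.2 ?_)
    exact (Nat.le_div_iff_mul_le (by omega)).2 (by rw [mul_comm]; exact hn)
  obtain ⟨v, hv⟩ : ∃ v, r = v + 1 := ⟨r - 1, by omega⟩
  have h1z : 3 * (k : ℤ) * ((r : ℤ) - 1) ^ 2 ≤ n := by
    rw [hv] at h1' ⊢
    rw [Nat.add_sub_cancel] at h1'
    push_cast
    rw [add_sub_cancel_right]
    exact_mod_cast h1'
  have h2z : (n : ℤ) < 3 * k * (r : ℤ) ^ 2 := by exact_mod_cast h2'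
  have hkz : (8 : ℤ) ≤ k := by exact_mod_cast hk
  have hrz : 4000 * (k : ℤ) < r := by exact_mod_cast h3
  have hkr : (0 : ℤ) < k * r := by positivity
  -- the number of vertices that are missing with all sides at distance zero
  set T : ℤ := n - k * r * (2 * r + 1) - 14 * r with hT
  set uz : ℤ := T / (2 * (k * r)) + 1 with huz
  have e1 := Int.mul_ediv_add_emod T (2 * (k * r))
  have e2 := Int.emod_nonneg T (show 2 * ((k : ℤ) * r) ≠ 0 by positivity)
  have e3 := Int.emod_lt_of_pos T (show 0 < 2 * ((k : ℤ) * r) by positivity)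
  have hu1 : T < 2 * (k * r) * uz := by rw [huz, mul_add]; linarith
  have hu2 : 2 * (k * r) * uz ≤ T + 2 * (k * r) := by rw [huz, mul_add]; linarith
  have hu3 : 2 * uz ≤ r := by
    have : (k * r : ℤ) * (2 * uz) < k * r * (r + 1) := by
      have : T < k * r * r - k * r := by rw [hT]; linarith
      linarith
    have := lt_of_mul_lt_mul_left this hkr.le
    omega
  have hu4 : (r : ℤ) - 9 < 2 * uz := by
    have : (k * r : ℤ) * (r - 9) < k * r * (2 * uz) := by
      have : (k * r : ℤ) * (r - 9) ≤ T := by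
        have : 8 * (r : ℤ) ≤ k * r := by gcongr
        rw [hT]; linarith
      linarith
    exact lt_of_mul_lt_mul_left this hkr.le
  obtain ⟨u, hu⟩ : ∃ u : ℕ, uz = u := ⟨uz.toNat, by omega⟩
  obtain ⟨D, hD⟩ : ∃ D : ℕ, 1 + 2 * (k * r) * uz - T = D :=
    ⟨(1 + 2 * (k * r) * uz - T).toNat, by omega⟩
  rw [hu] at hu3 hu4 hD
  -- this is where `r > 4000 k` is needed; with perturbations up to `4 (r / 40) + 1`, all sides
  -- stay between the rows `r / 4` and `r`
  have hB : 2 * (k * r) + 1 ≤ (r / 40) ^ 2 := by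
    have b1 : 99 * k ≤ r / 40 := by omega
    have b2 : r ≤ 41 * (r / 40) := by omega
    calc 2 * (k * r) + 1 ≤ 2 * (k * (41 * (r / 40))) + 1 := by gcongr
      _ ≤ 99 * k * (r / 40) := by nlinarith
      _ ≤ (r / 40) ^ 2 := by rw [pow_two]; gcongr
  refine fine_exact hk (r := r) (u := u) (B := r / 40) (W := r / 4) (D := D) ?_ ?_ ?_ ?_ ?_ ?_
  · zify
    rw [← hD, hT]; ring
  · rw [hu] at hu1; omega
  · refine le_trans ?_ hB
    zify
    rw [hu] at hu2
    linarith
  · omega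
  · omega
  · have b2 : r ≤ 5 * (r / 4) := by omega
    calc n ≤ 3 * k * r ^ 2 := h2'.le
      _ ≤ 3 * k * (5 * (r / 4)) ^ 2 := by gcongr
      _ = 75 * k * (r / 4) ^ 2 := by ring

/-- The values of a list, repeated periodically. -/
def cyclic (l : List ℕ) (i : ℕ) : ℕ := l.getD (i % l.length) 0

lemma cyclic_period (l : List ℕ) (i : ℕ) : cyclic l (i + l.length) = cyclic l i := by
  simp [cyclic]

lemma cyclic_mem {l : List ℕ} (hl : l ≠ []) (i : ℕ) : cyclic l i ∈ l := by
  have h : i % l.length < l.length := Nat.mod_lt _ (List.length_pos_iff.2 hl)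
  rw [cyclic, List.getD_eq_getElem _ _ h]
  exact List.getElem_mem h

/-- For `k = 7` and `r = 8 w`, the polygon with the rows
`w + a - m, w + a, 2 w + m, 7 w - a, 7 w - a, 2 w, 2 w + 1` contains
`430 w ^ 2 + 48 w + 1 + a + m (4 w - 1) - m ^ 2` vertices, which is linear in `a`. -/
lemma exists_heptagon_parameters {n : ℕ} (hn : 430 * 45000 ^ 2 + 48 * 45000 + 1 ≤ n) :
    HasManyPolygons 7 n 5400 := by
  let P : ℕ → Prop := fun w => 430 * w ^ 2 + 48 * w + 1 ≤ n
  have : DecidablePred P := fun w => by unfold P; infer_instance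
  obtain ⟨w, hw⟩ : ∃ w, w = Nat.findGreatest P n := ⟨_, rfl⟩
  have hPw : P w := by
    rw [hw]; exact Nat.findGreatest_spec (m := 45000) (by omega) hn
  have hw0 : 45000 ≤ w := by
    rw [hw]; exact Nat.le_findGreatest (by omega) hn
  have hPw' : n < 430 * (w + 1) ^ 2 + 48 * (w + 1) + 1 := by
    rcases Nat.lt_or_ge n (w + 1) with h | h
    · nlinarith
    · exact not_le.1 (Nat.findGreatest_is_greatest (P := P) (show Nat.findGreatest P n < w + 1 by
        omega) h)
  have hPw2 : 430 * w ^ 2 + 48 * w + 1 ≤ n := hPw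
  obtain ⟨t, ht⟩ := Nat.exists_eq_add_of_le hPw2
  have ht' : t < 860 * w + 478 := by nlinarith
  obtain ⟨m, hm⟩ : ∃ m, m = t / (4 * w - 1) := ⟨_, rfl⟩
  have hm1 : m ≤ 300 := by
    rw [hm]
    refine Nat.le_of_lt_succ ((Nat.div_lt_iff_lt_mul (by omega)).2 ?_)
    omega
  have e1 := Nat.div_add_mod t (4 * w - 1)
  have e2 := Nat.mod_lt t (show 0 < 4 * w - 1 by omega)
  rw [← hm] at e1
  obtain ⟨a, ha⟩ : ∃ a, a = t % (4 * w - 1) + m ^ 2 := ⟨_, rfl⟩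
  have hm2 : m ^ 2 ≤ 300 ^ 2 := by gcongr
  have ha' : a ≤ 6 * w := by omega
  have hlen : ∀ x₀ x₁ x₂ x₃ x₄ x₅ x₆ : ℕ, [x₀, x₁, x₂, x₃, x₄, x₅, x₆].length = 7 :=
    fun _ _ _ _ _ _ _ => rfl
  refine coarseMesh_hasManyPolygons (k := 7) (by norm_num) (by norm_num) (r := 8 * w) (by omega)
    (s := cyclic [w + a - m, w + a, 2 * w + m, 7 * w - a, 7 * w - a, 2 * w, 2 * w + 1])
    (W := w / 2) ?_ (cyclic_period _) ?_ ?_ ?_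
  · intro i
    have := cyclic_mem (List.cons_ne_nil _ _ : [w + a - m, w + a, 2 * w + m, 7 * w - a, 7 * w - a,
      2 * w, 2 * w + 1] ≠ []) i
    simp only [List.mem_cons, List.not_mem_nil, or_false] at this
    omega
  · have hz : (n : ℤ) = 430 * w ^ 2 + 48 * w + 1 + a + m * (4 * w - 1) - m ^ 2 := by
      have : (((4 * w - 1) * m + t % (4 * w - 1) : ℕ) : ℤ) = t := by rw [e1]
      rw [Nat.cast_add, Nat.cast_mul, Nat.cast_sub (by omega)] at this
      rw [ht, ha]
      push_cast at this ⊢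
      linarith
    simp only [Finset.sum_range_succ, Finset.sum_range_zero, cyclic, hlen]
    norm_num only [List.getD_cons_zero, List.getD_cons_succ]
    rw [Nat.cast_sub (show m ≤ w + a by omega), Nat.cast_sub (show a ≤ 7 * w by omega), hz]
    push_cast
    ring
  · have b1 : w ≤ 3 * (w / 2) := by omega
    calc n ≤ 430 * (w + 1) ^ 2 + 48 * (w + 1) + 1 := hPw'.le
      _ ≤ 600 * w ^ 2 := by
        have : 45000 * w ≤ w * w := Nat.mul_le_mul_right w hw0
        linarith
      _ ≤ 600 * (3 * (w / 2)) ^ 2 := by gcongr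
      _ = 5400 * (w / 2) ^ 2 := by ring
  · intro i
    have := cyclic_mem (List.cons_ne_nil _ _ : [w + a - m, w + a, 2 * w + m, 7 * w - a, 7 * w - a,
      2 * w, 2 * w + 1] ≠ []) i
    simp only [List.mem_cons, List.not_mem_nil, or_false] at this
    omega

/-- Triangular numbers represent all residues modulo a power of two. -/
lemma exists_triangular_residue (n K : ℕ) :
    ∃ p < 2 ^ K, ∃ h, 2 * n + p * (p + 1) = 2 * 2 ^ K * h := by
  have hex : ∀ K : ℕ, ∃ p : ℕ, (2 : ℤ) ^ (K + 1) ∣ 2 * n + p * (p + 1) := by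
    intro K
    induction K with
    | zero => exact ⟨0, by simp⟩
    | succ K ih =>
      obtain ⟨p, c, hc⟩ := ih
      rcases Int.even_or_odd' c with ⟨d, rfl | rfl⟩
      · exact ⟨p, d, by rw [hc]; ring⟩
      · refine ⟨p + 2 ^ (K + 1), d + p + 1 + 2 ^ K, ?_⟩
        push_cast
        linear_combination hc
  obtain ⟨p, hp⟩ := hex K
  have hQ : (0 : ℤ) < 2 ^ (K + 1) := by positivity
  set Q : ℕ := 2 ^ (K + 1) with hQdef
  have hQ2 : Q = 2 * 2 ^ K := by rw [hQdef, pow_succ]; ring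
  have hQ0 : 0 < Q := by rw [hQdef]; positivity
  -- reduction to a residue, and reflection of residues in the upper half
  have hp1 : (Q : ℤ) ∣ 2 * n + (p % Q : ℕ) * ((p % Q : ℕ) + 1) := by
    have e : (p : ℤ) = (p % Q : ℕ) + Q * (p / Q : ℕ) := by exact_mod_cast (Nat.mod_add_div p Q).symm
    have hp' : (Q : ℤ) ∣ 2 * n + p * (p + 1) := by rw [hQdef]; push_cast; exact hp
    obtain ⟨c, hc⟩ := hp'
    rw [e] at hc
    refine ⟨c - (p / Q : ℕ) * (2 * (p % Q : ℕ) + 1 + Q * (p / Q : ℕ)), ?_⟩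
    linear_combination hc
  have hlt := Nat.mod_lt p hQ0
  have fin : ∀ q < 2 ^ K, (Q : ℤ) ∣ 2 * n + (q : ℕ) * ((q : ℕ) + 1) →
      ∃ p < 2 ^ K, ∃ h, 2 * n + p * (p + 1) = 2 * 2 ^ K * h := by
    rintro q hq hdvd
    have : Q ∣ 2 * n + q * (q + 1) := by exact_mod_cast hdvd
    obtain ⟨h, hh⟩ := this
    exact ⟨q, hq, h, by rw [hh, hQ2]⟩
  rcases Nat.lt_or_ge (p % Q) (2 ^ K) with h | h
  · exact fin _ h hp1
  · refine fin (Q - 1 - p % Q) (by omega) ?_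
    obtain ⟨c, hc⟩ := hp1
    have e : ((Q - 1 - p % Q : ℕ) : ℤ) = Q - 1 - (p % Q : ℕ) := by
      rw [Nat.cast_sub (by omega), Nat.cast_sub (by omega)]; push_cast; ring
    rw [e]
    refine ⟨c + Q - 1 - 2 * (p % Q : ℕ), ?_⟩
    linear_combination hc

/-- For `k = 6`, a parallelogram of the triangular lattice with a side of length `2 ^ K`, whose
acute corner is cut off, has every number of vertices. -/
lemma exists_hexagon_parameters {n : ℕ} (hn : 4 ^ 4 ≤ n) : HasManyPolygons 6 n 1024 := by
  have hlog : 4 ≤ Nat.log 4 n := Nat.le_log_of_pow_le (by norm_num) hn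
  obtain ⟨K, hK⟩ : ∃ K, Nat.log 4 n = K + 4 := ⟨Nat.log 4 n - 4, by omega⟩
  have h1 : 4 ^ (K + 4) ≤ n := by
    rw [← hK]; exact Nat.pow_log_le_self 4 (by positivity)
  have h2 : n < 4 ^ (K + 5) := by
    have := Nat.lt_pow_succ_log_self (show 1 < 4 by norm_num) n
    rwa [hK] at this
  obtain ⟨p, hp, h, hh⟩ := exists_triangular_residue n (K + 2)
  set q := 2 ^ K with hq
  have hq0 : 0 < q := by rw [hq]; positivity
  have e4 : 4 ^ K = q ^ 2 := by rw [hq, ← pow_mul, mul_comm, pow_mul]; norm_num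
  have eL : 2 ^ (K + 2) = 4 * q := by rw [pow_add, hq]; ring
  rw [pow_add, e4] at h1 h2
  rw [eL] at hp hh
  have hh64 : 64 * q ≤ h := by
    by_contra hcon
    have h3 : h + 1 ≤ 64 * q := by omega
    nlinarith
  refine triangularLattice_hasManyPolygons
    (s := cyclic [2 * q - 1, h - 1 - 8 * q, h - 1 - 6 * q, 2 * q, 8 * q, 10 * q - 1 - p])
    (W := q) ?_ (cyclic_period _) ?_ ?_ (by linarith) hq0 ?_
  · intro i
    have := cyclic_mem (List.cons_ne_nil _ _ : [2 * q - 1, h - 1 - 8 * q, h - 1 - 6 * q, 2 * q,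
      8 * q, 10 * q - 1 - p] ≠ []) i
    simp only [List.mem_cons, List.not_mem_nil, or_false] at this
    omega
  · intro i
    have hi : i % 6 < 6 := Nat.mod_lt _ (by norm_num)
    simp only [cyclic, List.length_cons, List.length_nil, Nat.reduceAdd]
    rw [Nat.add_mod i 1, Nat.add_mod i 5]
    generalize i % 6 = j at hi
    interval_cases j <;>
      norm_num only [List.getD_cons_zero, List.getD_cons_succ] <;> omega
  · have hz : 2 * (n : ℤ) + p * (p + 1) = 2 * (4 * q) * h := by exact_mod_cast hh
    have c1 : ((2 * q - 1 : ℕ) : ℤ) = 2 * q - 1 := by rw [Nat.cast_sub (by omega)]; push_cast; ring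
    have c2 : ((h - 1 - 8 * q : ℕ) : ℤ) = h - 1 - 8 * q := by
      rw [Nat.cast_sub (by omega), Nat.cast_sub (by omega)]; push_cast; ring
    have c3 : ((h - 1 - 6 * q : ℕ) : ℤ) = h - 1 - 6 * q := by
      rw [Nat.cast_sub (by omega), Nat.cast_sub (by omega)]; push_cast; ring
    have c4 : ((10 * q - 1 - p : ℕ) : ℤ) = 10 * q - 1 - p := by
      rw [Nat.cast_sub (by omega), Nat.cast_sub (by omega)]; push_cast; ring
    simp only [Finset.sum_range_succ, Finset.sum_range_zero, cyclic, List.length_cons,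
      List.length_nil, Nat.reduceAdd]
    norm_num only [List.getD_cons_zero, List.getD_cons_succ]
    rw [c1, c2, c3, c4]
    push_cast
    linear_combination hz
  · intro i
    have := cyclic_mem (List.cons_ne_nil _ _ : [2 * q - 1, h - 1 - 8 * q, h - 1 - 6 * q, 2 * q,
      8 * q, 10 * q - 1 - p] ≠ []) i
    simp only [List.mem_cons, List.not_mem_nil, or_false] at this
    omega

theorem eventually_hasManyPolygons {k : ℕ} (hk : 6 ≤ k) :
    ∃ C > 0, ∃ N, ∀ n ≥ N, HasManyPolygons k n C := by
  rcases Nat.lt_or_ge k 8 with h | h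
  · interval_cases k
    · exact ⟨1024, by norm_num, _, fun n hn => exists_hexagon_parameters hn⟩
    · exact ⟨5400, by norm_num, _, fun n hn => exists_heptagon_parameters hn⟩
  · exact ⟨75 * k, by omega, _, fun n hn => exists_fine_parameters h hn⟩

theorem mainTheorem3 (δ : ℝ) (hδ : 0 < δ) (hδ' : δ ≤ Real.pi / 3) :
    ∃ C : ℝ, 0 < C ∧ ∃ N : ℕ, ∀ n : ℕ, N ≤ n →
      ∃ M : PlaneGraph, M.IsMesh ∧ M.size = n ∧ M.IsFat δ ∧ M.IsDelaunay ∧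
        C * (n : ℝ) ^ ((1 / 2 : ℝ) * (⌊2 * Real.pi / δ⌋₊ : ℝ)) ≤ (M.convexPolygons.ncard : ℝ) := by
  have hpi := Real.pi_pos
  set k := ⌊2 * Real.pi / δ⌋₊ with hkdef
  have hk : 6 ≤ k := by
    refine Nat.le_floor ?_
    rw [le_div_iff₀ hδ]
    push_cast
    linarith
  have hk0 : (0 : ℝ) < k := by exact_mod_cast (show 0 < k by omega)
  have hδk : δ ≤ wedgeAngle k := by
    have h1 : (k : ℝ) ≤ 2 * Real.pi / δ := Nat.floor_le (by positivity)
    rw [le_div_iff₀ hδ] at h1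
    rw [wedgeAngle, le_div_iff₀ hk0]
    linarith
  obtain ⟨A, hA, N, hN⟩ := eventually_hasManyPolygons hk
  have hA' : (0 : ℝ) < A := by exact_mod_cast hA
  refine ⟨((A : ℝ) ^ ((1 / 2 : ℝ) * k))⁻¹, by positivity, N, fun n hn => ?_⟩
  obtain ⟨G, h1, h2, h3, h4, W, h5, h6⟩ := hN n hn
  refine ⟨G, h1, h2, h3 δ hδk, h4, ?_⟩
  rw [inv_mul_le_iff₀ (by positivity)]
  have h5' : (n : ℝ) ≤ A * (W : ℝ) ^ 2 := by exact_mod_cast h5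
  have h6' : (W : ℝ) ^ k ≤ G.convexPolygons.ncard := by exact_mod_cast h6
  calc (n : ℝ) ^ ((1 / 2 : ℝ) * k) ≤ (A * (W : ℝ) ^ 2) ^ ((1 / 2 : ℝ) * k) := by gcongr
    _ = (A : ℝ) ^ ((1 / 2 : ℝ) * k) * (W : ℝ) ^ k := by
        rw [Real.mul_rpow hA'.le (by positivity), ← Real.rpow_natCast (W : ℝ) 2,
          ← Real.rpow_mul (by positivity), ← Real.rpow_natCast (W : ℝ) k]
        congr 2
        push_cast; ring
    _ ≤ _ := by gcongr
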